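/- **Setting.** Let $\mathfrak g$ be a finite-dimensional real Lie algebra of compact type with basis $\xi_a$ and totally antisymmetric real structure constants, $i[\xi_a,\xi_b]=\sum_c f_{abc}\xi_c$ (physicists' convention: $\xi_a$ is hermitean in unitary representations, the Lie bracket is $i[\cdot,\cdot]$), and $\langle\xi_a|\xi_b\rangle=\delta_{ab}$. Minkowski space $\mathbb R^{1,3}$ has the metric $\eta=\mathrm{diag}(1,-1,-1,-1)$. Let $c^\mu$ be a real vector-valued distribution on $\mathbb R^{1,3}$ with $\partial_\mu c^\mu=\delta$, supported in a closed convex salient spacelike cone $C$ (the string), and $(I_c^\mu f)(x)=\int d^4y\,c^\mu(y)f(x+y)$ the string integration, so that $I_c^\mu\partial_\mu f=-f$. Let $A_\mu=\sum_aA_\mu^a\xi_a$ be the free massless gauge potential ($\square A_\mu=0$, Feynman gauge), $F_{\mu\nu}=\partial_\mu A_\nu-\partial_\nu A_\mu$, $N=\partial^\mu A_\mu$ (so that $\partial^\mu F_{\mu\nu}=-\partial_\nu N$), $A_\mu(c)=I_c^\nu F_{\mu\nu}$ and $K_0=-\tfrac14\langle F^{\mu\nu}|F_{\mu\nu}\rangle$.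 All products are (commutative) Wick products, that is, fields are identified with the classical functionals of the field configuration. Write $\mathrm{ad}_{is}(v)=i[s,v]$. Let $\mathcal S^{\mathfrak g}$ be the smallest space of $\mathfrak g$-valued scalar fields that contains $I_c^\nu(\mathrm{ad}_{is_k}\cdots\mathrm{ad}_{is_1}(A_\nu))$ $(k\ge0)$ and $I_c^\nu(\mathrm{ad}_{is_k}\cdots\mathrm{ad}_{is_1}(\partial_\nu s_0))$ $(k\ge1)$ whenever it contains $s_0,\dots,s_k$, and let $\mathcal V^{\mathfrak g}$ be the space of $\mathfrak g$-valued vector fields spanned by $\mathrm{ad}_{is_k}\cdots\mathrm{ad}_{is_1}(A_\nu)$ and $\mathrm{ad}_{is_k}\cdots\mathrm{ad}_{is_1}(\partial_\nu s_0)$ with $k\ge0$ and $s_0,\dots,s_k\in\mathcal S^{\mathfrak g}$. For a vector field $U^\mu$, the (tree-level) obstruction map is $$\omega_U(X)(x)=i\int dx'\,O_\mu(U^\mu(x'),X(x)),\qquad O_\mu(Y(x'),X(x))=\sum_{\chi,\varphi}\frac{\partial Y}{\partial\chi}(x')\,\frac{\partial X}{\partial\varphi}(x)\,O_\mu(\chi(x'),\varphi(x)),$$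 $$O_\mu(\chi(x'),\varphi(x))=\langle T\,\partial'_\mu\chi(x')\,\varphi(x)\rangle-\partial'_\mu\langle T\,\chi(x')\,\varphi(x)\rangle ,$$ with the following conventions. The propagators are (up to $\delta_{ab}$) $\langle TA'_\mu A_\kappa\rangle=-\eta_{\mu\kappa}T_0$, $\langle TN'A_\kappa\rangle=-\partial'_\kappa T_0$, $\langle TA'_\mu N\rangle=\partial'_\mu T_0$, $\langle TN'N\rangle=0$, where $T_0=T_0(x'-x)$ and $\square T_0=-i\delta$. In the first term of $O_\mu(\chi',\varphi)$, the derivative $\partial_\mu\chi$ is taken subject to the field equations $\partial^\mu F_{\mu\nu}=-\partial_\nu N$, $\partial_{\mu}A_{\nu}-\partial_\nu A_\mu=F_{\mu\nu}$, $\partial^\mu A_\mu=N$. In the second entry, $O_\mu(Y',\cdot)$ commutes with derivatives and string integrals of $A$ and $N$ (with $N$ kept as a separate field). The elements $s\in\mathcal S^{\mathfrak g}$ are inert in the first entry, $O_\mu(s(x'),X(x))=0$, hence $O_\mu(\partial'_\nu s(x'),X(x))$ is symmetric in $\mu,\nu$; its values are otherwise an arbitrary choice of renormalization. **Proposition (YM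 dressing).** There are formal power series $\alpha_\nu\in g\,\mathcal V^{\mathfrak g}[[g]]$ and $\gamma\in g\,\mathcal S^{\mathfrak g}[[g]]$ in the coupling constant $g$ such that, for every such choice of renormalization, the mediator field $U^\mu=\langle F^{\mu\nu}|\alpha_\nu\rangle$ has the following properties. (i) Let $W=e^{i\gamma}$ and $W^{-1}=e^{-i\gamma}$, understood in any finite-dimensional representation of $\mathfrak g$ by hermitean matrices. Then $WW^{-1}=W^{-1}W=1$ with respect to the Wick product, $W$ is string-localized (for every $\varepsilon>0$, $W(x)$ depends on $A$ only in the $\varepsilon$-neighbourhood of $x+C$), and the flow $e^{\omega_U}$ generates the dressing transformations $$e^{\omega_U}(A_\mu(c))=W\big(A_\mu+ig^{-1}\partial_\mu\big)W^{-1}=WA_\mu W^{-1}+ig^{-1}W\,\partial_\mu(W^{-1}),$$ $$e^{\omega_U}(F_{\mu\nu})=\partial_\mu e^{\omega_U}(A_\nu(c))-\partial_\nu e^{\omega_U}(A_\mu(c)).$$ (ii) $\omega_U(N)=\omega_U(\partial_\kappa N)=0$, and, by the field equations, $$\partial_\mu U^\mu+\omega_U(K_0)=-\langle\partial^\nu N|\alpha_\nu\rangle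 .$$ -/

import Mathlib

open scoped Distributions LineDeriv ContDiff

noncomputable section

namespace StringYM

/-! ### Minkowski spacetime -/

/-- Minkowski spacetime with its coordinates `x 0` (time), `x 1, x 2, x 3` (space). -/
abbrev Spacetime := Fin 4 → ℝ

/-- The diagonal entries of the metric `diag(1,-1,-1,-1)`; lower and upper metric coincide. -/
def sgn (μ : Fin 4) : ℝ := if μ = 0 then 1 else -1

/-- The metric `η_{μν}`. -/
def metric (μ ν : Fin 4) : ℝ := if μ = ν then sgn μ else 0

/-- The coordinate vector in direction `μ`. -/
abbrev coordVec (μ : Fin 4) : Spacetime := Pi.single μ 1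

/-- The Euclidean length of the spatial part. -/
def spaceNorm (x : Spacetime) : ℝ := Real.sqrt (∑ i : Fin 3, x i.succ ^ 2)

/-- The partial derivative `∂_μ f`. -/
def pd {E : Type*} [NormedAddCommGroup E] [NormedSpace ℝ E] (μ : Fin 4) (f : Spacetime → E) :
    Spacetime → E :=
  fun x => fderiv ℝ f x (coordVec μ)

/-- The iterated derivative `∂^m f`. -/
def iterPd (m : Fin 4 →₀ ℕ) (f : Spacetime → ℝ) : Spacetime → ℝ :=
  (pd 0)^[m 0] ((pd 1)^[m 1] ((pd 2)^[m 2] ((pd 3)^[m 3] f)))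

/-! ### String integration -/

/-- A string function: a real vector-valued distribution `c^μ` with `∂_μ c^μ = δ`, supported in a
closed convex salient spacelike cone with apex `0` (the "string"). -/
structure StringFunction where
  /-- the cone that contains the support -/
  cone : Set Spacetime
  isClosed_cone : IsClosed cone
  convex_cone : Convex ℝ cone
  zero_mem : (0 : Spacetime) ∈ cone
  smul_mem : ∀ t : ℝ, 0 ≤ t → ∀ y ∈ cone, t • y ∈ cone
  spacelike : ∀ y ∈ cone, y ≠ 0 → |y 0| < spaceNorm y
  salient : ∀ y ∈ cone, -y ∈ cone → y = 0
  /-- the components `c^μ` -/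
  c : Fin 4 → 𝓓'((⊤ : TopologicalSpace.Opens Spacetime), ℝ)
  supported : ∀ μ, Distribution.IsVanishingOn (c μ) coneᶜ
  div_eq_delta : ∑ μ, ∂_{coordVec μ} (c μ) = Distribution.delta 0

open Classical in
/-- The value `∫ d⁴y c^μ(y) f(y)` of the distribution `c^μ` on a function `f` whose support meets
the cone in a compact set: the value on any test function that agrees with `f` near the cone. -/
def StringFunction.pair (c : StringFunction) (μ : Fin 4) (f : Spacetime → ℝ) : ℝ :=
  if h : ∃ φ : 𝓓((⊤ : TopologicalSpace.Opens Spacetime), ℝ),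
      Disjoint c.cone (tsupport (f - ⇑φ)) then c.c μ h.choose else 0

/-- String integration `(I_c^μ f)(x) = ∫ d⁴y c^μ(y) f(x + y)`. -/
def stringInt (c : StringFunction) (μ : Fin 4) (f : Spacetime → ℝ) : Spacetime → ℝ :=
  fun x => c.pair μ (fun y => f (x + y))

/-! ### Field configurations and fields -/

/-- Configurations `(A_μ^a, N^a)` of the gauge potential and of the null field. As in the
time-ordered products, `N` is kept as an independent field off shell; `N = ∂^μ A_μ` is one of the
field equations. -/
abbrev Conf (ι : Type*) := (Fin 4 → ι → Spacetime → ℝ) × (ι → Spacetime → ℝ)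

/-- Hermitean fields, realized as functionals of the classical configuration with values in
functions on spacetime; the Wick product is the pointwise product. -/
abbrev QField (ι : Type*) := Conf ι → Spacetime → ℝ

/-- Smooth functions supported in `J(B_R) - C`, where `J(B_R)` is the causal influence region of a
ball and `C` is the cone of the string. This class contains all smooth functions of spacelike
compact support, and products, derivatives and string integrals of its members. -/
def Admissible (c : StringFunction) (f : Spacetime → ℝ) : Prop :=
  ContDiff ℝ ∞ f ∧
    ∃ R : ℝ, ∀ x, f x ≠ 0 → ∃ y ∈ c.cone, spaceNorm (x + y) ≤ |(x + y) 0| + R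

/-- Off-shell configurations. -/
def configs (ι : Type*) (c : StringFunction) : Set (Conf ι) :=
  {Φ | (∀ μ a, Admissible c (Φ.1 μ a)) ∧ ∀ a, Admissible c (Φ.2 a)}

/-- On-shell configurations: `□ A_μ = 0` and `N = ∂^μ A_μ`. -/
def onShell (ι : Type*) (c : StringFunction) : Set (Conf ι) :=
  {Φ | Φ ∈ configs ι c ∧
    (∀ μ a x, ∑ ν, sgn ν * pd ν (pd ν (Φ.1 μ a)) x = 0) ∧
    ∀ a x, Φ.2 a x = ∑ μ, sgn μ * pd μ (Φ.1 μ a) x}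

variable {ι : Type*}

/-- The derivative `∂_μ X` of a (real or complex) field. -/
def fieldPd {E : Type*} [NormedAddCommGroup E] [NormedSpace ℝ E] (μ : Fin 4)
    (X : Conf ι → Spacetime → E) : Conf ι → Spacetime → E :=
  fun Φ => pd μ (X Φ)

/-- The string integral `I_c^μ X` of a field. -/
def fieldInt (c : StringFunction) (μ : Fin 4) (X : QField ι) : QField ι :=
  fun Φ => stringInt c μ (X Φ)

/-- The gauge potential `A_μ^a` (lower index). -/
def fieldA (μ : Fin 4) (a : ι) : QField ι := fun Φ => Φ.1 μ a

/-- The null field `N^a`. -/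
def fieldN (a : ι) : QField ι := fun Φ => Φ.2 a

/-- The field strength `F_{μν} = ∂_μ A_ν - ∂_ν A_μ` (lower indices). -/
def fieldF (μ ν : Fin 4) (a : ι) : QField ι :=
  fieldPd μ (fieldA ν a) - fieldPd ν (fieldA μ a)

/-- The string-localized potential `A_μ(c) = I_c^ν F_{μν}`. -/
def fieldAc (c : StringFunction) (μ : Fin 4) (a : ι) : QField ι :=
  ∑ ν, fieldInt c ν (fieldF μ ν a)

/-- The free Lagrangian density `K₀ = -¼ ⟨F^{μν}|F_{μν}⟩`. -/
def fieldK0 [Fintype ι] : QField ι :=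
  (-(1 / 4) : ℝ) • ∑ μ, ∑ ν, ∑ a, (sgn μ * sgn ν) • (fieldF μ ν a * fieldF μ ν a)

/-! ### The Lie algebra and the subspaces `𝒮` and `𝒱` -/

/-- The structure constants: `⁅ξ_a, ξ_b⁆ = ∑_k f_{abk} ξ_k`. The bracket of the Lie algebra is
`i[·,·]` in the physicists' convention. -/
def strConst {𝔤 : Type*} [LieRing 𝔤] [LieAlgebra ℝ 𝔤] (ξ : Module.Basis ι ℝ 𝔤) (a b k : ι) : ℝ :=
  ξ.repr ⁅ξ a, ξ b⁆ k

/-- `ad_{is}(v) = i[s,v]` for Lie-algebra-valued elements `s = ∑ s_a ξ_a`, `v = ∑ v_a ξ_a` with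
components in a commutative algebra. -/
def adField [Fintype ι] {R : Type*} [CommRing R] [Algebra ℝ R] (f : ι → ι → ι → ℝ) (s v : ι → R) :
    ι → R :=
  fun k => ∑ a, ∑ b, f a b k • (s a * v b)

/-- `ad_{is_k} ⋯ ad_{is_1}(v)` for the list `[s_k, …, s_1]`. -/
def adList [Fintype ι] {R : Type*} [CommRing R] [Algebra ℝ R] (f : ι → ι → ι → ℝ)
    (l : List (ι → R)) (v : ι → R) : ι → R :=
  l.foldr (adField f) v

/-- The space `𝒮` of Lie-algebra-valued scalar fields: the smallest subspace that contains
`I_c^ν(ad_{is_k} ⋯ ad_{is_1}(A_ν))` (`k ≥ 0`) and `I_c^ν(ad_{is_k} ⋯ ad_{is_1}(∂_ν s_0))`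
(`k ≥ 1`) whenever it contains `s_0, …, s_k`. -/
def spaceS [Fintype ι] (f : ι → ι → ι → ℝ) (c : StringFunction) : Submodule ℝ (ι → QField ι) :=
  sInf {p | (∀ l : List (ι → QField ι), (∀ s ∈ l, s ∈ p) →
        (fun a => ∑ ν, fieldInt c ν (adList f l (fieldA ν) a)) ∈ p) ∧
      ∀ l : List (ι → QField ι), l ≠ [] → (∀ s ∈ l, s ∈ p) → ∀ s₀ ∈ p,
        (fun a => ∑ ν, fieldInt c ν (adList f l (fun b => fieldPd ν (s₀ b)) a)) ∈ p}

/-- The generators with respect to which fields are contracted, when they are the first entry of an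
obstruction: `F_{μν}`, `A_ν`, `N`, the elements `s` of `𝒮`, and their derivatives `∂_ν s`. -/
inductive Letter (ι : Type*) (S : Submodule ℝ (ι → QField ι))
  | F (μ ν : Fin 4) (a : ι)
  | A (ν : Fin 4) (a : ι)
  | N (a : ι)
  | s (σ : S) (a : ι)
  | ds (ν : Fin 4) (σ : S) (a : ι)

/-- Wick polynomials in the generators. -/
abbrev Wick [Fintype ι] (f : ι → ι → ι → ℝ) (c : StringFunction) :=
  MvPolynomial (Letter ι (spaceS f c)) ℝ

/-- The field that a generator stands for. -/
def Letter.toField {S : Submodule ℝ (ι → QField ι)} : Letter ι S → QField ι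
  | .F μ ν a => fieldF μ ν a
  | .A ν a => fieldA ν a
  | .N a => fieldN a
  | .s σ a => σ.1 a
  | .ds ν σ a => fieldPd ν (σ.1 a)

/-- The field that a Wick polynomial stands for. -/
def wickField [Fintype ι] {f : ι → ι → ι → ℝ} {c : StringFunction} : Wick f c →ₐ[ℝ] QField ι :=
  MvPolynomial.aeval Letter.toField

/-- The space `𝒱` of Lie-algebra-valued vector fields (lower index): it is spanned by
`ad_{is_k} ⋯ ad_{is_1}(A_ν)` and `ad_{is_k} ⋯ ad_{is_1}(∂_ν s_0)` with `k ≥ 0` and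
`s_0, …, s_k ∈ 𝒮`. -/
def spaceV [Fintype ι] (f : ι → ι → ι → ℝ) (c : StringFunction) :
    Submodule ℝ (Fin 4 → ι → Wick f c) :=
  Submodule.span ℝ
    ({v | ∃ l : List (spaceS f c), v = fun ν =>
        adList f (l.map fun σ a => MvPolynomial.X (Letter.s σ a))
          (fun a => MvPolynomial.X (Letter.A ν a))} ∪
     {v | ∃ (l : List (spaceS f c)) (σ₀ : spaceS f c), v = fun ν =>
        adList f (l.map fun σ a => MvPolynomial.X (Letter.s σ a))
          (fun a => MvPolynomial.X (Letter.ds ν σ₀ a))})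

/-! ### Propagators and two-point obstructions

Let `T₀` be the time-ordered two-point function of the massless scalar field, `□ T₀ = -iδ`.
A polynomial `p` in four variables stands for the distribution `p(∂') T₀(x' - x)`. -/

/-- Polynomials in the derivatives `∂'_μ`. -/
abbrev DiffPoly := MvPolynomial (Fin 4) ℝ

/-- The wave operator. -/
def box : DiffPoly := ∑ μ, MvPolynomial.C (sgn μ) * MvPolynomial.X μ ^ 2

/-- Off-shell linear fields (of a given colour): `(p, q)` stands for `∑_ν p_ν(∂) A_ν + q(∂) N`. -/
abbrev LinField := (Fin 4 → DiffPoly) × DiffPoly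

/-- The linear field `A_ν`. -/
def linA (ν : Fin 4) : LinField := (Pi.single ν 1, 0)

/-- The linear field `N`. -/
def linN : LinField := (0, 1)

/-- The derivative `∂_μ` of a linear field. -/
def linPd (μ : Fin 4) (χ : LinField) : LinField := (MvPolynomial.X μ : DiffPoly) • χ

/-- The linear field `F_{μν} = ∂_μ A_ν - ∂_ν A_μ`. -/
def linF (μ ν : Fin 4) : LinField := linPd μ (linA ν) - linPd ν (linA μ)

/-- The combination `-∂_ν N - ∂^μ F_{μν}`, which vanishes by the field equations. -/
def linGauss (ν : Fin 4) : LinField := -linPd ν linN - ∑ μ, sgn μ • linPd μ (linF μ ν)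

/-- The combination `N - ∂^μ A_μ`, which vanishes by the field equations. -/
def linNull : LinField := linN - ∑ μ, sgn μ • linPd μ (linA μ)

/-- The linear fields among which the second entry of a propagator is chosen. -/
inductive Base (ι : Type*)
  | A (κ : Fin 4) (b : ι)
  | N (b : ι)

/-- The colour index. -/
def Base.colour : Base ι → ι
  | .A _ b => b
  | .N b => b

/-- The propagators `⟨T χ(x') φ(x)⟩` (without the factor `δ_{ab}`), which are determined by
`⟨T A'_ν A_κ⟩ = -η_{νκ} T₀`, `⟨T N' A_κ⟩ = -∂'_κ T₀`, `⟨T A'_ν N⟩ = ∂'_ν T₀`, `⟨T N' N⟩ = 0`. -/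
def propagator (χ : LinField) : Base ι → DiffPoly
  | .A κ _ => -(MvPolynomial.C (sgn κ) * χ.1 κ) - χ.2 * MvPolynomial.X κ
  | .N _ => ∑ ν, χ.1 ν * MvPolynomial.X ν

/-- The two-point obstruction `⟨T [∂'_μ χ'] φ⟩ - ∂'_μ ⟨T χ' φ⟩`, where `dχ` is the representative
of `∂_μ χ` that is subject to the field equations. -/
def obstruction (μ : Fin 4) (χ dχ : LinField) (φ : Base ι) : DiffPoly :=
  propagator dχ φ - MvPolynomial.X μ * propagator χ φ

/-- The representative of `∂_μ F_{κλ}`: Lorentz covariant, equal to `∂_μ F_{κλ}` on shell, with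
vanishing cyclic sum and with `∂^μ F_{μν} = -∂_ν N`. -/
def redF (μ κ l : Fin 4) : LinField :=
  linPd μ (linF κ l) + (1 / 3 : ℝ) • (metric μ κ • linGauss l - metric μ l • linGauss κ)

/-- The representative of `∂_μ A_ν`: Lorentz covariant, equal to `∂_μ A_ν` on shell, with
`∂_μ A_ν - ∂_ν A_μ = F_{μν}` and with `∂^μ A_μ = N`. -/
def redA (μ ν : Fin 4) : LinField :=
  linPd μ (linA ν) + ((1 / 4 : ℝ) * metric μ ν) • linNull

open Classical in
/-- For `p = □ q`, the polynomial `q`, so that `i p(∂') T₀(x' - x) = q(∂') δ(x' - x)`. -/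
def deltaCoeff (p : DiffPoly) : DiffPoly := if h : box ∣ p then h.choose else 0

/-- `∫ dx' Z(x') q(∂') δ(x' - x) = (q(-∂) Z)(x)`. -/
def smear (q : DiffPoly) (Z : Spacetime → ℝ) : Spacetime → ℝ :=
  fun x => ∑ m ∈ q.support, (-1) ^ (m.degree) * q.coeff m * iterPd m Z x

/-- The freedom in the time-ordered products of the second derivatives of `s ∈ 𝒮`. As `s` is
inert, `T ∂'_ν s' · X = ∂'_ν T s' · X`, and `val σ μ ν a φ Φ Z` stands for
`i ∫ dx' Z(x') (T ∂'_μ ∂'_ν s'_a · φ - ∂'_μ ∂'_ν T s'_a · φ)` at the configuration `Φ`.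
It is symmetric because derivatives commute, and otherwise arbitrary. -/
structure Renormalization (ι : Type*) (S : Submodule ℝ (ι → QField ι)) where
  /-- the kernels, smeared in `x'` -/
  val : S → Fin 4 → Fin 4 → ι → Base ι → Conf ι → (Spacetime → ℝ) →ₗ[ℝ] (Spacetime → ℝ)
  symm : ∀ σ μ ν a φ Φ, val σ μ ν a φ Φ = val σ ν μ a φ Φ

open Classical in
/-- `i ∫ dx' Z(x') O_μ(χ(x'), φ(x))` for the generators `χ`. The elements of `𝒮` are inert. -/
def contract {S : Submodule ℝ (ι → QField ι)} (τ : Renormalization ι S) (μ : Fin 4)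
    (φ : Base ι) (Φ : Conf ι) (Z : Spacetime → ℝ) : Letter ι S → Spacetime → ℝ
  | .F κ l a =>
      if a = φ.colour then smear (deltaCoeff (obstruction μ (linF κ l) (redF μ κ l) φ)) Z else 0
  | .A ν a =>
      if a = φ.colour then smear (deltaCoeff (obstruction μ (linA ν) (redA μ ν) φ)) Z else 0
  | .N a =>
      if a = φ.colour then smear (deltaCoeff (obstruction μ linN (linPd μ linN) φ)) Z else 0
  | .s _ _ => 0
  | .ds ν σ a => τ.val σ μ ν a φ Φ Z

/-! ### The obstruction map and its flow -/

section Flow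

variable [Fintype ι] {f : ι → ι → ι → ℝ} {c : StringFunction}

/-- `i ∫ dx' O_μ(U^μ(x'), φ(x)) = i ∫ dx' ∑_χ (∂U^μ/∂χ)(x') O_μ(χ(x'), φ(x))`. -/
def variation (τ : Renormalization ι (spaceS f c)) (U : Fin 4 → Wick f c) (φ : Base ι) :
    QField ι :=
  fun Φ => ∑ μ, ∑ χ ∈ (U μ).vars, contract τ μ φ Φ (wickField (MvPolynomial.pderiv χ (U μ)) Φ) χ

/-- The obstruction map `ω_U(X)(x) = i ∫ dx' O_μ(U^μ(x'), X(x))`. The sum over the contractions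
`∂X/∂φ` in the second entry is the functional derivative of `X`. -/
def omega (τ : Renormalization ι (spaceS f c)) (U : Fin 4 → Wick f c) (X : QField ι) : QField ι :=
  fun Φ x => deriv (fun t : ℝ => X (Φ + t • ((fun μ a => variation τ U (.A μ a) Φ,
    fun a => variation τ U (.N a) Φ) : Conf ι)) x) 0

/-- The obstruction map on power series in `g`, for `U = ∑ gⁿ U_n`. -/
def omegaSeries (τ : Renormalization ι (spaceS f c)) (U : ℕ → Fin 4 → Wick f c)
    (Y : PowerSeries (QField ι)) : PowerSeries (QField ι) :=
  PowerSeries.mk fun n => ∑ p ∈ Finset.HasAntidiagonal.antidiagonal n, omega τ (U p.1) (PowerSeries.coeff p.2 Y)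

/-- The flow `e^{ω_U}` for `U = O(g)`: then `ω_U^k` does not contribute to the order `n < k`. -/
def expOmega (τ : Renormalization ι (spaceS f c)) (U : ℕ → Fin 4 → Wick f c)
    (Y : PowerSeries (QField ι)) : PowerSeries (QField ι) :=
  PowerSeries.mk fun n => ∑ k ∈ Finset.range (n + 1),
    ((k.factorial : ℝ)⁻¹) • PowerSeries.coeff n ((omegaSeries τ U)^[k] Y)

/-- The mediator field `U^μ = ⟨F^{μν}|α_ν⟩`, order by order in `g`. -/
def mediator (α : ℕ → Fin 4 → ι → Wick f c) : ℕ → Fin 4 → Wick f c :=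
  fun n μ => ∑ ν, ∑ a, (sgn μ * sgn ν) • (MvPolynomial.X (Letter.F μ ν a) * α n ν a)

end Flow

/-! ### Matrix-valued fields -/

/-- A unitary representation (on the Lie algebra level) by hermitean matrices; the bracket of the
Lie algebra is represented by `i[·,·]`. -/
structure HermitianRep (𝔤 : Type*) [LieRing 𝔤] [LieAlgebra ℝ 𝔤] (d : ℕ) where
  /-- the representing matrices -/
  toFun : 𝔤 →ₗ[ℝ] Matrix (Fin d) (Fin d) ℂ
  isHermitian : ∀ x, (toFun x).IsHermitian
  map_lie : ∀ x y, toFun ⁅x, y⁆ = Complex.I • (toFun x * toFun y - toFun y * toFun x)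

/-- Matrices of complex fields, with the Wick product of the entries. -/
abbrev MatField (ι : Type*) (d : ℕ) := Matrix (Fin d) (Fin d) (Conf ι → Spacetime → ℂ)

/-- The matrix-valued power series `∑_a X_a π(ξ_a)` of a Lie-algebra-valued power series. -/
def repSeries [Fintype ι] {𝔤 : Type*} [LieRing 𝔤] [LieAlgebra ℝ 𝔤] {d : ℕ}
    (π : HermitianRep 𝔤 d) (ξ : Module.Basis ι ℝ 𝔤) (X : ι → PowerSeries (QField ι)) :
    PowerSeries (MatField ι d) :=
  PowerSeries.mk fun n => Matrix.of fun i j => fun Φ x =>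
    ∑ a, ((PowerSeries.coeff n (X a) Φ x : ℝ) : ℂ) * π.toFun (ξ a) i j

/-- The derivative of a matrix-valued power series. -/
def matPd {d : ℕ} (μ : Fin 4) (Y : PowerSeries (MatField ι d)) : PowerSeries (MatField ι d) :=
  PowerSeries.mk fun n => Matrix.of fun i j => fieldPd μ (PowerSeries.coeff n Y i j)

/-- The exponential of a power series without constant term. -/
def expSeries {R : Type*} [Ring R] [Algebra ℝ R] (Y : PowerSeries R) : PowerSeries R :=
  PowerSeries.mk fun n => ∑ k ∈ Finset.range (n + 1),
    ((k.factorial : ℝ)⁻¹) • PowerSeries.coeff n (Y ^ k)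

/-- `e^{iγ}` in the representation `π`, for `γ = ∑ gⁿ γ_n`. -/
def dressingFactor [Fintype ι] {𝔤 : Type*} [LieRing 𝔤] [LieAlgebra ℝ 𝔤] {d : ℕ}
    (π : HermitianRep 𝔤 d) (ξ : Module.Basis ι ℝ 𝔤) (γ : ℕ → ι → QField ι) :
    PowerSeries (MatField ι d) :=
  expSeries (Complex.I • repSeries π ξ fun a => PowerSeries.mk fun n => γ n a)

/-- Equality of power series of fields on all configurations in `𝒞`. -/
def EqOnConf (𝒞 : Set (Conf ι)) (Y Z : PowerSeries (QField ι)) : Prop :=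
  ∀ n, ∀ Φ ∈ 𝒞, PowerSeries.coeff n Y Φ = PowerSeries.coeff n Z Φ

/-- Equality of matrix-valued power series of fields on all configurations in `𝒞`. -/
def MatEqOnConf {d : ℕ} (𝒞 : Set (Conf ι)) (Y Z : PowerSeries (MatField ι d)) : Prop :=
  ∀ n i j, ∀ Φ ∈ 𝒞, PowerSeries.coeff n Y i j Φ = PowerSeries.coeff n Z i j Φ

/-- A matrix-valued series of fields is string-localized if, at `x`, it depends on the potential
only in arbitrarily small neighbourhoods of the string `x + C`. -/
def StringLocalized {d : ℕ} (c : StringFunction) (Y : PowerSeries (MatField ι d)) : Prop :=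
  ∀ n i j x, ∀ ε > 0, ∀ Φ ∈ configs ι c, ∀ Ψ ∈ configs ι c,
    (∀ z ∈ Metric.thickening ε ((fun y => x + y) '' c.cone), ∀ μ a, Φ.1 μ a z = Ψ.1 μ a z) →
      PowerSeries.coeff n Y i j Φ x = PowerSeries.coeff n Y i j Ψ x

end StringYM

end

/-!
Contracting `F^{μν}` in the mediator field with any propagator produces a multiple of `δ`, whereas
the contractions of `α_ν` vanish against the antisymmetric `F^{μν}`, whatever the renormalization.
Hence `ω_U` is the functional derivative in the direction `δA_ν = α_ν`, `δN = 0`. In particular its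
flow commutes with derivatives and string integrals, so everything follows from the flow of `A_ν`.

In `B_ν = W (A_ν + i g⁻¹ ∂_ν) W⁻¹`, the coefficient of `γ` of highest order appears only as
`g⁻¹ ∂_ν γ`. Since `I_c^ν ∂_ν = -1`, the axial gauge condition `I_c^ν B_ν = 0` can be solved for `γ`
order by order in `g`. Since `ω_U(A_ν) = α_ν`, one can then choose `α_ν` order by order such that
`e^{ω_U}(A_ν) = B_ν` up to the gradient in `B_ν` at order zero. The string integral of the curl of
`B` is `B_μ + ∂_μ I_c^ν B_ν`, and therefore `e^{ω_U}(A_μ(c)) = B_μ`.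
-/

noncomputable section

namespace StringYM

open Metric TopologicalSpace Filter Topology

/-! ### Smearing a smooth function with a distribution -/

section Regularization

section Taylor

variable {E F G : Type*} [NormedAddCommGroup E] [NormedSpace ℝ E]
  [NormedAddCommGroup F] [NormedSpace ℝ F] [NormedAddCommGroup G]
  [NormedSpace ℝ G] {f : E → F}

lemma contDiff_fderiv_apply (hf : ContDiff ℝ ∞ f) (v : E) :
    ContDiff ℝ ∞ fun y => fderiv ℝ f y v :=
  (hf.fderiv_right (m := ∞) (by simp)).clm_apply contDiff_const

/-- The remainder of the first-order Taylor expansion of `f` at `y` with increment `h`. -/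
def taylorRemainder (f : E → F) (h y : E) : F := f (y + h) - f y - fderiv ℝ f y h

lemma contDiff_taylorRemainder (hf : ContDiff ℝ ∞ f) (h : E) :
    ContDiff ℝ ∞ (taylorRemainder f h) :=
  ((hf.comp (contDiff_id.add contDiff_const)).sub hf).sub
    (contDiff_fderiv_apply hf h)

lemma exists_norm_taylorRemainder_le [ProperSpace E] (hf : ContDiff ℝ 2 f) (r : ℝ) :
    ∃ M, ∀ y, ‖y‖ ≤ r → ∀ h, ‖h‖ ≤ 1 → ‖taylorRemainder f h y‖ ≤ M * ‖h‖ ^ 2 := by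
  have hf' : ContDiff ℝ 1 (fderiv ℝ f) := hf.fderiv_right (by norm_num)
  obtain ⟨M, hM⟩ := (isCompact_closedBall (0 : E) (r + 1)).exists_bound_of_continuousOn
    (hf'.continuous_fderiv one_ne_zero).continuousOn
  refine ⟨M, fun y hy h hh => ?_⟩
  have segment_subset : segment ℝ y (y + h) ⊆ closedBall (0 : E) (r + 1) := by
    refine (convex_closedBall _ _).segment_subset ?_ ?_ <;> rw [mem_closedBall_zero_iff]
    · linarith
    · exact (norm_add_le _ _).trans (add_le_add hy hh)
  have fderiv_sub_le : ∀ z ∈ segment ℝ y (y + h), ‖fderiv ℝ f z - fderiv ℝ f y‖ ≤ M * ‖h‖ := by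
    intro z hz
    have hM0 : 0 ≤ M := (norm_nonneg _).trans (hM z (segment_subset hz))
    refine ((convex_segment y (y + h)).norm_image_sub_le_of_norm_fderiv_le (𝕜 := ℝ)
      (fun w _ => hf'.differentiable one_ne_zero w) (fun w hw => hM w (segment_subset hw))
      (left_mem_segment ℝ y (y + h)) hz).trans (mul_le_mul_of_nonneg_left ?_ hM0)
    simpa using norm_sub_le_of_mem_segment hz
  have taylor := (convex_segment y (y + h)).norm_image_sub_le_of_norm_fderiv_le' (𝕜 := ℝ)
    (fun w _ => hf.differentiable two_ne_zero w) fderiv_sub_le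
    (left_mem_segment ℝ y (y + h)) (right_mem_segment ℝ y (y + h))
  rwa [add_sub_cancel_left, mul_assoc, ← sq] at taylor

lemma fderiv_taylorRemainder (hf : ContDiff ℝ 2 f) (h : E) :
    fderiv ℝ (taylorRemainder f h) = taylorRemainder (fderiv ℝ f) h := by
  have hf' : Differentiable ℝ (fderiv ℝ f) :=
    (hf.fderiv_right (m := 1) (by norm_num)).differentiable one_ne_zero
  have hd : Differentiable ℝ f := hf.differentiable two_ne_zero
  ext1 y
  have hshift : HasFDerivAt (fun z => f (z + h)) (fderiv ℝ f (y + h)) y :=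
    (hasFDerivAt_comp_add_right h).2 (hd (y + h)).hasFDerivAt
  have happly : HasFDerivAt (fun z => fderiv ℝ f z h) ((fderiv ℝ (fderiv ℝ f) y).flip h) y := by
    simpa using (hf' y).hasFDerivAt.clm_apply (hasFDerivAt_const h y)
  have hsymm : IsSymmSndFDerivAt ℝ f y := hf.contDiffAt.isSymmSndFDerivAt (by simp)
  refine ((hshift.sub (hd y).hasFDerivAt).sub happly).fderiv.trans ?_
  rw [taylorRemainder]
  congr 1
  ext w
  exact hsymm.eq w h

lemma taylorRemainder_equiv_comp (L : F ≃ₗᵢ[ℝ] G) (f : E → F) (h : E) :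
    taylorRemainder (L ∘ f) h = L ∘ taylorRemainder f h := by
  ext y
  simp [taylorRemainder, L.comp_fderiv]

lemma iteratedFDeriv_taylorRemainder (hf : ContDiff ℝ ∞ f) (h : E) (i : ℕ) :
    iteratedFDeriv ℝ i (taylorRemainder f h) = taylorRemainder (iteratedFDeriv ℝ i f) h := by
  induction i with
  | zero =>
    rw [iteratedFDeriv_zero_eq_comp, iteratedFDeriv_zero_eq_comp]
    exact (taylorRemainder_equiv_comp (G := E [×0]→L[ℝ] F)
      (continuousMultilinearCurryFin0 ℝ E F).symm f h).symm
  | succ i ih =>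
    have hi : ContDiff ℝ 2 (iteratedFDeriv ℝ i f) :=
      hf.iteratedFDeriv_right (WithTop.coe_le_coe.2 le_top)
    rw [iteratedFDeriv_succ_eq_comp_left, iteratedFDeriv_succ_eq_comp_left, ih,
      fderiv_taylorRemainder hi]
    exact (taylorRemainder_equiv_comp (F := E →L[ℝ] E [×i]→L[ℝ] F) (G := E [×i + 1]→L[ℝ] F)
      (continuousMultilinearCurryLeftEquiv ℝ (fun _ => E) F).symm _ h).symm

lemma exists_norm_iteratedFDeriv_taylorRemainder_le [ProperSpace E] (hf : ContDiff ℝ ∞ f) (i : ℕ)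
    (r : ℝ) :
    ∃ M, ∀ y, ‖y‖ ≤ r → ∀ h, ‖h‖ ≤ 1 →
      ‖iteratedFDeriv ℝ i (taylorRemainder f h) y‖ ≤ M * ‖h‖ ^ 2 := by
  simpa only [iteratedFDeriv_taylorRemainder hf] using exists_norm_taylorRemainder_le
    (hf.iteratedFDeriv_right (m := 2) (i := i) (WithTop.coe_le_coe.2 le_top)) r

end Taylor

variable {E : Type*} [NormedAddCommGroup E] [NormedSpace ℝ E] {Ω : Opens E}

/-- The product of a test function and a smooth function. -/
def mulTest (χ : 𝓓(Ω, ℝ)) (g : E → ℝ) (hg : ContDiff ℝ ∞ g) : 𝓓(Ω, ℝ) where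
  toFun y := χ y * g y
  contDiff' := χ.contDiff.mul hg
  hasCompactSupport' := χ.hasCompactSupport.mul_right
  tsupport_subset' := tsupport_mul_subset_left.trans χ.tsupport_subset

@[simp]
lemma mulTest_apply (χ : 𝓓(Ω, ℝ)) (g : E → ℝ) (hg : ContDiff ℝ ∞ g) (y : E) :
    mulTest χ g hg y = χ y * g y := rfl

lemma tsupport_mulTest_subset (χ : 𝓓(Ω, ℝ)) (g : E → ℝ) (hg : ContDiff ℝ ∞ g) :
    tsupport (mulTest χ g hg) ⊆ tsupport χ :=
  tsupport_mul_subset_left (f := χ) (g := g)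

lemma exists_norm_iteratedFDeriv_mulTest_le (χ : 𝓓(Ω, ℝ)) (m : ℕ) :
    ∃ C, ∀ (g : E → ℝ) (hg : ContDiff ℝ ∞ g) (M : ℝ), 0 ≤ M →
      (∀ i ≤ m, ∀ y ∈ tsupport χ, ‖iteratedFDeriv ℝ i g y‖ ≤ M) →
      ∀ i ≤ m, ∀ y, ‖iteratedFDeriv ℝ i (mulTest χ g hg) y‖ ≤ C * M := by
  choose N hN using fun j : ℕ => (χ.hasCompactSupport.iteratedFDeriv (𝕜 := ℝ) j)
    |>.exists_bound_of_continuous (χ.contDiff.continuous_iteratedFDeriv (mod_cast le_top))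
  have hN0 : ∀ j, 0 ≤ N j := fun j => (norm_nonneg _).trans (hN j 0)
  have hterm : ∀ i, ∀ j ∈ Finset.range (i + 1), 0 ≤ (i.choose j : ℝ) * N j := fun i j _ =>
    mul_nonneg (Nat.cast_nonneg _) (hN0 j)
  have hsum : ∀ i, 0 ≤ ∑ j ∈ Finset.range (i + 1), (i.choose j : ℝ) * N j := fun i =>
    Finset.sum_nonneg (hterm i)
  refine ⟨∑ i ∈ Finset.range (m + 1), ∑ j ∈ Finset.range (i + 1), (i.choose j : ℝ) * N j,
    fun g hg M hM hgM i hi y => ?_⟩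
  by_cases hy : y ∈ tsupport χ
  · calc ‖iteratedFDeriv ℝ i (mulTest χ g hg) y‖
      _ ≤ ∑ j ∈ Finset.range (i + 1), (i.choose j : ℝ) * ‖iteratedFDeriv ℝ j χ y‖ *
            ‖iteratedFDeriv ℝ (i - j) g y‖ :=
          norm_iteratedFDeriv_mul_le (N := ∞) χ.contDiff hg y (mod_cast le_top)
      _ ≤ ∑ j ∈ Finset.range (i + 1), (i.choose j : ℝ) * N j * M :=
          Finset.sum_le_sum fun j hj => mul_le_mul
            (mul_le_mul_of_nonneg_left (hN j y) (Nat.cast_nonneg _))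
            (hgM _ ((Nat.sub_le _ _).trans hi) y hy) (norm_nonneg _) (hterm i j hj)
      _ ≤ _ := by
          rw [← Finset.sum_mul]
          exact mul_le_mul_of_nonneg_right (Finset.single_le_sum (fun i _ => hsum i)
            (Finset.mem_range_succ_iff.2 hi)) hM
  · have hzero : iteratedFDeriv ℝ i (mulTest χ g hg) y = 0 := by
      by_contra h
      exact hy (tsupport_mulTest_subset χ g hg (support_iteratedFDeriv_subset i h))
    rw [hzero, norm_zero]
    exact mul_nonneg (Finset.sum_nonneg fun i _ => hsum i) hM

variable {F : Type*} [NormedAddCommGroup F] [NormedSpace ℝ F]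

lemma exists_finite_order (T : 𝓓'(Ω, F)) {K : Compacts E} (hK : (K : Set E) ⊆ Ω) :
    ∃ (m : ℕ) (C : ℝ), ∀ φ : 𝓓(Ω, ℝ), tsupport φ ⊆ K → ∀ M, 0 ≤ M →
      (∀ i ≤ m, ∀ y, ‖iteratedFDeriv ℝ i φ y‖ ≤ M) → ‖T φ‖ ≤ C * M := by
  let L : 𝓓^{⊤}_{K}(E, ℝ) →L[ℝ] F := T.comp (TestFunction.ofSupportedInCLM ℝ hK)
  obtain ⟨s, C, -, hC⟩ := Seminorm.bound_of_continuous
    (ContDiffMapSupportedIn.withSeminorms ℝ E ℝ ⊤ K) ((normSeminorm ℝ F).comp L.toLinearMap)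
    (continuous_norm.comp L.continuous)
  refine ⟨s.sup id, C, fun φ hφ M hM hφM => ?_⟩
  let φK : 𝓓^{⊤}_{K}(E, ℝ) := .of_support_subset φ.contDiff (subset_closure.trans hφ)
  refine (hC φK).trans (mul_le_mul_of_nonneg_left ?_ C.2)
  refine Seminorm.finset_sup_apply_le hM fun i hi => ?_
  rw [ContDiffMapSupportedIn.seminorm_top_le_iff ℝ hM]
  exact fun x _ => hφM i (Finset.le_sup (f := id) hi) x

/-- The function `x ↦ ∫ T(y) χ(y) f(x + y) dy`, for a distribution `T` and a cutoff `χ`. -/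
def regularize (T : 𝓓'(Ω, F)) (χ : 𝓓(Ω, ℝ)) (f : E → ℝ) (hf : ContDiff ℝ ∞ f) (x : E) : F :=
  T (mulTest χ (fun y => f (x + y)) (hf.comp (contDiff_const.add contDiff_id)))

section Regularize

variable (T : 𝓓'(Ω, F)) (χ : 𝓓(Ω, ℝ)) {f g : E → ℝ}

lemma regularize_add (hf : ContDiff ℝ ∞ f) (hg : ContDiff ℝ ∞ g) (x : E) :
    regularize T χ (f + g) (hf.add hg) x = regularize T χ f hf x + regularize T χ g hg x := by
  rw [regularize, regularize, regularize, ← map_add]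
  congr 1
  ext y
  simp [mul_add]

lemma regularize_smul (hf : ContDiff ℝ ∞ f) (t : ℝ) (x : E) :
    regularize T χ (t • f) (hf.const_smul t) x = t • regularize T χ f hf x := by
  rw [regularize, regularize, ← map_smul]
  congr 1
  ext y
  simp [mul_left_comm]

variable [FiniteDimensional ℝ E]

/-- The derivative of `regularize T χ f` at `x`: its value at `v` is obtained by smearing the
derivative `∂_v f`. -/
def regularizeFDeriv (hf : ContDiff ℝ ∞ f) (x : E) : E →L[ℝ] F :=
  LinearMap.toContinuousLinearMap
    { toFun v := regularize T χ (fun y => fderiv ℝ f y v) (contDiff_fderiv_apply hf v) x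
      map_add' v w := by
        simp only [map_add]
        exact regularize_add T χ (contDiff_fderiv_apply hf v) (contDiff_fderiv_apply hf w) x
      map_smul' t v := by
        simp only [map_smul]
        exact regularize_smul T χ (contDiff_fderiv_apply hf v) t x }

@[simp]
lemma regularizeFDeriv_apply (hf : ContDiff ℝ ∞ f) (x v : E) :
    regularizeFDeriv T χ hf x v =
      regularize T χ (fun y => fderiv ℝ f y v) (contDiff_fderiv_apply hf v) x := rfl

lemma regularize_add_sub_sub_regularizeFDeriv (hf : ContDiff ℝ ∞ f) (x h : E) :
    regularize T χ f hf (x + h) - regularize T χ f hf x - regularizeFDeriv T χ hf x h =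
      regularize T χ (taylorRemainder f h) (contDiff_taylorRemainder hf h) x := by
  simp only [regularizeFDeriv_apply, regularize, ← map_sub]
  congr 1
  ext y
  simp [taylorRemainder, mul_sub, add_right_comm]

lemma exists_norm_regularize_taylorRemainder_le (hf : ContDiff ℝ ∞ f) (x : E) :
    ∃ C, ∀ h, ‖h‖ ≤ 1 →
      ‖regularize T χ (taylorRemainder f h) (contDiff_taylorRemainder hf h) x‖ ≤ C * ‖h‖ ^ 2 := by
  obtain ⟨m, C, hT⟩ :=
    exists_finite_order T (K := ⟨tsupport χ, χ.hasCompactSupport⟩) χ.tsupport_subset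
  obtain ⟨D, hD⟩ := exists_norm_iteratedFDeriv_mulTest_le χ m
  obtain ⟨r, hr⟩ := χ.hasCompactSupport.isCompact.isBounded.exists_norm_le
  choose M hM using fun i => exists_norm_iteratedFDeriv_taylorRemainder_le hf i (‖x‖ + r)
  refine ⟨C * (|D| * ∑ i ∈ Finset.range (m + 1), |M i|), fun h hh => ?_⟩
  have hbound : 0 ≤ (∑ i ∈ Finset.range (m + 1), |M i|) * ‖h‖ ^ 2 := by positivity
  rw [mul_assoc, mul_assoc]
  refine hT _ (tsupport_mulTest_subset χ _ _) _ (mul_nonneg (abs_nonneg D) hbound) fun i hi y =>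
    (hD _ _ _ hbound (fun j hj z hz => ?_) i hi y).trans
      (mul_le_mul_of_nonneg_right (le_abs_self D) hbound)
  rw [iteratedFDeriv_comp_add_left]
  refine (hM j _ ((norm_add_le _ _).trans (add_le_add_right (hr z hz) _)) h hh).trans
    (mul_le_mul_of_nonneg_right ((le_abs_self _).trans ?_) (sq_nonneg _))
  exact Finset.single_le_sum (f := fun j => |M j|) (fun _ _ => abs_nonneg _)
    (Finset.mem_range_succ_iff.2 hj)

lemma hasFDerivAt_regularize (hf : ContDiff ℝ ∞ f) (x : E) :
    HasFDerivAt (regularize T χ f hf) (regularizeFDeriv T χ hf x) x := by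
  obtain ⟨C, hC⟩ := exists_norm_regularize_taylorRemainder_le T χ hf x
  rw [hasFDerivAt_iff_isLittleO_nhds_zero]
  refine Asymptotics.IsBigO.trans_isLittleO (g := fun h : E => ‖h‖ ^ 2)
    (Asymptotics.IsBigO.of_bound C ?_) (Asymptotics.isLittleO_norm_pow_id one_lt_two)
  filter_upwards [closedBall_mem_nhds (0 : E) one_pos] with h hh
  rw [regularize_add_sub_sub_regularizeFDeriv, norm_pow, norm_norm]
  exact hC h (mem_closedBall_zero_iff.1 hh)

lemma fderiv_regularize_apply (hf : ContDiff ℝ ∞ f) (x v : E) :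
    fderiv ℝ (regularize T χ f hf) x v =
      regularize T χ (fun y => fderiv ℝ f y v) (contDiff_fderiv_apply hf v) x := by
  rw [(hasFDerivAt_regularize T χ hf x).fderiv, regularizeFDeriv_apply]

lemma contDiff_regularize (hf : ContDiff ℝ ∞ f) : ContDiff ℝ ∞ (regularize T χ f hf) := by
  rw [contDiff_infty]
  intro n
  induction n generalizing f with
  | zero =>
    exact contDiff_zero.2 (continuous_iff_continuousAt.2 fun x =>
      (hasFDerivAt_regularize T χ hf x).continuousAt)
  | succ n ih =>
    rw [Nat.cast_succ, contDiff_succ_iff_hasFDerivAt]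
    exact ⟨regularizeFDeriv T χ hf,
      contDiff_clm_apply_iff.2 fun v => ih (contDiff_fderiv_apply hf v),
      hasFDerivAt_regularize T χ hf⟩

end Regularize

end Regularization

open scoped Pointwise

/-! ### The geometry of the string -/

lemma spaceNorm_eq_norm (x : Spacetime) :
    spaceNorm x = ‖(WithLp.toLp 2 fun i : Fin 3 => x i.succ : EuclideanSpace ℝ (Fin 3))‖ := by
  simp [spaceNorm, EuclideanSpace.norm_eq]

lemma continuous_spaceNorm : Continuous spaceNorm := by
  unfold spaceNorm
  fun_prop

lemma spaceNorm_add_le (x y : Spacetime) : spaceNorm (x + y) ≤ spaceNorm x + spaceNorm y := by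
  simp only [spaceNorm_eq_norm]
  exact norm_add_le (WithLp.toLp 2 fun i : Fin 3 => x i.succ : EuclideanSpace ℝ (Fin 3))
    (WithLp.toLp 2 fun i : Fin 3 => y i.succ)

lemma spaceNorm_smul {t : ℝ} (ht : 0 ≤ t) (x : Spacetime) :
    spaceNorm (t • x) = t * spaceNorm x := by
  simp only [spaceNorm, Pi.smul_apply, smul_eq_mul, mul_pow, ← Finset.mul_sum]
  rw [Real.sqrt_mul (sq_nonneg t), Real.sqrt_sq ht]

lemma spaceNorm_le (x : Spacetime) : spaceNorm x ≤ 2 * ‖x‖ := by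
  refine Real.sqrt_le_iff.2 ⟨by positivity, ?_⟩
  have hcoord : ∀ i : Fin 3, x i.succ ^ 2 ≤ ‖x‖ ^ 2 := fun i =>
    sq_le_sq.2 (by simpa using norm_le_pi_norm x i.succ)
  calc ∑ i : Fin 3, x i.succ ^ 2 ≤ ∑ _i : Fin 3, ‖x‖ ^ 2 := Finset.sum_le_sum fun i _ => hcoord i
    _ = 3 * ‖x‖ ^ 2 := by simp
    _ ≤ (2 * ‖x‖) ^ 2 := by nlinarith [sq_nonneg ‖x‖]

/-- The excess `|𝐱| - |x⁰|` of the spatial over the temporal distance from the origin: it is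
positive on spacelike vectors, and at most `R` on the causal influence region `J(B_R)`. -/
def spacelikeExcess (x : Spacetime) : ℝ := spaceNorm x - |x 0|

lemma continuous_spacelikeExcess : Continuous spacelikeExcess :=
  continuous_spaceNorm.sub (continuous_apply 0).abs

lemma spacelikeExcess_smul {t : ℝ} (ht : 0 ≤ t) (x : Spacetime) :
    spacelikeExcess (t • x) = t * spacelikeExcess x := by
  rw [spacelikeExcess, spacelikeExcess, spaceNorm_smul ht, Pi.smul_apply, smul_eq_mul, abs_mul,
    abs_of_nonneg ht, mul_sub]

lemma spacelikeExcess_le_add_norm_sub (x y : Spacetime) :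
    spacelikeExcess x ≤ spacelikeExcess y + 3 * ‖x - y‖ := by
  have hspace : spaceNorm x ≤ spaceNorm y + 2 * ‖x - y‖ := by
    simpa using (spaceNorm_add_le y (x - y)).trans (add_le_add_right (spaceNorm_le _) _)
  have htime : |y 0| - |x 0| ≤ ‖x - y‖ := by
    rw [norm_sub_rev]
    exact (abs_sub_abs_le_abs_sub _ _).trans (norm_le_pi_norm (y - x) 0)
  rw [spacelikeExcess, spacelikeExcess]
  linarith

lemma exists_pos_mul_norm_le {E : Type*} [NormedAddCommGroup E] [NormedSpace ℝ E] [ProperSpace E]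
    {K : Set E} (hK : IsClosed K) (hcone : ∀ t > (0 : ℝ), ∀ y ∈ K, t • y ∈ K) {q : E → ℝ}
    (hq : Continuous q) (hsmul : ∀ t > (0 : ℝ), ∀ y, q (t • y) = t * q y)
    (hpos : ∀ y ∈ K, y ≠ 0 → 0 < q y) :
    ∃ κ > 0, ∀ y ∈ K, y ≠ 0 → κ * ‖y‖ ≤ q y := by
  have hunit : ∀ y ∈ K, y ≠ 0 → ‖y‖⁻¹ • y ∈ K ∩ sphere 0 1 := fun y hy hy0 =>
    ⟨hcone _ (inv_pos.2 (norm_pos_iff.2 hy0)) y hy, by simp [norm_smul, hy0]⟩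
  rcases (K ∩ sphere 0 1).eq_empty_or_nonempty with hempty | hne
  · exact ⟨1, one_pos, fun y hy hy0 => absurd (hunit y hy hy0) (hempty ▸ Set.notMem_empty _)⟩
  · obtain ⟨y₀, ⟨hy₀, hy₀'⟩, hmin⟩ :=
      ((isCompact_sphere _ _).inter_left hK).exists_isMinOn hne hq.continuousOn
    refine ⟨q y₀, hpos y₀ hy₀ (ne_zero_of_mem_unit_sphere ⟨y₀, hy₀'⟩), fun y hy hy0 => ?_⟩
    have hn : 0 < ‖y‖ := norm_pos_iff.2 hy0
    have hle : q y₀ ≤ q (‖y‖⁻¹ • y) := hmin (hunit y hy hy0)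
    rwa [hsmul _ (inv_pos.2 hn), inv_mul_eq_div, le_div_iff₀ hn] at hle

namespace StringFunction

variable (c : StringFunction)

lemma add_mem {y z : Spacetime} (hy : y ∈ c.cone) (hz : z ∈ c.cone) : y + z ∈ c.cone := by
  have hmid := c.convex_cone hy hz one_half_pos.le one_half_pos.le (add_halves 1)
  simpa [← smul_add, smul_smul] using c.smul_mem 2 two_pos.le _ hmid

lemma smul_cone {t : ℝ} (ht : 0 < t) : t • c.cone = c.cone := by
  refine Set.Subset.antisymm ?_ fun y hy =>
    ⟨t⁻¹ • y, c.smul_mem _ (inv_pos.2 ht).le y hy, smul_inv_smul₀ ht.ne' y⟩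
  rintro _ ⟨y, hy, rfl⟩
  exact c.smul_mem t ht.le y hy

lemma exists_pos_mul_norm_le_spacelikeExcess :
    ∃ κ > 0, ∀ y ∈ c.cone, κ * ‖y‖ ≤ spacelikeExcess y := by
  obtain ⟨κ, hκ, h⟩ := exists_pos_mul_norm_le c.isClosed_cone (fun t ht => c.smul_mem t ht.le)
    continuous_spacelikeExcess (fun t ht => spacelikeExcess_smul ht.le)
    fun y hy hy0 => sub_pos.2 (c.spacelike y hy hy0)
  refine ⟨κ, hκ, fun y hy => ?_⟩
  rcases eq_or_ne y 0 with rfl | hy0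
  · simp [spacelikeExcess, spaceNorm]
  · exact h y hy hy0

lemma exists_pos_mul_norm_le_norm_add :
    ∃ κ > 0, ∀ y ∈ c.cone, ∀ z ∈ c.cone, κ * ‖y‖ ≤ ‖y + z‖ := by
  have hsmul : ∀ t > (0 : ℝ), ∀ y, infDist (-(t • y)) c.cone = t * infDist (-y) c.cone := by
    intro t ht y
    conv_lhs => rw [← smul_neg, ← c.smul_cone ht]
    rw [infDist_smul₀ ht.ne', Real.norm_of_nonneg ht.le]
  obtain ⟨κ, hκ, h⟩ := exists_pos_mul_norm_le c.isClosed_cone (fun t ht => c.smul_mem t ht.le)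
    ((continuous_infDist_pt c.cone).comp continuous_neg) hsmul fun y hy hy0 =>
      (c.isClosed_cone.notMem_iff_infDist_pos ⟨0, c.zero_mem⟩).1 fun hneg =>
        hy0 (c.salient y hy hneg)
  refine ⟨κ, hκ, fun y hy z hz => ?_⟩
  rcases eq_or_ne y 0 with rfl | hy0
  · simp
  · calc κ * ‖y‖ ≤ infDist (-y) c.cone := h y hy hy0
      _ ≤ dist (-y) z := infDist_le_dist_of_mem hz
      _ = ‖y + z‖ := by rw [dist_eq_norm, ← neg_add', norm_neg]

lemma exists_norm_le_of_spacelikeExcess_le (R r : ℝ) :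
    ∃ L, ∀ e : Spacetime, ‖e‖ ≤ r → ∀ y ∈ c.cone, ∀ z ∈ c.cone,
      spacelikeExcess (e + y + z) ≤ R → ‖y‖ ≤ L := by
  obtain ⟨κ₁, hκ₁, h₁⟩ := c.exists_pos_mul_norm_le_spacelikeExcess
  obtain ⟨κ₂, hκ₂, h₂⟩ := c.exists_pos_mul_norm_le_norm_add
  refine ⟨(R + 3 * r) / (κ₁ * κ₂), fun e he y hy z hz hR => ?_⟩
  rw [le_div_iff₀' (mul_pos hκ₁ hκ₂)]
  calc κ₁ * κ₂ * ‖y‖ ≤ κ₁ * ‖y + z‖ := by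
        rw [mul_assoc]
        exact mul_le_mul_of_nonneg_left (h₂ y hy z hz) hκ₁.le
    _ ≤ spacelikeExcess (y + z) := h₁ _ (c.add_mem hy hz)
    _ ≤ spacelikeExcess (e + y + z) + 3 * ‖y + z - (e + y + z)‖ :=
        spacelikeExcess_le_add_norm_sub _ _
    _ = spacelikeExcess (e + y + z) + 3 * ‖e‖ := by
        rw [norm_sub_rev, add_assoc, add_sub_cancel_right]
    _ ≤ R + 3 * r := by linarith

end StringFunction

/-! ### Admissible functions -/

/-- Smooth functions supported in `J(B_R) - C` for a given radius `R`. -/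
def AdmissibleWith (c : StringFunction) (R : ℝ) (f : Spacetime → ℝ) : Prop :=
  ContDiff ℝ ∞ f ∧ ∀ x, f x ≠ 0 → ∃ y ∈ c.cone, spacelikeExcess (x + y) ≤ R

lemma contDiff_pd {E : Type*} [NormedAddCommGroup E] [NormedSpace ℝ E] {f : Spacetime → E}
    (hf : ContDiff ℝ ∞ f) (μ : Fin 4) : ContDiff ℝ ∞ (pd μ f) :=
  contDiff_fderiv_apply hf _

variable {c : StringFunction} {f g : Spacetime → ℝ}

lemma admissible_iff_exists_admissibleWith : Admissible c f ↔ ∃ R, AdmissibleWith c R f := by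
  simp only [Admissible, AdmissibleWith, spacelikeExcess, sub_le_iff_le_add',
    exists_and_left]

namespace AdmissibleWith

variable {R : ℝ}

lemma admissible (hf : AdmissibleWith c R f) : Admissible c f :=
  admissible_iff_exists_admissibleWith.2 ⟨R, hf⟩

lemma mono {R' : ℝ} (hf : AdmissibleWith c R f) (h : R ≤ R') : AdmissibleWith c R' f :=
  ⟨hf.1, fun x hx => (hf.2 x hx).imp fun _ ⟨hy, hR⟩ => ⟨hy, hR.trans h⟩⟩

lemma add (hf : AdmissibleWith c R f) (hg : AdmissibleWith c R g) :
    AdmissibleWith c R (f + g) := by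
  refine ⟨hf.1.add hg.1, fun x hx => ?_⟩
  by_cases h : f x = 0
  · exact hg.2 x (by simpa [h] using hx)
  · exact hf.2 x h

lemma smul (hf : AdmissibleWith c R f) (t : ℝ) : AdmissibleWith c R (t • f) :=
  ⟨hf.1.const_smul t, fun x hx => hf.2 x fun h => hx (by simp [h])⟩

lemma pd (hf : AdmissibleWith c R f) (μ : Fin 4) : AdmissibleWith c (R + 3) (pd μ f) := by
  refine ⟨contDiff_pd hf.1 μ, fun x hx => ?_⟩
  have hmem : x ∈ tsupport f := by
    by_contra h
    rw [notMem_tsupport_iff_eventuallyEq] at h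
    exact hx (by simp [StringYM.pd, h.fderiv_eq])
  obtain ⟨x', hx', hdist⟩ := Metric.mem_closure_iff.1 hmem 1 one_pos
  obtain ⟨y, hy, hR⟩ := hf.2 x' hx'
  have hle := spacelikeExcess_le_add_norm_sub (x + y) (x' + y)
  rw [add_sub_add_right_eq_sub, ← dist_eq_norm] at hle
  exact ⟨y, hy, by linarith⟩

end AdmissibleWith

namespace Admissible

lemma exists₂ (hf : Admissible c f) (hg : Admissible c g) :
    ∃ R, AdmissibleWith c R f ∧ AdmissibleWith c R g :=
  let ⟨R₁, h₁⟩ := admissible_iff_exists_admissibleWith.1 hf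
  let ⟨R₂, h₂⟩ := admissible_iff_exists_admissibleWith.1 hg
  ⟨max R₁ R₂, h₁.mono (le_max_left _ _), h₂.mono (le_max_right _ _)⟩

lemma contDiff (hf : Admissible c f) : ContDiff ℝ ∞ f := hf.1

lemma differentiable (hf : Admissible c f) : Differentiable ℝ f :=
  hf.contDiff.differentiable (by simp)

lemma zero : Admissible c (0 : Spacetime → ℝ) :=
  ⟨contDiff_const, 0, fun _ hx => absurd rfl hx⟩

lemma add (hf : Admissible c f) (hg : Admissible c g) : Admissible c (f + g) :=
  let ⟨_, h₁, h₂⟩ := hf.exists₂ hg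
  (h₁.add h₂).admissible

lemma smul (hf : Admissible c f) (t : ℝ) : Admissible c (t • f) :=
  ⟨hf.1.const_smul t, hf.2.imp fun _ h x hx => h x fun h0 => hx (by simp [h0])⟩

lemma mul (hf : Admissible c f) (hg : ContDiff ℝ ∞ g) : Admissible c (f * g) :=
  ⟨hf.1.mul hg, hf.2.imp fun _ h x hx => h x fun h0 => hx (by simp [h0])⟩

lemma pd (hf : Admissible c f) (μ : Fin 4) : Admissible c (pd μ f) :=
  let ⟨_, h⟩ := admissible_iff_exists_admissibleWith.1 hf
  (h.pd μ).admissible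

lemma sum {κ : Type*} (s : Finset κ) {f : κ → Spacetime → ℝ} (hf : ∀ i ∈ s, Admissible c (f i)) :
    Admissible c (∑ i ∈ s, f i) :=
  Finset.sum_induction f (Admissible c) (fun _ _ => add) zero hf

end Admissible

/-! ### String integrals of admissible functions -/

/-- Test functions on spacetime. -/
abbrev TestFn := 𝓓((⊤ : Opens Spacetime), ℝ)

namespace StringFunction

variable {φ : TestFn}

lemma disjoint_cone_tsupport_sub_iff :
    Disjoint c.cone (tsupport (f - ⇑φ)) ↔ ∀ y ∈ c.cone, f =ᶠ[𝓝 y] φ := by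
  rw [Set.disjoint_left]
  refine forall₂_congr fun y _ => ?_
  rw [notMem_tsupport_iff_eventuallyEq]
  exact eventually_congr (.of_forall fun z => by simp [sub_eq_zero])

lemma pair_eq (μ : Fin 4) (h : ∀ y ∈ c.cone, f =ᶠ[𝓝 y] φ) : c.pair μ f = c.c μ φ := by
  have hex : ∃ ψ : TestFn, Disjoint c.cone (tsupport (f - ⇑ψ)) :=
    ⟨φ, disjoint_cone_tsupport_sub_iff.2 h⟩
  have hchoose := disjoint_cone_tsupport_sub_iff.1 hex.choose_spec
  rw [pair, dif_pos hex, ← sub_eq_zero, ← map_sub]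
  refine c.supported μ _ fun y hy hyc => absurd hy (notMem_tsupport_iff_eventuallyEq.2 ?_)
  filter_upwards [hchoose y hyc, h y hyc] with z hz₁ hz₂
  simp [← hz₁, ← hz₂]

lemma pair_congr (μ : Fin 4) (h : ∀ y ∈ c.cone, f =ᶠ[𝓝 y] g) : c.pair μ f = c.pair μ g := by
  by_cases hf : ∃ φ : TestFn, ∀ y ∈ c.cone, f =ᶠ[𝓝 y] φ
  · obtain ⟨φ, hφ⟩ := hf
    rw [pair_eq μ hφ, pair_eq μ fun y hy => (h y hy).symm.trans (hφ y hy)]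
  · have hg : ¬∃ φ : TestFn, ∀ y ∈ c.cone, g =ᶠ[𝓝 y] φ :=
      fun ⟨φ, hφ⟩ => hf ⟨φ, fun y hy => (h y hy).trans (hφ y hy)⟩
    simp only [← disjoint_cone_tsupport_sub_iff] at hf hg
    rw [pair, pair, dif_neg hf, dif_neg hg]

lemma sum_apply_lineDeriv (c : StringFunction) (φ : TestFn) :
    ∑ μ, c.c μ (∂_{coordVec μ} φ) = -φ 0 := by
  have h := DFunLike.congr_fun c.div_eq_delta φ
  simp only [Fin.sum_univ_four, FunLike.coe_add, Pi.add_apply,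
    Distribution.lineDerivOp_apply_apply, map_neg, Distribution.delta_apply] at h ⊢
  linarith

end StringFunction

section Cutoff

variable (c)

-- `f(x + ·)` is supported in `J(B_R) - C - x`, which meets `C` in a bounded set: the cone is
-- spacelike and salient.
lemma exists_cutoff (R r : ℝ) : ∃ χ : TestFn, ∀ f, AdmissibleWith c R f → ∀ x, ‖x‖ ≤ r →
    ∀ y ∈ c.cone, (fun z => f (x + z)) =ᶠ[𝓝 y] fun z => χ z * f (x + z) := by
  obtain ⟨L, hL⟩ := c.exists_norm_le_of_spacelikeExcess_le R (r + 1)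
  let b : ContDiffBump (0 : Spacetime) := ⟨|L| + 1, |L| + 2, by positivity, by linarith⟩
  refine ⟨⟨b, b.contDiff, b.hasCompactSupport, fun _ _ => trivial⟩, fun f hf x hx y hy => ?_⟩
  filter_upwards [ball_mem_nhds y one_pos] with z hz
  rw [mem_ball, dist_eq_norm] at hz
  rcases eq_or_ne (f (x + z)) 0 with h0 | h0
  · simp [h0]
  obtain ⟨w, hw, hR⟩ := hf.2 _ h0
  have hyL : ‖y‖ ≤ L := by
    refine hL (x + (z - y)) ((norm_add_le _ _).trans (add_le_add hx hz.le)) y hy w hw ?_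
    rwa [add_assoc x, sub_add_cancel]
  have hzL : ‖z‖ ≤ |L| + 1 := by
    calc ‖z‖ = ‖y + (z - y)‖ := by rw [add_sub_cancel]
      _ ≤ |L| + 1 := (norm_add_le _ _).trans (add_le_add (hyL.trans (le_abs_self L)) hz.le)
  have hbz : b z = 1 := b.one_of_mem_closedBall (mem_closedBall_zero_iff.2 hzL)
  exact (one_mul (f (x + z))).symm.trans (congrArg (· * f (x + z)) hbz.symm)

lemma exists_stringInt_eventuallyEq_regularize (R : ℝ) (x : Spacetime) :
    ∃ χ : TestFn, ∀ f, ∀ hf : AdmissibleWith c R f, ∀ μ,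
      stringInt c μ f =ᶠ[𝓝 x] regularize (c.c μ) χ f hf.1 := by
  obtain ⟨χ, hχ⟩ := exists_cutoff c R (‖x‖ + 1)
  refine ⟨χ, fun f hf μ => ?_⟩
  filter_upwards [(continuous_norm.tendsto x).eventually_le_const (lt_add_one ‖x‖)] with z hz
  exact StringFunction.pair_eq μ (hχ f hf z hz)

end Cutoff

lemma stringInt_congr {x : Spacetime} {ε : ℝ} (hε : 0 < ε)
    (h : ∀ z ∈ thickening ε ((fun y => x + y) '' c.cone), f z = g z) (μ : Fin 4) :
    stringInt c μ f x = stringInt c μ g x := by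
  refine StringFunction.pair_congr μ fun y hy => ?_
  filter_upwards [ball_mem_nhds y hε] with z hz
  exact h _ (mem_thickening_iff.2 ⟨x + y, ⟨y, hy, rfl⟩, by simpa using hz⟩)

lemma AdmissibleWith.stringInt {R : ℝ} (hf : AdmissibleWith c R f) (μ : Fin 4) :
    AdmissibleWith c (R + 3) (stringInt c μ f) := by
  refine ⟨contDiff_iff_contDiffAt.2 fun x => ?_, fun x hx => ?_⟩
  · obtain ⟨χ, hχ⟩ := exists_stringInt_eventuallyEq_regularize c R x
    exact (contDiff_regularize (c.c μ) χ hf.1).contDiffAt.congr_of_eventuallyEq (hχ f hf μ)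
  · by_contra! hfar
    refine hx ((StringFunction.pair_eq (φ := 0) μ fun y hy => ?_).trans (map_zero _))
    filter_upwards [ball_mem_nhds y one_pos] with z hz
    by_contra h0
    obtain ⟨w, hw, hR⟩ := hf.2 _ h0
    have hle := spacelikeExcess_le_add_norm_sub (x + (y + w)) (x + z + w)
    rw [← add_assoc, add_sub_add_right_eq_sub, add_sub_add_left_eq_sub, norm_sub_rev,
      ← dist_eq_norm, add_assoc] at hle
    linarith [hfar (y + w) (c.add_mem hy hw), mem_ball.1 hz]

lemma Admissible.stringInt (hf : Admissible c f) (μ : Fin 4) : Admissible c (stringInt c μ f) :=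
  let ⟨_, h⟩ := admissible_iff_exists_admissibleWith.1 hf
  (h.stringInt μ).admissible

lemma stringInt_add (hf : Admissible c f) (hg : Admissible c g) (μ : Fin 4) :
    stringInt c μ (f + g) = stringInt c μ f + stringInt c μ g := by
  obtain ⟨R, h₁, h₂⟩ := hf.exists₂ hg
  ext x
  obtain ⟨χ, hχ⟩ := exists_stringInt_eventuallyEq_regularize c R x
  rw [Pi.add_apply, (hχ _ h₁ μ).eq_of_nhds, (hχ _ h₂ μ).eq_of_nhds,
    (hχ _ (h₁.add h₂) μ).eq_of_nhds, regularize_add]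

lemma stringInt_smul (hf : Admissible c f) (t : ℝ) (μ : Fin 4) :
    stringInt c μ (t • f) = t • stringInt c μ f := by
  obtain ⟨R, h⟩ := admissible_iff_exists_admissibleWith.1 hf
  ext x
  obtain ⟨χ, hχ⟩ := exists_stringInt_eventuallyEq_regularize c R x
  rw [Pi.smul_apply, (hχ _ h μ).eq_of_nhds, (hχ _ (h.smul t) μ).eq_of_nhds, regularize_smul]

lemma stringInt_zero (μ : Fin 4) : stringInt c μ 0 = 0 := by
  simpa using stringInt_smul (c := c) Admissible.zero 0 μ

lemma pd_stringInt (hf : Admissible c f) (μ ν : Fin 4) :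
    pd ν (stringInt c μ f) = stringInt c μ (pd ν f) := by
  obtain ⟨R, h⟩ := admissible_iff_exists_admissibleWith.1 hf
  have h' : AdmissibleWith c (R + 3) f := h.mono (by linarith)
  ext x
  obtain ⟨χ, hχ⟩ := exists_stringInt_eventuallyEq_regularize c (R + 3) x
  rw [(hχ _ (h.pd ν) μ).eq_of_nhds, pd, (hχ _ h' μ).fderiv_eq, fderiv_regularize_apply]
  rfl

lemma pd_comp_const_add (μ : Fin 4) (x y : Spacetime) :
    pd μ (fun z => f (x + z)) y = pd μ f (x + y) := by
  rw [pd, pd, fderiv_comp_add_left]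

lemma sum_stringInt_pd (hf : Admissible c f) : ∑ μ, stringInt c μ (pd μ f) = -f := by
  obtain ⟨R, h⟩ := admissible_iff_exists_admissibleWith.1 hf
  ext x
  obtain ⟨χ, hχ⟩ := exists_cutoff c R ‖x‖
  let φ : TestFn := mulTest χ (fun y => f (x + y)) (h.1.comp (contDiff_const.add contDiff_id))
  have hφ : ∀ y ∈ c.cone, (fun z => f (x + z)) =ᶠ[𝓝 y] φ := hχ f h x le_rfl
  have hpd : ∀ μ, stringInt c μ (pd μ f) x = c.c μ (∂_{coordVec μ} φ) := fun μ =>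
    StringFunction.pair_eq μ fun y hy => by
      filter_upwards [(hφ y hy).eventuallyEq_nhds] with z hz
      rw [← pd_comp_const_add, pd, hz.fderiv_eq]
      rfl
  have hφ0 : φ 0 = f x := by simpa using ((hφ 0 c.zero_mem).eq_of_nhds).symm
  rw [Finset.sum_apply, Finset.sum_congr rfl fun μ _ => hpd μ, c.sum_apply_lineDeriv, hφ0,
    Pi.neg_apply]

/-! ### Partial derivatives -/

section PartialDerivatives

variable {E : Type*} [NormedAddCommGroup E] [NormedSpace ℝ E] {f g : Spacetime → E}

lemma pd_zero (μ : Fin 4) : pd μ (0 : Spacetime → E) = 0 := by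
  ext1 x
  simp [pd]

lemma pd_add (hf : Differentiable ℝ f) (hg : Differentiable ℝ g) (μ : Fin 4) :
    pd μ (f + g) = pd μ f + pd μ g := by
  ext1 x
  simp [pd, fderiv_add (hf x) (hg x)]

lemma pd_sub (hf : Differentiable ℝ f) (hg : Differentiable ℝ g) (μ : Fin 4) :
    pd μ (f - g) = pd μ f - pd μ g := by
  ext1 x
  simp [pd, fderiv_sub (hf x) (hg x)]

lemma pd_smul {R : Type*} [Monoid R] [DistribMulAction R E] [SMulCommClass ℝ R E]
    [ContinuousConstSMul R E] (hf : Differentiable ℝ f) (r : R) (μ : Fin 4) :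
    pd μ (r • f) = r • pd μ f := by
  ext1 x
  simp [pd, fderiv_const_smul (hf x)]

lemma pd_sum {κ : Type*} (s : Finset κ) {f : κ → Spacetime → E}
    (hf : ∀ i ∈ s, Differentiable ℝ (f i)) (μ : Fin 4) :
    pd μ (∑ i ∈ s, f i) = ∑ i ∈ s, pd μ (f i) := by
  ext1 x
  simp [pd, fderiv_sum fun i hi => hf i hi x]

lemma pd_mul {𝔸 : Type*} [NormedCommRing 𝔸] [NormedAlgebra ℝ 𝔸] {f g : Spacetime → 𝔸}
    (hf : Differentiable ℝ f) (hg : Differentiable ℝ g) (μ : Fin 4) :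
    pd μ (f * g) = pd μ f * g + f * pd μ g := by
  ext1 x
  simp only [pd, fderiv_mul (hf x) (hg x), FunLike.coe_add, FunLike.coe_smul, Pi.add_apply,
    Pi.mul_apply, Pi.smul_apply, smul_eq_mul]
  ring

lemma pd_pd_apply (hf : ContDiff ℝ ∞ f) (μ ν : Fin 4) (x : Spacetime) :
    pd μ (pd ν f) x = fderiv ℝ (fderiv ℝ f) x (coordVec μ) (coordVec ν) := by
  have hd : DifferentiableAt ℝ (fderiv ℝ f) x :=
    (hf.fderiv_right (m := ∞) (by simp)).differentiable (by simp) x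
  have h := hd.hasFDerivAt.clm_apply (hasFDerivAt_const (coordVec ν) x)
  change fderiv ℝ (fun z => fderiv ℝ f z (coordVec ν)) x (coordVec μ) = _
  simp [h.fderiv]

lemma pd_pd_comm (hf : ContDiff ℝ ∞ f) (μ ν : Fin 4) : pd μ (pd ν f) = pd ν (pd μ f) := by
  ext1 x
  rw [pd_pd_apply hf, pd_pd_apply hf]
  refine hf.contDiffAt.isSymmSndFDerivAt ?_ _ _
  rw [minSmoothness_of_isRCLikeNormedField]
  exact WithTop.coe_le_coe.2 le_top

end PartialDerivatives

variable {ι : Type*} {c : StringFunction} {L : (Spacetime → ℝ) → Spacetime → ℝ}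

/-! ### Regular fields -/

lemma zero_mem_configs : (0 : Conf ι) ∈ configs ι c :=
  ⟨fun _ _ => Admissible.zero, fun _ => Admissible.zero⟩

lemma add_smul_mem_configs {Φ Ψ : Conf ι} (hΦ : Φ ∈ configs ι c) (hΨ : Ψ ∈ configs ι c) (t : ℝ) :
    Φ + t • Ψ ∈ configs ι c :=
  ⟨fun μ a => (hΦ.1 μ a).add ((hΨ.1 μ a).smul t), fun a => (hΦ.2 a).add ((hΨ.2 a).smul t)⟩

/-- Polynomials with admissible coefficients; the variable is the parameter of a line of
configurations. -/
def AdmissibleCoeffs (c : StringFunction) (p : Polynomial (Spacetime → ℝ)) : Prop :=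
  ∀ k, Admissible c (p.coeff k)

namespace AdmissibleCoeffs

variable {p q : Polynomial (Spacetime → ℝ)} {f : Spacetime → ℝ}

lemma monomial (hf : Admissible c f) (k : ℕ) :
    AdmissibleCoeffs c (Polynomial.monomial k f) := fun n => by
  rw [Polynomial.coeff_monomial]
  split_ifs
  exacts [hf, Admissible.zero]

lemma add (hp : AdmissibleCoeffs c p) (hq : AdmissibleCoeffs c q) : AdmissibleCoeffs c (p + q) :=
  fun k => by
    rw [Polynomial.coeff_add]
    exact (hp k).add (hq k)

lemma smul (hp : AdmissibleCoeffs c p) (t : ℝ) : AdmissibleCoeffs c (t • p) := fun k => by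
  rw [Polynomial.coeff_smul]
  exact (hp k).smul t

lemma mul (hp : AdmissibleCoeffs c p) (hq : AdmissibleCoeffs c q) : AdmissibleCoeffs c (p * q) :=
  fun k => by
    rw [Polynomial.coeff_mul]
    exact Admissible.sum _ fun i _ => (hp i.1).mul (hq i.2).1

end AdmissibleCoeffs

/-- The value of a polynomial with function coefficients at a real parameter. -/
def evalAt (t : ℝ) (p : Polynomial (Spacetime → ℝ)) : Spacetime → ℝ :=
  p.eval (algebraMap ℝ (Spacetime → ℝ) t)

section EvalAt

variable (t : ℝ) (p q : Polynomial (Spacetime → ℝ))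

lemma evalAt_add : evalAt t (p + q) = evalAt t p + evalAt t q := Polynomial.eval_add

lemma evalAt_mul : evalAt t (p * q) = evalAt t p * evalAt t q := Polynomial.eval_mul

lemma evalAt_smul (r : ℝ) : evalAt t (r • p) = r • evalAt t p := Polynomial.eval_smul r p _

lemma evalAt_monomial (k : ℕ) (f : Spacetime → ℝ) :
    evalAt t (Polynomial.monomial k f) = t ^ k • f := by
  rw [evalAt, Polynomial.eval_monomial, ← map_pow, mul_comm, ← Algebra.smul_def]

lemma evalAt_sum {κ : Type*} (s : Finset κ) (p : κ → Polynomial (Spacetime → ℝ)) :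
    evalAt t (∑ i ∈ s, p i) = ∑ i ∈ s, evalAt t (p i) := Polynomial.eval_finsetSum s p _

lemma evalAt_eq_sum : evalAt t p = ∑ k ∈ Finset.range (p.natDegree + 1), t ^ k • p.coeff k := by
  conv_lhs => rw [p.as_sum_range, evalAt_sum]
  simp only [evalAt_monomial]

lemma evalAt_zero : evalAt 0 p = p.coeff 0 := by
  rw [evalAt, map_zero, Polynomial.coeff_zero_eq_eval_zero]

lemma deriv_evalAt (x : Spacetime) : deriv (fun t => evalAt t p x) 0 = p.coeff 1 x := by
  have h : ∀ t, evalAt t p x = (p.map (Pi.evalRingHom (fun _ => ℝ) x)).eval t := fun t => by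
    rw [evalAt, ← Pi.evalRingHom_apply (fun _ : Spacetime => ℝ) x (p.eval _),
      ← Polynomial.eval_map_apply]
    rfl
  simp only [h, Polynomial.deriv, ← Polynomial.coeff_zero_eq_eval_zero,
    Polynomial.coeff_derivative, Polynomial.coeff_map]
  simp

end EvalAt

/-- Linear operators on admissible functions whose value at `x` depends on the function only near
the string `x + C`: the common properties of derivatives and string integrals. -/
structure IsStringLocalOp (c : StringFunction) (L : (Spacetime → ℝ) → Spacetime → ℝ) : Prop where
  admissible : ∀ {f}, Admissible c f → Admissible c (L f)
  map_add : ∀ {f g}, Admissible c f → Admissible c g → L (f + g) = L f + L g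
  map_smul : ∀ (t : ℝ) {f}, Admissible c f → L (t • f) = t • L f
  congr : ∀ {f g x ε}, 0 < ε → (∀ z ∈ thickening ε ((fun y => x + y) '' c.cone), f z = g z) →
    L f x = L g x

lemma isStringLocalOp_pd (μ : Fin 4) : IsStringLocalOp c (pd μ) where
  admissible hf := hf.pd μ
  map_add hf hg := pd_add hf.differentiable hg.differentiable μ
  map_smul t _ hf := pd_smul hf.differentiable t μ
  congr {f g x ε} hε h := by
    have hfg : f =ᶠ[𝓝 x] g := by
      filter_upwards [ball_mem_nhds x hε] with z hz
      exact h z (mem_thickening_iff.2 ⟨x, ⟨0, c.zero_mem, add_zero x⟩, hz⟩)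
    rw [pd, pd, hfg.fderiv_eq]

lemma isStringLocalOp_stringInt (μ : Fin 4) : IsStringLocalOp c (stringInt c μ) where
  admissible hf := hf.stringInt μ
  map_add hf hg := stringInt_add hf hg μ
  map_smul t _ hf := stringInt_smul hf t μ
  congr hε h := stringInt_congr hε h μ

namespace IsStringLocalOp

lemma map_zero (hL : IsStringLocalOp c L) : L 0 = 0 := by
  simpa using hL.map_smul 0 Admissible.zero

lemma map_sum (hL : IsStringLocalOp c L) {κ : Type*} (s : Finset κ) {f : κ → Spacetime → ℝ}
    (hf : ∀ i ∈ s, Admissible c (f i)) : L (∑ i ∈ s, f i) = ∑ i ∈ s, L (f i) := by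
  classical
  induction s using Finset.induction_on with
  | empty => simp [hL.map_zero]
  | insert a s ha ih =>
    rw [Finset.forall_mem_insert] at hf
    rw [Finset.sum_insert ha, Finset.sum_insert ha, hL.map_add hf.1 (.sum s hf.2), ih hf.2]

lemma exists_evalAt_eq (hL : IsStringLocalOp c L) {p : Polynomial (Spacetime → ℝ)}
    (hp : AdmissibleCoeffs c p) :
    ∃ q, (∀ k, q.coeff k = L (p.coeff k)) ∧ ∀ t, L (evalAt t p) = evalAt t q := by
  refine ⟨∑ k ∈ Finset.range (p.natDegree + 1), Polynomial.monomial k (L (p.coeff k)),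
    fun k => ?_, fun t => ?_⟩
  · simp only [Polynomial.finsetSum_coeff, Polynomial.coeff_monomial, Finset.sum_ite_eq',
      Finset.mem_range]
    split_ifs with h
    · rfl
    · rw [Polynomial.coeff_eq_zero_of_natDegree_lt (by omega), hL.map_zero]
  · rw [evalAt_eq_sum, hL.map_sum _ fun k _ => (hp k).smul _, evalAt_sum]
    exact Finset.sum_congr rfl fun k _ => by rw [hL.map_smul _ (hp k), evalAt_monomial]

end IsStringLocalOp

/-- A field is regular if it is polynomial along lines of configurations, with admissible
coefficients, and its value at `x` only depends on the potential near the string `x + C`. -/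
structure IsRegular (c : StringFunction) (X : QField ι) : Prop where
  exists_poly : ∀ Φ ∈ configs ι c, ∀ Ψ ∈ configs ι c, ∃ p, AdmissibleCoeffs c p ∧
    ∀ t : ℝ, X (Φ + t • Ψ) = evalAt t p
  localized : ∀ x, ∀ ε > 0, ∀ Φ ∈ configs ι c, ∀ Ψ ∈ configs ι c,
    (∀ z ∈ thickening ε ((fun y => x + y) '' c.cone), ∀ μ a, Φ.1 μ a z = Ψ.1 μ a z) → X Φ x = X Ψ x

lemma thickening_string_subset {x z : Spacetime} {ε : ℝ}
    (hz : z ∈ thickening (ε / 2) ((fun y => x + y) '' c.cone)) :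
    thickening (ε / 2) ((fun y => z + y) '' c.cone) ⊆
      thickening ε ((fun y => x + y) '' c.cone) := by
  intro w hw
  obtain ⟨_, ⟨y, hy, rfl⟩, hzy⟩ := mem_thickening_iff.1 hz
  obtain ⟨_, ⟨y', hy', rfl⟩, hwy'⟩ := mem_thickening_iff.1 hw
  refine mem_thickening_iff.2 ⟨x + (y + y'), ⟨y + y', c.add_mem hy hy', rfl⟩, ?_⟩
  calc dist w (x + (y + y'))
      ≤ dist w (z + y') + dist (z + y') (x + (y + y')) := dist_triangle _ _ _
    _ = dist w (z + y') + dist z (x + y) := by rw [← add_assoc, dist_add_right]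
    _ < ε := by linarith

lemma isRegular_zero : IsRegular c (0 : QField ι) where
  exists_poly _ _ _ _ := ⟨0, fun _ => Admissible.zero, fun t => by simp [evalAt]⟩
  localized _ _ _ _ _ _ _ _ := rfl

lemma isRegular_fieldA (μ : Fin 4) (a : ι) : IsRegular c (fieldA μ a) where
  exists_poly Φ hΦ Ψ hΨ :=
    ⟨Polynomial.monomial 0 (Φ.1 μ a) + Polynomial.monomial 1 (Ψ.1 μ a),
      (AdmissibleCoeffs.monomial (hΦ.1 μ a) 0).add (AdmissibleCoeffs.monomial (hΨ.1 μ a) 1),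
      fun t => by
        simp only [evalAt_add, evalAt_monomial, pow_zero, pow_one, one_smul, fieldA, Prod.fst_add,
          Prod.smul_fst, Pi.add_apply, Pi.smul_apply]⟩
  localized x ε hε Φ _ Ψ _ h :=
    h x (mem_thickening_iff.2 ⟨x, ⟨0, c.zero_mem, add_zero x⟩, by simpa using hε⟩) μ a

namespace IsRegular

variable {X Y : QField ι}

lemma admissible (hX : IsRegular c X) {Φ : Conf ι} (hΦ : Φ ∈ configs ι c) :
    Admissible c (X Φ) := by
  obtain ⟨p, hp, h⟩ := hX.exists_poly Φ hΦ 0 zero_mem_configs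
  have h₀ := h 0
  rw [smul_zero, add_zero, evalAt_zero] at h₀
  exact h₀ ▸ hp 0

lemma add (hX : IsRegular c X) (hY : IsRegular c Y) : IsRegular c (X + Y) where
  exists_poly Φ hΦ Ψ hΨ := by
    obtain ⟨p, hp, hXp⟩ := hX.exists_poly Φ hΦ Ψ hΨ
    obtain ⟨q, hq, hYq⟩ := hY.exists_poly Φ hΦ Ψ hΨ
    exact ⟨p + q, hp.add hq, fun t => by rw [Pi.add_apply, hXp, hYq, evalAt_add]⟩
  localized x ε hε Φ hΦ Ψ hΨ h :=
    congrArg₂ (· + ·) (hX.localized x ε hε Φ hΦ Ψ hΨ h) (hY.localized x ε hε Φ hΦ Ψ hΨ h)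

lemma smul (hX : IsRegular c X) (r : ℝ) : IsRegular c (r • X) where
  exists_poly Φ hΦ Ψ hΨ := by
    obtain ⟨p, hp, hXp⟩ := hX.exists_poly Φ hΦ Ψ hΨ
    exact ⟨r • p, hp.smul r, fun t => by rw [Pi.smul_apply, hXp, evalAt_smul]⟩
  localized x ε hε Φ hΦ Ψ hΨ h := congrArg (r • ·) (hX.localized x ε hε Φ hΦ Ψ hΨ h)

lemma sub (hX : IsRegular c X) (hY : IsRegular c Y) : IsRegular c (X - Y) := by
  simpa only [neg_one_smul, ← sub_eq_add_neg] using hX.add (hY.smul (-1))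

lemma mul (hX : IsRegular c X) (hY : IsRegular c Y) : IsRegular c (X * Y) where
  exists_poly Φ hΦ Ψ hΨ := by
    obtain ⟨p, hp, hXp⟩ := hX.exists_poly Φ hΦ Ψ hΨ
    obtain ⟨q, hq, hYq⟩ := hY.exists_poly Φ hΦ Ψ hΨ
    exact ⟨p * q, hp.mul hq, fun t => by rw [Pi.mul_apply, hXp, hYq, evalAt_mul]⟩
  localized x ε hε Φ hΦ Ψ hΨ h :=
    congrArg₂ (· * ·) (hX.localized x ε hε Φ hΦ Ψ hΨ h) (hY.localized x ε hε Φ hΦ Ψ hΨ h)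

lemma sum {κ : Type*} (s : Finset κ) {X : κ → QField ι} (hX : ∀ i ∈ s, IsRegular c (X i)) :
    IsRegular c (∑ i ∈ s, X i) :=
  Finset.sum_induction X (IsRegular c) (fun _ _ => add) isRegular_zero hX

lemma comp (hX : IsRegular c X) (hL : IsStringLocalOp c L) :
    IsRegular c (fun Φ => L (X Φ)) where
  exists_poly Φ hΦ Ψ hΨ := by
    obtain ⟨p, hp, hXp⟩ := hX.exists_poly Φ hΦ Ψ hΨ
    obtain ⟨q, hqp, hq⟩ := hL.exists_evalAt_eq hp
    exact ⟨q, fun k => hqp k ▸ hL.admissible (hp k), fun t => by rw [hXp, hq]⟩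
  localized x ε hε Φ hΦ Ψ hΨ h :=
    hL.congr (half_pos hε) fun z hz => hX.localized z (ε / 2) (half_pos hε) Φ hΦ Ψ hΨ
      fun w hw => h w (thickening_string_subset hz hw)

lemma fieldPd (hX : IsRegular c X) (μ : Fin 4) : IsRegular c (fieldPd μ X) :=
  hX.comp (isStringLocalOp_pd μ)

lemma fieldInt (hX : IsRegular c X) (μ : Fin 4) : IsRegular c (fieldInt c μ X) :=
  hX.comp (isStringLocalOp_stringInt μ)

end IsRegular

section StringIntegrals

variable {X Y : QField ι} {Φ : Conf ι}

lemma sum_fieldInt_fieldPd (hX : IsRegular c X) (hΦ : Φ ∈ configs ι c) :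
    (∑ ν, fieldInt c ν (fieldPd ν X)) Φ = -X Φ := by
  rw [Finset.sum_apply]
  exact sum_stringInt_pd (hX.admissible hΦ)

lemma fieldInt_add_apply (hX : IsRegular c X) (hY : IsRegular c Y) (hΦ : Φ ∈ configs ι c)
    (ν : Fin 4) : fieldInt c ν (X + Y) Φ = fieldInt c ν X Φ + fieldInt c ν Y Φ :=
  stringInt_add (hX.admissible hΦ) (hY.admissible hΦ) ν

lemma fieldInt_smul_apply (hX : IsRegular c X) (hΦ : Φ ∈ configs ι c) (t : ℝ) (ν : Fin 4) :
    fieldInt c ν (t • X) Φ = t • fieldInt c ν X Φ :=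
  stringInt_smul (hX.admissible hΦ) t ν

end StringIntegrals

/-! ### Functional derivatives -/

section DirDeriv

variable {v : Fin 4 → ι → QField ι} {X Y : QField ι}

/-- The configuration `(v, 0)` of a field variation that changes `A_μ` by `v_μ` and fixes `N`. -/
def potentialVariation (v : Fin 4 → ι → QField ι) (Φ : Conf ι) : Conf ι :=
  (fun μ a => v μ a Φ, 0)

/-- The functional derivative of `X` in the direction of the field variation `δA_μ = v_μ`,
`δN = 0`. -/
def dirDeriv (v : Fin 4 → ι → QField ι) (X : QField ι) : QField ι :=
  fun Φ x => deriv (fun t : ℝ => X (Φ + t • potentialVariation v Φ) x) 0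

/-- A variation of the potential that preserves the space of configurations. -/
def IsVariation (c : StringFunction) (v : Fin 4 → ι → QField ι) : Prop :=
  ∀ μ a, ∀ Φ ∈ configs ι c, Admissible c (v μ a Φ)

lemma IsVariation.potentialVariation_mem (hv : IsVariation c v) {Φ : Conf ι}
    (hΦ : Φ ∈ configs ι c) : potentialVariation v Φ ∈ configs ι c :=
  ⟨fun μ a => hv μ a Φ hΦ, fun _ => Admissible.zero⟩

lemma dirDeriv_eq_coeff {Φ : Conf ι} {p : Polynomial (Spacetime → ℝ)}
    (h : ∀ t : ℝ, X (Φ + t • potentialVariation v Φ) = evalAt t p) :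
    dirDeriv v X Φ = p.coeff 1 := by
  ext x
  simp only [dirDeriv, h]
  exact deriv_evalAt p x

lemma IsRegular.exists_evalAt_eq (hX : IsRegular c X) (hv : IsVariation c v) {Φ : Conf ι}
    (hΦ : Φ ∈ configs ι c) :
    ∃ p, AdmissibleCoeffs c p ∧ (∀ t : ℝ, X (Φ + t • potentialVariation v Φ) = evalAt t p) ∧
      X Φ = p.coeff 0 ∧ dirDeriv v X Φ = p.coeff 1 := by
  obtain ⟨p, hp, h⟩ := hX.exists_poly Φ hΦ _ (hv.potentialVariation_mem hΦ)
  refine ⟨p, hp, h, ?_, dirDeriv_eq_coeff h⟩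
  simpa only [zero_smul, add_zero, evalAt_zero] using h 0

lemma dirDeriv_congr (hv : IsVariation c v) (h : Set.EqOn X Y (configs ι c)) :
    Set.EqOn (dirDeriv v X) (dirDeriv v Y) (configs ι c) := by
  intro Φ hΦ
  ext x
  simp only [dirDeriv,
    fun t => h (add_smul_mem_configs hΦ (hv.potentialVariation_mem hΦ) t)]

lemma dirDeriv_zero_left (X : QField ι) : dirDeriv 0 X = 0 := by
  ext Φ x
  have h : potentialVariation 0 Φ = 0 := rfl
  simp [dirDeriv, h]

lemma dirDeriv_zero (v : Fin 4 → ι → QField ι) : dirDeriv v 0 = 0 := by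
  ext Φ x
  simp [dirDeriv]

lemma dirDeriv_fieldA (v : Fin 4 → ι → QField ι) (μ : Fin 4) (a : ι) :
    dirDeriv v (fieldA μ a) = v μ a := by
  ext Φ x
  have h : HasDerivAt (fun t : ℝ => Φ.1 μ a x + t * v μ a Φ x) (v μ a Φ x) 0 := by
    simpa using ((hasDerivAt_id (0 : ℝ)).mul_const (v μ a Φ x)).const_add (Φ.1 μ a x)
  exact h.deriv

lemma dirDeriv_fieldN (v : Fin 4 → ι → QField ι) (a : ι) : dirDeriv v (fieldN a) = 0 := by
  ext Φ x
  simp [dirDeriv, fieldN, potentialVariation]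

lemma dirDeriv_fieldPd_fieldN (v : Fin 4 → ι → QField ι) (κ : Fin 4) (a : ι) :
    dirDeriv v (fieldPd κ (fieldN a)) = 0 := by
  ext Φ x
  simp [dirDeriv, fieldN, fieldPd, potentialVariation]

lemma dirDeriv_add (hv : IsVariation c v) (hX : IsRegular c X) (hY : IsRegular c Y) :
    Set.EqOn (dirDeriv v (X + Y)) (dirDeriv v X + dirDeriv v Y) (configs ι c) := by
  intro Φ hΦ
  obtain ⟨p, -, hXp, -, hX₁⟩ := hX.exists_evalAt_eq hv hΦ
  obtain ⟨q, -, hYq, -, hY₁⟩ := hY.exists_evalAt_eq hv hΦ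
  rw [Pi.add_apply, hX₁, hY₁, ← Polynomial.coeff_add]
  exact dirDeriv_eq_coeff fun t => by rw [Pi.add_apply, hXp, hYq, evalAt_add]

lemma dirDeriv_smul (hv : IsVariation c v) (hX : IsRegular c X) (r : ℝ) :
    Set.EqOn (dirDeriv v (r • X)) (r • dirDeriv v X) (configs ι c) := by
  intro Φ hΦ
  obtain ⟨p, -, hXp, -, hX₁⟩ := hX.exists_evalAt_eq hv hΦ
  rw [Pi.smul_apply, hX₁, ← Polynomial.coeff_smul]
  exact dirDeriv_eq_coeff fun t => by rw [Pi.smul_apply, hXp, evalAt_smul]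

lemma dirDeriv_sum (hv : IsVariation c v) {κ : Type*} (s : Finset κ) {X : κ → QField ι}
    (hX : ∀ i ∈ s, IsRegular c (X i)) :
    Set.EqOn (dirDeriv v (∑ i ∈ s, X i)) (∑ i ∈ s, dirDeriv v (X i)) (configs ι c) := by
  classical
  induction s using Finset.induction_on with
  | empty => intro Φ _; simp [dirDeriv_zero]
  | insert i s hi ih =>
    intro Φ hΦ
    rw [Finset.forall_mem_insert] at hX
    rw [Finset.sum_insert hi, Finset.sum_insert hi, dirDeriv_add hv hX.1 (.sum s hX.2) hΦ,
      Pi.add_apply, Pi.add_apply, ih hX.2 hΦ]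

lemma dirDeriv_mul (hv : IsVariation c v) (hX : IsRegular c X) (hY : IsRegular c Y) :
    Set.EqOn (dirDeriv v (X * Y)) (dirDeriv v X * Y + X * dirDeriv v Y) (configs ι c) := by
  intro Φ hΦ
  obtain ⟨p, -, hXp, hX₀, hX₁⟩ := hX.exists_evalAt_eq hv hΦ
  obtain ⟨q, -, hYq, hY₀, hY₁⟩ := hY.exists_evalAt_eq hv hΦ
  rw [Pi.add_apply, Pi.mul_apply, Pi.mul_apply, hX₁, hY₁, hX₀, hY₀, add_comm,
    ← Polynomial.mul_coeff_one]
  exact dirDeriv_eq_coeff fun t => by rw [Pi.mul_apply, hXp, hYq, evalAt_mul]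

lemma dirDeriv_comp (hv : IsVariation c v) (hX : IsRegular c X) (hL : IsStringLocalOp c L) :
    Set.EqOn (dirDeriv v fun Φ => L (X Φ)) (fun Φ => L (dirDeriv v X Φ)) (configs ι c) := by
  intro Φ hΦ
  obtain ⟨p, hp, hXp, -, hX₁⟩ := hX.exists_evalAt_eq hv hΦ
  obtain ⟨q, hqp, hq⟩ := hL.exists_evalAt_eq hp
  beta_reduce
  rw [hX₁, ← hqp]
  exact dirDeriv_eq_coeff fun t => by rw [hXp, hq]

lemma dirDeriv_fieldPd (hv : IsVariation c v) (hX : IsRegular c X) (μ : Fin 4) :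
    Set.EqOn (dirDeriv v (fieldPd μ X)) (fieldPd μ (dirDeriv v X)) (configs ι c) :=
  dirDeriv_comp hv hX (isStringLocalOp_pd μ)

lemma dirDeriv_fieldInt (hv : IsVariation c v) (hX : IsRegular c X) (μ : Fin 4) :
    Set.EqOn (dirDeriv v (fieldInt c μ X)) (fieldInt c μ (dirDeriv v X)) (configs ι c) :=
  dirDeriv_comp hv hX (isStringLocalOp_stringInt μ)

end DirDeriv

variable {ι : Type*} [Fintype ι]

/-! ### The adjoint action -/

section AdField

variable {R R' : Type*} [CommRing R] [Algebra ℝ R] [CommRing R'] [Algebra ℝ R']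
  (f : ι → ι → ι → ℝ)

lemma adField_add_right (s v w : ι → R) :
    adField f s (v + w) = adField f s v + adField f s w := by
  ext k
  simp [adField, mul_add, Finset.sum_add_distrib]

lemma adField_smul_right (t : ℝ) (s v : ι → R) : adField f s (t • v) = t • adField f s v := by
  ext k
  simp only [adField, Pi.smul_apply, Algebra.mul_smul_comm, Finset.smul_sum]
  exact Finset.sum_congr rfl fun a _ => Finset.sum_congr rfl fun b _ => smul_comm _ _ _

lemma adField_zero_right (s : ι → R) : adField f s 0 = 0 := by
  ext k
  simp [adField]

lemma map_adField (φ : R →ₐ[ℝ] R') (s v : ι → R) (k : ι) :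
    φ (adField f s v k) = adField f (fun a => φ (s a)) (fun a => φ (v a)) k := by
  simp [adField, map_sum, map_smul, map_mul]

end AdField

variable {f : ι → ι → ι → ℝ} {c : StringFunction}

lemma adField_apply_congr {s s' u u' : ι → QField ι} {Φ : Conf ι} (hs : ∀ a, s a Φ = s' a Φ)
    (hu : ∀ a, u a Φ = u' a Φ) (k : ι) : adField f s u k Φ = adField f s' u' k Φ := by
  simp only [adField, Finset.sum_apply, Pi.smul_apply, Pi.mul_apply, hs, hu]

namespace IsRegular

variable {s u : ι → QField ι}

lemma adField (hs : ∀ a, IsRegular c (s a)) (hu : ∀ a, IsRegular c (u a)) (k : ι) :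
    IsRegular c (adField f s u k) :=
  sum _ fun a _ => sum _ fun b _ => ((hs a).mul (hu b)).smul _

lemma adList {l : List (ι → QField ι)} (hl : ∀ s ∈ l, ∀ a, IsRegular c (s a))
    (hu : ∀ a, IsRegular c (u a)) (k : ι) : IsRegular c (adList f l u k) := by
  induction l generalizing k with
  | nil => exact hu k
  | cons s l ih =>
    rw [List.forall_mem_cons] at hl
    exact adField hl.1 (ih hl.2) k

end IsRegular

lemma dirDeriv_adField {v : Fin 4 → ι → QField ι} (hv : IsVariation c v) {s u : ι → QField ι}
    (hs : ∀ a, IsRegular c (s a)) (hu : ∀ a, IsRegular c (u a)) (k : ι) :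
    Set.EqOn (dirDeriv v (adField f s u k))
      (adField f (fun a => dirDeriv v (s a)) u k + adField f s (fun a => dirDeriv v (u a)) k)
      (configs ι c) := by
  intro Φ hΦ
  unfold adField
  rw [dirDeriv_sum hv _ (fun a _ => .sum _ fun b _ => ((hs a).mul (hu b)).smul _) hΦ,
    ← Finset.sum_add_distrib, Finset.sum_apply, Finset.sum_apply]
  refine Finset.sum_congr rfl fun a _ => ?_
  rw [dirDeriv_sum hv _ (fun b _ => ((hs a).mul (hu b)).smul _) hΦ,
    ← Finset.sum_add_distrib, Finset.sum_apply, Finset.sum_apply]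
  refine Finset.sum_congr rfl fun b _ => ?_
  rw [dirDeriv_smul hv ((hs a).mul (hu b)) _ hΦ, Pi.smul_apply,
    dirDeriv_mul hv (hs a) (hu b) hΦ, ← smul_add]
  rfl

/-! ### The spaces `𝒮` and `𝒱` -/

lemma sum_fieldInt_adList_fieldA_mem {l : List (ι → QField ι)} (hl : ∀ s ∈ l, s ∈ spaceS f c) :
    (fun a => ∑ ν, fieldInt c ν (adList f l (fieldA ν) a)) ∈ spaceS f c :=
  Submodule.mem_sInf.2 fun p hp => hp.1 l fun s hs => Submodule.mem_sInf.1 (hl s hs) p hp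

lemma sum_fieldInt_adList_fieldPd_mem {l : List (ι → QField ι)} (hne : l ≠ [])
    (hl : ∀ s ∈ l, s ∈ spaceS f c) {s₀ : ι → QField ι} (hs₀ : s₀ ∈ spaceS f c) :
    (fun a => ∑ ν, fieldInt c ν (adList f l (fun b => fieldPd ν (s₀ b)) a)) ∈ spaceS f c :=
  Submodule.mem_sInf.2 fun p hp =>
    hp.2 l hne (fun s hs => Submodule.mem_sInf.1 (hl s hs) p hp) s₀ (Submodule.mem_sInf.1 hs₀ p hp)

variable (ι c) in
/-- The Lie-algebra-valued fields with regular components. -/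
def regularSubmodule : Submodule ℝ (ι → QField ι) where
  carrier := {s | ∀ a, IsRegular c (s a)}
  add_mem' hs ht a := (hs a).add (ht a)
  zero_mem' _ := isRegular_zero
  smul_mem' r _ hs a := (hs a).smul r

lemma spaceS_le_regularSubmodule : spaceS f c ≤ regularSubmodule ι c :=
  sInf_le
    ⟨fun _ hl a => IsRegular.sum _ fun ν _ =>
        (IsRegular.adList hl (isRegular_fieldA ν) a).fieldInt ν,
      fun _ _ hl _ hs₀ a => IsRegular.sum _ fun ν _ =>
        (IsRegular.adList hl (fun b => (hs₀ b).fieldPd ν) a).fieldInt ν⟩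

lemma isRegular_of_mem_spaceS {s : ι → QField ι} (hs : s ∈ spaceS f c) (a : ι) :
    IsRegular c (s a) :=
  spaceS_le_regularSubmodule hs a

/-- The components of an element of `𝒮` as generators of the Wick polynomials. -/
def sLetter (σ : spaceS f c) : ι → Wick f c := fun a => MvPolynomial.X (Letter.s σ a)

/-- The gauge potential as an element of `𝒱`. -/
def vecA : Fin 4 → ι → Wick f c := fun ν a => MvPolynomial.X (Letter.A ν a)

/-- The gradient of an element of `𝒮` as an element of `𝒱`. -/
def vecDs (σ : spaceS f c) : Fin 4 → ι → Wick f c := fun ν a => MvPolynomial.X (Letter.ds ν σ a)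

/-- The action of `ad_{is}` on vector fields. -/
def adVec (σ : spaceS f c) (u : Fin 4 → ι → Wick f c) : Fin 4 → ι → Wick f c :=
  fun ν => adField f (sLetter σ) (u ν)

lemma wickField_sLetter (σ : spaceS f c) (a : ι) : wickField (sLetter σ a) = σ.1 a := by
  simp [wickField, sLetter, Letter.toField]

lemma wickField_vecA (ν : Fin 4) (a : ι) :
    wickField (vecA (f := f) (c := c) ν a) = fieldA ν a := by
  simp [wickField, vecA, Letter.toField]

lemma wickField_vecDs (σ : spaceS f c) (ν : Fin 4) (a : ι) :
    wickField (vecDs σ ν a) = fieldPd ν (σ.1 a) := by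
  simp [wickField, vecDs, Letter.toField]

lemma wickField_adVec (σ : spaceS f c) (u : Fin 4 → ι → Wick f c) (ν : Fin 4) (a : ι) :
    wickField (adVec σ u ν a) = adField f σ.1 (fun b => wickField (u ν b)) a := by
  simp only [adVec, map_adField, wickField_sLetter]

lemma wickField_adList (l : List (spaceS f c)) (v : ι → Wick f c) (a : ι) :
    wickField (adList f (l.map sLetter) v a) =
      adList f (l.map Subtype.val) (fun b => wickField (v b)) a := by
  induction l generalizing a with
  | nil => rfl
  | cons σ l ih =>
    change wickField (adField f (sLetter σ) (adList f (l.map sLetter) v) a) = adField f σ.1 _ a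
    simp only [map_adField, wickField_sLetter, ih]
    rfl

variable {u v w : Fin 4 → ι → Wick f c}

lemma vecA_mem : vecA ∈ spaceV f c := Submodule.subset_span (Or.inl ⟨[], rfl⟩)

lemma vecDs_mem (σ : spaceS f c) : vecDs σ ∈ spaceV f c :=
  Submodule.subset_span (Or.inr ⟨[], σ, rfl⟩)

lemma adVec_add (σ : spaceS f c) (u w : Fin 4 → ι → Wick f c) :
    adVec σ (u + w) = adVec σ u + adVec σ w :=
  funext fun _ => adField_add_right f _ _ _

lemma adVec_smul (σ : spaceS f c) (t : ℝ) (u : Fin 4 → ι → Wick f c) :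
    adVec σ (t • u) = t • adVec σ u :=
  funext fun _ => adField_smul_right f _ _ _

lemma adVec_zero (σ : spaceS f c) : adVec σ 0 = 0 :=
  funext fun _ => adField_zero_right f _

lemma adVec_mem (σ : spaceS f c) (hu : u ∈ spaceV f c) : adVec σ u ∈ spaceV f c := by
  induction hu using Submodule.span_induction with
  | mem u hu =>
    rcases hu with ⟨l, rfl⟩ | ⟨l, σ₀, rfl⟩
    · exact Submodule.subset_span (Or.inl ⟨σ :: l, rfl⟩)
    · exact Submodule.subset_span (Or.inr ⟨σ :: l, σ₀, rfl⟩)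
  | zero => rw [adVec_zero]; exact zero_mem _
  | add u w _ _ hu hw => rw [adVec_add]; exact add_mem hu hw
  | smul t u _ hu => rw [adVec_smul]; exact Submodule.smul_mem _ t hu

lemma spaceV_induction {P : (u : Fin 4 → ι → Wick f c) → u ∈ spaceV f c → Prop}
    (vecA : P vecA vecA_mem) (vecDs : ∀ σ, P (vecDs σ) (vecDs_mem σ))
    (adVec : ∀ σ u hu, P u hu → P (adVec σ u) (adVec_mem σ hu)) (zero : P 0 (zero_mem _))
    (add : ∀ u w hu hw, P u hu → P w hw → P (u + w) (add_mem hu hw))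
    (smul : ∀ (t : ℝ) u hu, P u hu → P (t • u) (Submodule.smul_mem _ t hu))
    (hu : u ∈ spaceV f c) : P u hu := by
  induction hu using Submodule.span_induction with
  | mem u hu =>
    rcases hu with ⟨l, rfl⟩ | ⟨l, σ₀, rfl⟩
    · induction l with
      | nil => exact vecA
      | cons σ l ih => exact adVec σ _ (Submodule.subset_span (Or.inl ⟨l, rfl⟩)) ih
    · induction l with
      | nil => exact vecDs σ₀
      | cons σ l ih => exact adVec σ _ (Submodule.subset_span (Or.inr ⟨l, σ₀, rfl⟩)) ih
  | zero => exact zero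
  | add u w h₁ h₂ hu hw => exact add u w h₁ h₂ hu hw
  | smul t u h₁ hu => exact smul t u h₁ hu

lemma isRegular_wickField (hu : u ∈ spaceV f c) (ν : Fin 4) (a : ι) :
    IsRegular c (wickField (u ν a)) := by
  induction hu using spaceV_induction generalizing a with
  | vecA => rw [wickField_vecA]; exact isRegular_fieldA ν a
  | vecDs σ => rw [wickField_vecDs]; exact (isRegular_of_mem_spaceS σ.2 a).fieldPd ν
  | adVec σ u _ hu =>
    rw [wickField_adVec]; exact IsRegular.adField (isRegular_of_mem_spaceS σ.2) hu a
  | zero => rw [Pi.zero_apply, Pi.zero_apply, map_zero]; exact isRegular_zero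
  | add u w _ _ hu hw => rw [Pi.add_apply, Pi.add_apply, map_add]; exact (hu a).add (hw a)
  | smul t u _ hu => rw [Pi.smul_apply, Pi.smul_apply, map_smul]; exact (hu a).smul t

/-- The Lie-algebra-valued scalar field `I_c^ν u_ν`. -/
def vecInt (c : StringFunction) (u : Fin 4 → ι → Wick f c) : ι → QField ι :=
  fun a => ∑ ν, fieldInt c ν (wickField (u ν a))

section VecInt

variable {Φ : Conf ι} (hΦ : Φ ∈ configs ι c) (a : ι)
include hΦ

lemma vecInt_add_apply (hu : u ∈ spaceV f c) (hw : w ∈ spaceV f c) :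
    vecInt c (u + w) a Φ = vecInt c u a Φ + vecInt c w a Φ := by
  simp only [vecInt, Pi.add_apply, map_add, Finset.sum_apply, ← Finset.sum_add_distrib,
    fieldInt_add_apply (isRegular_wickField hu _ a) (isRegular_wickField hw _ a) hΦ]

lemma vecInt_smul_apply (hu : u ∈ spaceV f c) (t : ℝ) :
    vecInt c (t • u) a Φ = t • vecInt c u a Φ := by
  simp only [vecInt, Pi.smul_apply, map_smul, Finset.sum_apply, Finset.smul_sum,
    fieldInt_smul_apply (isRegular_wickField hu _ a) hΦ]

lemma vecInt_vecDs_apply (σ : spaceS f c) : vecInt c (vecDs σ) a Φ = -σ.1 a Φ := by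
  simp only [vecInt, wickField_vecDs]
  exact sum_fieldInt_fieldPd (isRegular_of_mem_spaceS σ.2 a) hΦ

end VecInt

lemma vecInt_zero_apply (a : ι) (Φ : Conf ι) :
    vecInt c (0 : Fin 4 → ι → Wick f c) a Φ = 0 := by
  simp only [vecInt, Pi.zero_apply, map_zero, Finset.sum_apply]
  exact Finset.sum_eq_zero fun ν _ => stringInt_zero ν

lemma forall_mem_map_val (l : List (spaceS f c)) : ∀ s ∈ l.map Subtype.val, s ∈ spaceS f c :=
  fun _ hs => let ⟨σ, _, h⟩ := List.mem_map.1 hs; h ▸ σ.2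

lemma exists_spaceS_eqOn_vecInt (hu : u ∈ spaceV f c) :
    ∃ s ∈ spaceS f c, ∀ a, Set.EqOn (s a) (vecInt c u a) (configs ι c) := by
  induction hu using Submodule.span_induction with
  | mem u hu =>
    rcases hu with ⟨l, rfl⟩ | ⟨l, σ₀, rfl⟩
    · refine ⟨_, sum_fieldInt_adList_fieldA_mem (forall_mem_map_val l), fun a Φ _ => ?_⟩
      change _ = vecInt c (fun ν => adList f (l.map sLetter) (vecA ν)) a Φ
      simp only [vecInt, wickField_adList, wickField_vecA]
    · rcases eq_or_ne l [] with rfl | hl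
      · exact ⟨-σ₀.1, neg_mem σ₀.2, fun a Φ hΦ => (vecInt_vecDs_apply hΦ a σ₀).symm⟩
      · refine ⟨_, sum_fieldInt_adList_fieldPd_mem (List.map_eq_nil_iff.not.2 hl)
          (forall_mem_map_val l) σ₀.2, fun a Φ _ => ?_⟩
        change _ = vecInt c (fun ν => adList f (l.map sLetter) (vecDs σ₀ ν)) a Φ
        simp only [vecInt, wickField_adList, wickField_vecDs]
  | zero => exact ⟨0, zero_mem _, fun a Φ _ => (vecInt_zero_apply a Φ).symm⟩
  | add u w hu hw ihu ihw =>
    obtain ⟨s, hs, hsu⟩ := ihu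
    obtain ⟨t, ht, htw⟩ := ihw
    refine ⟨s + t, add_mem hs ht, fun a Φ hΦ => ?_⟩
    rw [vecInt_add_apply hΦ a hu hw, ← hsu a hΦ, ← htw a hΦ, Pi.add_apply, Pi.add_apply]
  | smul t u hu ih =>
    obtain ⟨s, hs, hsu⟩ := ih
    refine ⟨t • s, Submodule.smul_mem _ t hs, fun a Φ hΦ => ?_⟩
    rw [vecInt_smul_apply hΦ a hu, ← hsu a hΦ, Pi.smul_apply, Pi.smul_apply]

/-! ### Functional derivatives on `𝒮` and `𝒱` -/

/-- The fields that the Wick polynomials `u` stand for. -/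
abbrev vecField (u : Fin 4 → ι → Wick f c) : Fin 4 → ι → QField ι := fun ν a => wickField (u ν a)

lemma isVariation_vecField (hu : u ∈ spaceV f c) : IsVariation c (vecField u) :=
  fun ν a _ hΦ => (isRegular_wickField hu ν a).admissible hΦ

/-- `s'` is the functional derivative of the scalar field `s` in the direction `v`. -/
def IsDerivS (v : Fin 4 → ι → Wick f c) (s s' : ι → QField ι) : Prop :=
  ∀ a, Set.EqOn (dirDeriv (vecField v) (s a)) (s' a) (configs ι c)

/-- `w` is the functional derivative of the vector field `u` in the direction `v`. -/
def IsDerivV (v u w : Fin 4 → ι → Wick f c) : Prop :=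
  ∀ ν a, Set.EqOn (dirDeriv (vecField v) (wickField (u ν a))) (wickField (w ν a)) (configs ι c)

namespace IsDerivS

variable {s s' t t' : ι → QField ι}

lemma zero : IsDerivS v 0 0 := fun a Φ _ => by rw [Pi.zero_apply, dirDeriv_zero]

lemma add (hv : v ∈ spaceV f c) (hs : s ∈ spaceS f c) (ht : t ∈ spaceS f c)
    (h : IsDerivS v s s') (h' : IsDerivS v t t') : IsDerivS v (s + t) (s' + t') := fun a Φ hΦ => by
  rw [Pi.add_apply, dirDeriv_add (isVariation_vecField hv) (isRegular_of_mem_spaceS hs a)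
    (isRegular_of_mem_spaceS ht a) hΦ, Pi.add_apply, h a hΦ, h' a hΦ, Pi.add_apply, Pi.add_apply]

lemma smul (hv : v ∈ spaceV f c) (hs : s ∈ spaceS f c) (h : IsDerivS v s s') (r : ℝ) :
    IsDerivS v (r • s) (r • s') := fun a Φ hΦ => by
  rw [Pi.smul_apply, dirDeriv_smul (isVariation_vecField hv) (isRegular_of_mem_spaceS hs a) r hΦ,
    Pi.smul_apply, h a hΦ, Pi.smul_apply, Pi.smul_apply]

lemma vecDs (hv : v ∈ spaceV f c) {σ σ' : spaceS f c} (h : IsDerivS v σ.1 σ'.1) :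
    IsDerivV v (vecDs σ) (vecDs σ') := fun ν a Φ hΦ => by
  rw [wickField_vecDs, wickField_vecDs, dirDeriv_fieldPd (isVariation_vecField hv)
    (isRegular_of_mem_spaceS σ.2 a) ν hΦ, fieldPd, fieldPd, h a hΦ]

lemma adVec (hv : v ∈ spaceV f c) {σ σ' : spaceS f c} (h : IsDerivS v σ.1 σ'.1)
    (hu : u ∈ spaceV f c) (huw : IsDerivV v u w) :
    IsDerivV v (adVec σ u) (adVec σ' u + adVec σ w) := fun ν a Φ hΦ => by
  rw [Pi.add_apply, Pi.add_apply, map_add, wickField_adVec, wickField_adVec, wickField_adVec,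
    dirDeriv_adField (isVariation_vecField hv) (isRegular_of_mem_spaceS σ.2)
      (isRegular_wickField hu ν) a hΦ, Pi.add_apply, Pi.add_apply]
  congr 1
  · exact adField_apply_congr (fun b => h b hΦ) (fun _ => rfl) a
  · exact adField_apply_congr (fun _ => rfl) (fun b => huw ν b hΦ) a

end IsDerivS

namespace IsDerivV

variable {u' w' : Fin 4 → ι → Wick f c}

lemma vecA : IsDerivV v vecA v := fun ν a Φ _ => by rw [wickField_vecA, dirDeriv_fieldA]

lemma zero : IsDerivV v 0 0 := fun ν a Φ _ => by
  rw [Pi.zero_apply, Pi.zero_apply, map_zero, dirDeriv_zero]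

lemma add (hv : v ∈ spaceV f c) (hu : u ∈ spaceV f c) (hw : w ∈ spaceV f c)
    (h : IsDerivV v u u') (h' : IsDerivV v w w') : IsDerivV v (u + w) (u' + w') :=
  fun ν a Φ hΦ => by
    simp only [Pi.add_apply, map_add]
    rw [dirDeriv_add (isVariation_vecField hv) (isRegular_wickField hu ν a)
      (isRegular_wickField hw ν a) hΦ, Pi.add_apply, h ν a hΦ, h' ν a hΦ]

lemma smul (hv : v ∈ spaceV f c) (hu : u ∈ spaceV f c) (h : IsDerivV v u u') (t : ℝ) :
    IsDerivV v (t • u) (t • u') := fun ν a Φ hΦ => by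
  simp only [Pi.smul_apply, map_smul]
  rw [dirDeriv_smul (isVariation_vecField hv) (isRegular_wickField hu ν a) t hΦ, Pi.smul_apply,
    h ν a hΦ]

lemma vecInt (hv : v ∈ spaceV f c) (hu : u ∈ spaceV f c) (huw : IsDerivV v u w) :
    IsDerivS v (vecInt c u) (vecInt c w) := fun a Φ hΦ => by
  rw [StringYM.vecInt, StringYM.vecInt, dirDeriv_sum (isVariation_vecField hv) _
    (fun ν _ => (isRegular_wickField hu ν a).fieldInt ν) hΦ, Finset.sum_apply, Finset.sum_apply]
  refine Finset.sum_congr rfl fun ν _ => ?_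
  rw [dirDeriv_fieldInt (isVariation_vecField hv) (isRegular_wickField hu ν a) ν hΦ, fieldInt,
    fieldInt, huw ν a hΦ]

end IsDerivV

lemma exists_isDerivS_vecInt (hv : v ∈ spaceV f c) (hu : u ∈ spaceV f c) (hw : w ∈ spaceV f c)
    (huw : IsDerivV v u w) : ∃ s ∈ spaceS f c, IsDerivS v (vecInt c u) s := by
  obtain ⟨s, hs, h⟩ := exists_spaceS_eqOn_vecInt hw
  exact ⟨s, hs, fun a => (huw.vecInt hv hu a).trans (h a).symm⟩

/-- The elements of `𝒮` whose functional derivative in the direction `v` belongs to `𝒮`. -/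
def derivableSubmodule (hv : v ∈ spaceV f c) : Submodule ℝ (ι → QField ι) where
  carrier := {s | s ∈ spaceS f c ∧ ∃ s' ∈ spaceS f c, IsDerivS v s s'}
  add_mem' := fun ⟨hs, s', hs', h⟩ ⟨ht, t', ht', h'⟩ =>
    ⟨add_mem hs ht, s' + t', add_mem hs' ht', h.add hv hs ht h'⟩
  zero_mem' := ⟨zero_mem _, 0, zero_mem _, .zero⟩
  smul_mem' r _ := fun ⟨hs, s', hs', h⟩ =>
    ⟨Submodule.smul_mem _ r hs, r • s', Submodule.smul_mem _ r hs', h.smul hv hs r⟩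

lemma exists_isDerivV_adList (hv : v ∈ spaceV f c) {l : List (ι → QField ι)}
    (hl : ∀ s ∈ l, s ∈ derivableSubmodule hv) {u₀ w₀ : Fin 4 → ι → Wick f c}
    (hu₀ : u₀ ∈ spaceV f c) (hw₀ : w₀ ∈ spaceV f c) (h₀ : IsDerivV v u₀ w₀) :
    ∃ u ∈ spaceV f c, (∃ w ∈ spaceV f c, IsDerivV v u w) ∧
      ∀ ν a, wickField (u ν a) = adList f l (fun b => wickField (u₀ ν b)) a := by
  induction l with
  | nil => exact ⟨u₀, hu₀, ⟨w₀, hw₀, h₀⟩, fun _ _ => rfl⟩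
  | cons s l ih =>
    rw [List.forall_mem_cons] at hl
    obtain ⟨⟨hs, s', hs', h⟩, hl⟩ := hl
    obtain ⟨u, hu, ⟨w, hw, huw⟩, hul⟩ := ih hl
    refine ⟨adVec ⟨s, hs⟩ u, adVec_mem _ hu, ⟨_, add_mem (adVec_mem ⟨s', hs'⟩ hu)
      (adVec_mem ⟨s, hs⟩ hw), IsDerivS.adVec hv (σ := ⟨s, hs⟩) h hu huw⟩, fun ν a => ?_⟩
    simp only [wickField_adVec, hul]
    rfl

lemma exists_isDerivS_sum_fieldInt_adList (hv : v ∈ spaceV f c) {l : List (ι → QField ι)}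
    (hl : ∀ s ∈ l, s ∈ derivableSubmodule hv) {u w : Fin 4 → ι → Wick f c}
    (hu : u ∈ spaceV f c) (hw : w ∈ spaceV f c) (huw : IsDerivV v u w) :
    ∃ s' ∈ spaceS f c,
      IsDerivS v (fun a => ∑ ν, fieldInt c ν (adList f l (fun b => wickField (u ν b)) a)) s' := by
  obtain ⟨u', hu', ⟨w', hw', huw'⟩, hul⟩ := exists_isDerivV_adList hv hl hu hw huw
  have hint : vecInt c u' =
      fun a => ∑ ν, fieldInt c ν (adList f l (fun b => wickField (u ν b)) a) :=
    funext fun a => by simp only [vecInt, hul]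
  exact hint ▸ exists_isDerivS_vecInt hv hu' hw' huw'

lemma spaceS_le_derivableSubmodule (hv : v ∈ spaceV f c) :
    spaceS f c ≤ derivableSubmodule hv := by
  refine sInf_le ⟨fun l hl => ⟨sum_fieldInt_adList_fieldA_mem fun s hs => (hl s hs).1, ?_⟩,
    fun l hne hl s₀ ⟨hs₀, s', hs', h⟩ =>
      ⟨sum_fieldInt_adList_fieldPd_mem hne (fun s hs => (hl s hs).1) hs₀, ?_⟩⟩
  · simpa only [wickField_vecA] using
      exists_isDerivS_sum_fieldInt_adList hv hl vecA_mem hv IsDerivV.vecA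
  · simpa only [wickField_vecDs] using
      exists_isDerivS_sum_fieldInt_adList hv hl (vecDs_mem ⟨s₀, hs₀⟩) (vecDs_mem ⟨s', hs'⟩)
        (IsDerivS.vecDs hv h)

lemma exists_isDerivS (hv : v ∈ spaceV f c) {s : ι → QField ι} (hs : s ∈ spaceS f c) :
    ∃ s' ∈ spaceS f c, IsDerivS v s s' :=
  (spaceS_le_derivableSubmodule hv hs).2

lemma exists_isDerivV (hv : v ∈ spaceV f c) (hu : u ∈ spaceV f c) :
    ∃ w ∈ spaceV f c, IsDerivV v u w := by
  induction hu using spaceV_induction with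
  | vecA => exact ⟨v, hv, .vecA⟩
  | vecDs σ =>
    obtain ⟨s', hs', h⟩ := exists_isDerivS hv σ.2
    exact ⟨vecDs ⟨s', hs'⟩, vecDs_mem _, IsDerivS.vecDs hv h⟩
  | adVec σ u hu ih =>
    obtain ⟨w, hw, h⟩ := ih
    obtain ⟨s', hs', h'⟩ := exists_isDerivS hv σ.2
    exact ⟨_, add_mem (adVec_mem ⟨s', hs'⟩ hu) (adVec_mem σ hw), IsDerivS.adVec hv h' hu h⟩
  | zero => exact ⟨0, zero_mem _, .zero⟩
  | add u w hu hw ihu ihw =>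
    obtain ⟨u', hu', h⟩ := ihu
    obtain ⟨w', hw', h'⟩ := ihw
    exact ⟨u' + w', add_mem hu' hw', h.add hv hu hw h'⟩
  | smul t u hu ih =>
    obtain ⟨u', hu', h⟩ := ih
    exact ⟨t • u', Submodule.smul_mem _ t hu', h.smul hv hu t⟩

variable {ι : Type*}

/-! ### Two-point obstructions -/

section TwoPoint

open MvPolynomial

/-- The propagator as a linear map in its first entry. -/
def propagatorLin (φ : Base ι) : LinField →ₗ[DiffPoly] DiffPoly where
  toFun χ := propagator χ φ
  map_add' χ χ' := by
    cases φ
    · simp only [propagator, Prod.fst_add, Prod.snd_add, Pi.add_apply]; ring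
    · simp only [propagator, Prod.fst_add, Pi.add_apply, add_mul, Finset.sum_add_distrib]
  map_smul' p χ := by
    cases φ
    · simp only [propagator, Prod.smul_fst, Prod.smul_snd, Pi.smul_apply, smul_eq_mul,
        RingHom.id_apply]; ring
    · simp only [propagator, Prod.smul_fst, Pi.smul_apply, smul_eq_mul, RingHom.id_apply,
        Finset.mul_sum, mul_assoc]

lemma propagatorLin_apply (φ : Base ι) (χ : LinField) : propagatorLin φ χ = propagator χ φ := rfl

lemma propagatorLin_real_smul (φ : Base ι) (r : ℝ) (χ : LinField) :
    propagatorLin φ (r • χ) = C r * propagatorLin φ χ := by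
  rw [← smul_eq_mul, ← map_smul]
  congr 1
  refine Prod.ext (funext fun ν => ?_) ?_ <;> simp [MvPolynomial.smul_eq_C_mul]

lemma propagatorLin_linPd (φ : Base ι) (μ : Fin 4) (χ : LinField) :
    propagatorLin φ (linPd μ χ) = X μ * propagatorLin φ χ := by
  rw [linPd, map_smul, smul_eq_mul]

lemma propagatorLin_linA_A (ν κ : Fin 4) (b : ι) :
    propagatorLin (.A κ b) (linA ν) = -C (metric ν κ) := by
  simp only [propagatorLin_apply, propagator, linA, metric, Pi.single_apply, zero_mul, sub_zero]
  by_cases h : κ = ν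
  · subst h; simp
  · simp [h, Ne.symm h]

lemma propagatorLin_linA_N (ν : Fin 4) (b : ι) : propagatorLin (.N b) (linA ν) = X ν := by
  simp [propagatorLin_apply, propagator, linA, Pi.single_apply]

lemma propagatorLin_linN_A (κ : Fin 4) (b : ι) : propagatorLin (.A κ b) linN = -X κ := by
  simp [propagatorLin_apply, propagator, linN]

lemma propagatorLin_linN_N (b : ι) : propagatorLin (.N b) linN = 0 := by
  simp [propagatorLin_apply, propagator, linN]

lemma sum_sgn_X_metric (κ : Fin 4) :
    ∑ μ, (C (sgn μ) * (X μ * C (metric μ κ)) : DiffPoly) = X κ := by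
  rw [Finset.sum_eq_single κ]
  · rw [mul_left_comm, ← C_mul]
    have hsq : sgn κ * metric κ κ = 1 := by simp only [metric, sgn]; split_ifs <;> norm_num
    rw [hsq, C_1, mul_one]
  · intro μ _ h
    simp [metric, h]
  · simp

lemma propagatorLin_linGauss_A (ν κ : Fin 4) (b : ι) :
    propagatorLin (.A κ b) (linGauss ν) = C (metric ν κ) * box := by
  have h : ∀ μ, propagatorLin (.A κ b) (sgn μ • linPd μ (linF μ ν)) =
      -(C (metric ν κ) * (C (sgn μ) * X μ ^ 2)) + X ν * (C (sgn μ) * (X μ * C (metric μ κ))) := by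
    intro μ
    rw [propagatorLin_real_smul, propagatorLin_linPd, linF, map_sub, propagatorLin_linPd,
      propagatorLin_linPd, propagatorLin_linA_A, propagatorLin_linA_A]
    ring
  rw [linGauss, map_sub, map_neg, map_sum, propagatorLin_linPd, propagatorLin_linN_A]
  simp only [h, Finset.sum_add_distrib, Finset.sum_neg_distrib, ← Finset.mul_sum,
    sum_sgn_X_metric]
  rw [box]
  ring

lemma propagatorLin_linGauss_N (ν : Fin 4) (b : ι) : propagatorLin (.N b) (linGauss ν) = 0 := by
  have h : ∀ μ, propagatorLin (.N b) (sgn μ • linPd μ (linF μ ν)) = 0 := by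
    intro μ
    rw [propagatorLin_real_smul, propagatorLin_linPd, linF, map_sub, propagatorLin_linPd,
      propagatorLin_linPd, propagatorLin_linA_N, propagatorLin_linA_N]
    ring
  rw [linGauss, map_sub, map_neg, map_sum, propagatorLin_linPd, propagatorLin_linN_N]
  simp [h]

lemma propagatorLin_linNull_A (κ : Fin 4) (b : ι) : propagatorLin (.A κ b) linNull = 0 := by
  have h : ∀ μ, propagatorLin (.A κ b) (sgn μ • linPd μ (linA μ)) =
      -(C (sgn μ) * (X μ * C (metric μ κ))) := by
    intro μ
    rw [propagatorLin_real_smul, propagatorLin_linPd, propagatorLin_linA_A]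
    ring
  rw [linNull, map_sub, map_sum, propagatorLin_linN_A]
  simp only [h, Finset.sum_neg_distrib, sum_sgn_X_metric]
  ring

lemma propagatorLin_linNull_N (b : ι) : propagatorLin (.N b) linNull = -box := by
  have h : ∀ μ, propagatorLin (.N b) (sgn μ • linPd μ (linA μ)) = C (sgn μ) * X μ ^ 2 := by
    intro μ
    rw [propagatorLin_real_smul, propagatorLin_linPd, propagatorLin_linA_N]
    ring
  rw [linNull, map_sub, map_sum, propagatorLin_linN_N]
  simp only [h, box, zero_sub]

lemma box_ne_zero : box ≠ 0 := by
  intro h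
  have := congrArg (MvPolynomial.eval (Pi.single 0 1 : Fin 4 → ℝ)) h
  simp [box, Fin.sum_univ_four, sgn] at this

lemma deltaCoeff_C_mul_box (k : ℝ) : deltaCoeff (C k * box) = C k := by
  have h : box ∣ C k * box := ⟨C k, mul_comm _ _⟩
  rw [deltaCoeff, dif_pos h]
  exact mul_left_cancel₀ box_ne_zero (h.choose_spec.symm.trans (mul_comm _ _))

lemma smear_C (k : ℝ) (Z : Spacetime → ℝ) : smear (C k) Z = k • Z := by
  classical
  ext x
  by_cases hk : k = 0
  · simp [smear, hk]
  · have : (C k : DiffPoly).support = {0} := by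
      rw [C_apply, support_monomial, if_neg hk]
    simp [smear, this, iterPd]

lemma obstruction_F_A (μ κ l ρ : Fin 4) (b : ι) :
    obstruction μ (linF κ l) (redF μ κ l) (.A ρ b) =
      C ((1 / 3) * (metric μ κ * metric l ρ - metric μ l * metric κ ρ)) * box := by
  rw [obstruction, ← propagatorLin_apply, ← propagatorLin_apply, redF, map_add,
    propagatorLin_linPd, propagatorLin_real_smul, map_sub, propagatorLin_real_smul,
    propagatorLin_real_smul, propagatorLin_linGauss_A, propagatorLin_linGauss_A, C_mul, C_sub,
    C_mul, C_mul]
  ring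

lemma obstruction_F_N (μ κ l : Fin 4) (b : ι) :
    obstruction μ (linF κ l) (redF μ κ l) (.N b) = C 0 * box := by
  rw [obstruction, ← propagatorLin_apply, ← propagatorLin_apply, redF, map_add,
    propagatorLin_linPd, propagatorLin_real_smul, map_sub, propagatorLin_real_smul,
    propagatorLin_real_smul, propagatorLin_linGauss_N, propagatorLin_linGauss_N, C_0]
  ring

lemma obstruction_A_A (μ ν ρ : Fin 4) (b : ι) :
    obstruction μ (linA ν) (redA μ ν) (.A ρ b) = C 0 * box := by
  rw [obstruction, ← propagatorLin_apply, ← propagatorLin_apply, redA, map_add,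
    propagatorLin_linPd, propagatorLin_real_smul, propagatorLin_linNull_A, C_0]
  ring

lemma obstruction_A_N (μ ν : Fin 4) (b : ι) :
    obstruction μ (linA ν) (redA μ ν) (.N b) = C (-(1 / 4 * metric μ ν)) * box := by
  rw [obstruction, ← propagatorLin_apply, ← propagatorLin_apply, redA, map_add,
    propagatorLin_linPd, propagatorLin_real_smul, propagatorLin_linNull_N, C_neg]
  ring

lemma obstruction_N (μ : Fin 4) (φ : Base ι) :
    obstruction μ linN (linPd μ linN) φ = C 0 * box := by
  rw [obstruction, ← propagatorLin_apply, ← propagatorLin_apply, propagatorLin_linPd, C_0]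
  ring

end TwoPoint

/-! ### The contraction of a Wick polynomial -/

section Contraction

variable {S : Submodule ℝ (ι → QField ι)}

/-- The coefficient of the `δ` function in the contraction of `F_{κλ}`. -/
def coeffF (μ κ l : Fin 4) : Base ι → ℝ
  | .A ρ _ => (1 / 3) * (metric μ κ * metric l ρ - metric μ l * metric κ ρ)
  | .N _ => 0

/-- The coefficient of the `δ` function in the contraction of `A_ν`. -/
def coeffA (μ ν : Fin 4) : Base ι → ℝ
  | .A _ _ => 0
  | .N _ => -(1 / 4 * metric μ ν)

open Classical in
/-- The contraction of a generator as a linear map in the smearing function. -/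
def contractLin (τ : Renormalization ι S) (μ : Fin 4) (φ : Base ι) (Φ : Conf ι) :
    Letter ι S → (Spacetime → ℝ) →ₗ[ℝ] (Spacetime → ℝ)
  | .F κ l a => if a = φ.colour then coeffF μ κ l φ • LinearMap.id else 0
  | .A ν a => if a = φ.colour then coeffA μ ν φ • LinearMap.id else 0
  | .N _ => 0
  | .s _ _ => 0
  | .ds ν σ a => τ.val σ μ ν a φ Φ

lemma contract_eq (τ : Renormalization ι S) (μ : Fin 4) (φ : Base ι) (Φ : Conf ι)
    (Z : Spacetime → ℝ) (χ : Letter ι S) : contract τ μ φ Φ Z χ = contractLin τ μ φ Φ χ Z := by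
  cases χ with
  | F κ l a =>
    cases φ <;> simp only [contract, contractLin, coeffF, obstruction_F_A, obstruction_F_N,
      deltaCoeff_C_mul_box, smear_C] <;> split_ifs <;> rfl
  | A ν a =>
    cases φ <;> simp only [contract, contractLin, coeffA, obstruction_A_A, obstruction_A_N,
      deltaCoeff_C_mul_box, smear_C] <;> split_ifs <;> rfl
  | N a =>
    simp only [contract, contractLin, obstruction_N, deltaCoeff_C_mul_box, smear_C, zero_smul,
      ite_self]
    rfl
  | s σ a => rfl
  | ds ν σ a => rfl

lemma fieldF_antisymm (μ ν : Fin 4) (a : ι) : fieldF μ ν a = -fieldF ν μ a := by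
  simp [fieldF]

lemma sum_coeffF (ρ : Fin 4) (b : ι) (Y : Fin 4 → Spacetime → ℝ) :
    ∑ μ, ∑ ν, (sgn μ * sgn ν) • coeffF μ μ ν (.A ρ b) • Y ν = Y ρ := by
  ext x
  simp only [Finset.sum_apply, Pi.smul_apply, smul_eq_mul, coeffF]
  fin_cases ρ <;> simp [Fin.sum_univ_four, sgn, metric] <;> ring

variable [Fintype ι] {f : ι → ι → ι → ℝ} {c : StringFunction}

/-- The universal derivation of Wick polynomials. -/
def wickD : Derivation ℝ (Wick f c) (Letter ι (spaceS f c) →₀ Wick f c) :=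
  MvPolynomial.mkDerivation ℝ fun χ => Finsupp.single χ 1

lemma wickD_apply (p : Wick f c) (χ : Letter ι (spaceS f c)) :
    wickD p χ = MvPolynomial.pderiv χ p := by
  classical
  have h : (Finsupp.lapply χ : _ →ₗ[Wick f c] Wick f c).compDer wickD =
      MvPolynomial.pderiv χ := by
    refine MvPolynomial.derivation_ext fun χ' => ?_
    simp [wickD, MvPolynomial.mkDerivation_X, MvPolynomial.pderiv_X, Finsupp.single_apply,
      Pi.single_apply, eq_comm]
  exact congrArg (fun D : Derivation ℝ (Wick f c) (Wick f c) => D p) h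

lemma support_wickD_subset (p : Wick f c) : (wickD p).support ⊆ p.vars := by
  intro χ hχ
  by_contra h
  rw [Finsupp.mem_support_iff, wickD_apply] at hχ
  exact hχ (MvPolynomial.pderiv_eq_zero_of_notMem_vars h)

/-- The sum of the contractions of the generators, with a spectator `Z`. -/
def contraction (Φ : Conf ι)
    (k : Letter ι (spaceS f c) → (Spacetime → ℝ) →ₗ[ℝ] (Spacetime → ℝ)) (Z : Spacetime → ℝ) :
    (Letter ι (spaceS f c) →₀ Wick f c) →ₗ[ℝ] (Spacetime → ℝ) :=
  Finsupp.lsum ℝ fun χ => k χ ∘ₗ LinearMap.mulLeft ℝ Z ∘ₗ LinearMap.proj Φ ∘ₗ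
    (wickField (f := f) (c := c)).toLinearMap

variable {Φ : Conf ι} {k : Letter ι (spaceS f c) → (Spacetime → ℝ) →ₗ[ℝ] (Spacetime → ℝ)}

lemma contraction_single (Z : Spacetime → ℝ) (χ : Letter ι (spaceS f c)) (p : Wick f c) :
    contraction Φ k Z (Finsupp.single χ p) = k χ (Z * wickField p Φ) := by
  simp [contraction]

lemma contraction_smul (Z : Spacetime → ℝ) (p : Wick f c)
    (w : Letter ι (spaceS f c) →₀ Wick f c) :
    contraction Φ k Z (p • w) = contraction Φ k (Z * wickField p Φ) w := by
  induction w using Finsupp.induction_linear with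
  | zero => simp
  | add w w' h h' => rw [smul_add, map_add, map_add, h, h']
  | single χ q =>
    rw [Finsupp.smul_single, contraction_single, contraction_single, smul_eq_mul,
      map_mul wickField, Pi.mul_apply, mul_assoc]

lemma contraction_add_left (Z Z' : Spacetime → ℝ) (w : Letter ι (spaceS f c) →₀ Wick f c) :
    contraction Φ k (Z + Z') w = contraction Φ k Z w + contraction Φ k Z' w := by
  induction w using Finsupp.induction_linear with
  | zero => simp
  | add w w' h h' => rw [map_add, map_add, map_add, h, h']; abel
  | single χ q => simp only [contraction_single, add_mul, map_add]

lemma contraction_smul_left (r : ℝ) (Z : Spacetime → ℝ)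
    (w : Letter ι (spaceS f c) →₀ Wick f c) :
    contraction Φ k (r • Z) w = r • contraction Φ k Z w := by
  induction w using Finsupp.induction_linear with
  | zero => simp
  | add w w' h h' => rw [map_add, map_add, h, h', smul_add]
  | single χ q => simp only [contraction_single, smul_mul_assoc, map_smul]

lemma contraction_sum_left {κ : Type*} (s : Finset κ) (Z : κ → Spacetime → ℝ)
    (w : Letter ι (spaceS f c) →₀ Wick f c) :
    contraction Φ k (∑ i ∈ s, Z i) w = ∑ i ∈ s, contraction Φ k (Z i) w := by
  classical
  induction s using Finset.induction_on with
  | empty => simpa using contraction_smul_left (Φ := Φ) (k := k) 0 0 w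
  | insert i s hi ih => rw [Finset.sum_insert hi, Finset.sum_insert hi, contraction_add_left, ih]

lemma contraction_wickD_X (Z : Spacetime → ℝ) (χ : Letter ι (spaceS f c)) :
    contraction Φ k Z (wickD (MvPolynomial.X χ)) = k χ Z := by
  have h : wickField (1 : Wick f c) Φ = 1 := by rw [map_one]; rfl
  rw [wickD, MvPolynomial.mkDerivation_X, contraction_single, h, mul_one]

lemma contraction_wickD_mul (Z : Spacetime → ℝ) (p q : Wick f c) :
    contraction Φ k Z (wickD (p * q)) =
      contraction Φ k (Z * wickField p Φ) (wickD q) +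
        contraction Φ k (Z * wickField q Φ) (wickD p) := by
  rw [Derivation.leibniz, map_add, contraction_smul, contraction_smul]

lemma contraction_wickD_smul (Z : Spacetime → ℝ) (r : ℝ) (p : Wick f c) :
    contraction Φ k Z (wickD (r • p)) = r • contraction Φ k Z (wickD p) := by
  rw [← map_smul]
  exact congrArg _ (map_smul (wickD (f := f) (c := c)).toLinearMap r p)

lemma variation_eq_contraction (τ : Renormalization ι (spaceS f c)) (U : Fin 4 → Wick f c)
    (φ : Base ι) (Φ : Conf ι) :
    variation τ U φ Φ = ∑ μ, contraction Φ (contractLin τ μ φ Φ) 1 (wickD (U μ)) := by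
  refine Finset.sum_congr rfl fun μ _ => ?_
  rw [contraction, Finsupp.lsum_apply, Finsupp.sum_of_support_subset _ (support_wickD_subset _) _
    (fun _ _ => map_zero _)]
  refine Finset.sum_congr rfl fun χ _ => ?_
  rw [contract_eq, wickD_apply]
  simp

lemma sum_contraction_vecA (τ : Renormalization ι (spaceS f c)) (φ : Base ι) (Φ : Conf ι)
    {Z : Fin 4 → Fin 4 → ι → Spacetime → ℝ} (hZ : ∀ μ ν a, Z μ ν a = -Z ν μ a) :
    ∑ μ, ∑ ν, ∑ a, contraction Φ (contractLin τ μ φ Φ) (Z μ ν a)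
      (wickD (vecA ν a : Wick f c)) = 0 := by
  refine Finset.sum_eq_zero fun μ _ => Finset.sum_eq_zero fun ν _ =>
    Finset.sum_eq_zero fun a _ => ?_
  have hcoeff : coeffA μ ν φ • Z μ ν a = 0 := by
    cases φ with
    | A => exact zero_smul _ _
    | N =>
      rcases eq_or_ne μ ν with rfl | hμν
      · rw [self_eq_neg.1 (hZ μ μ a), smul_zero]
      · simp only [coeffA, metric, if_neg hμν, mul_zero, neg_zero, zero_smul]
  rw [vecA, contraction_wickD_X, contractLin]
  split_ifs
  · exact hcoeff
  · rfl

lemma sum_contraction_vecDs (τ : Renormalization ι (spaceS f c)) (φ : Base ι) (Φ : Conf ι)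
    {Z : Fin 4 → Fin 4 → ι → Spacetime → ℝ} (hZ : ∀ μ ν a, Z μ ν a = -Z ν μ a)
    (σ : spaceS f c) :
    ∑ μ, ∑ ν, ∑ a, contraction Φ (contractLin τ μ φ Φ) (Z μ ν a) (wickD (vecDs σ ν a)) = 0 := by
  simp only [vecDs, contraction_wickD_X, contractLin]
  refine self_eq_neg.1 ?_
  conv_lhs => rw [Finset.sum_comm]
  simp only [← Finset.sum_neg_distrib]
  refine Finset.sum_congr rfl fun μ _ => Finset.sum_congr rfl fun ν _ =>
    Finset.sum_congr rfl fun a _ => ?_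
  rw [τ.symm, hZ ν μ a, map_neg]

lemma contraction_wickD_adVec (τ : Renormalization ι (spaceS f c)) (μ : Fin 4) (φ : Base ι)
    (Φ : Conf ι) (Z : Spacetime → ℝ) (σ : spaceS f c) (u : Fin 4 → ι → Wick f c) (ν : Fin 4)
    (k : ι) :
    contraction Φ (contractLin τ μ φ Φ) Z (wickD (adVec σ u ν k)) =
      ∑ b, ∑ a, f a b k • contraction Φ (contractLin τ μ φ Φ) (Z * σ.1 a Φ)
        (wickD (u ν b)) := by
  have hinert : ∀ Z' a, contraction Φ (contractLin τ μ φ Φ) Z' (wickD (sLetter σ a)) = 0 :=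
    fun Z' a => by rw [sLetter, contraction_wickD_X]; rfl
  rw [Finset.sum_comm]
  simp only [adVec, adField, map_sum, contraction_wickD_smul, contraction_wickD_mul, hinert,
    add_zero, wickField_sLetter]

-- Contracting `A_ν` gives a multiple of `η_{μν}` and contracting `∂_ν s` is symmetric in `μ, ν`,
-- so both vanish against an antisymmetric tensor, whatever the renormalization.
lemma sum_contraction_eq_zero (τ : Renormalization ι (spaceS f c)) (φ : Base ι) (Φ : Conf ι)
    {u : Fin 4 → ι → Wick f c} (hu : u ∈ spaceV f c) {Z : Fin 4 → Fin 4 → ι → Spacetime → ℝ}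
    (hZ : ∀ μ ν a, Z μ ν a = -Z ν μ a) :
    ∑ μ, ∑ ν, ∑ a, contraction Φ (contractLin τ μ φ Φ) (Z μ ν a) (wickD (u ν a)) = 0 := by
  induction hu using spaceV_induction generalizing Z with
  | vecA => exact sum_contraction_vecA τ φ Φ hZ
  | vecDs σ => exact sum_contraction_vecDs τ φ Φ hZ σ
  | adVec σ u _ ih =>
    have hanti : ∀ μ ν b, ∑ k, ∑ a, f a b k • (Z μ ν k * σ.1 a Φ) =
        -∑ k, ∑ a, f a b k • (Z ν μ k * σ.1 a Φ) := fun μ ν b => by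
      simp only [hZ μ ν, neg_mul, smul_neg, Finset.sum_neg_distrib]
    rw [← ih hanti]
    refine Finset.sum_congr rfl fun μ _ => Finset.sum_congr rfl fun ν _ => ?_
    simp only [contraction_wickD_adVec, contraction_sum_left, contraction_smul_left]
    rw [Finset.sum_comm]
  | zero => simp
  | add u w _ _ hu hw =>
    simp only [Pi.add_apply, map_add, Finset.sum_add_distrib, hu hZ, hw hZ, add_zero]
  | smul t u _ hu =>
    simp only [Pi.smul_apply, contraction_wickD_smul, ← Finset.smul_sum, hu hZ, smul_zero]

lemma wickField_X_F (μ ν : Fin 4) (a : ι) :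
    wickField (MvPolynomial.X (Letter.F μ ν a) : Wick f c) = fieldF μ ν a := by
  rw [wickField, MvPolynomial.aeval_X, Letter.toField]

lemma sum_contractLin_F (τ : Renormalization ι (spaceS f c)) (μ ν : Fin 4) (φ : Base ι)
    (Φ : Conf ι) (Y : ι → Spacetime → ℝ) :
    ∑ a, contractLin τ μ φ Φ (.F μ ν a) (Y a) = coeffF μ μ ν φ • Y φ.colour := by
  simp only [contractLin]
  rw [Finset.sum_eq_single_of_mem φ.colour (Finset.mem_univ _) fun a _ ha => by
    rw [if_neg ha, LinearMap.zero_apply], if_pos rfl]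
  rfl

section Mediator

variable (τ : Renormalization ι (spaceS f c)) {α : ℕ → Fin 4 → ι → Wick f c} {n : ℕ}

lemma variation_mediator (hα : α n ∈ spaceV f c) (φ : Base ι) (Φ : Conf ι) :
    variation τ (mediator α n) φ Φ =
      ∑ μ, ∑ ν, (sgn μ * sgn ν) • coeffF μ μ ν φ • wickField (α n ν φ.colour) Φ := by
  have hF : ∑ μ, ∑ ν, ∑ a, contraction Φ (contractLin τ μ φ Φ)
      ((sgn μ * sgn ν) • fieldF μ ν a Φ) (wickD (α n ν a)) = 0 :=
    sum_contraction_eq_zero τ φ Φ hα fun μ ν a => by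
      rw [fieldF_antisymm μ ν a, mul_comm (sgn ν), Pi.neg_apply, smul_neg]
  rw [variation_eq_contraction, ← add_zero (∑ μ, ∑ ν, _), ← hF, ← Finset.sum_add_distrib]
  refine Finset.sum_congr rfl fun μ _ => ?_
  rw [← Finset.sum_add_distrib]
  simp only [mediator, map_sum, contraction_wickD_smul]
  refine Finset.sum_congr rfl fun ν _ => ?_
  simp only [contraction_wickD_mul, contraction_wickD_X, one_mul, wickField_X_F, smul_add,
    Finset.sum_add_distrib, contraction_smul_left]
  rw [add_comm, ← Finset.smul_sum, sum_contractLin_F]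

lemma variation_mediator_A (hα : α n ∈ spaceV f c) (ρ : Fin 4) (b : ι) :
    variation τ (mediator α n) (.A ρ b) = wickField (α n ρ b) := by
  ext1 Φ
  rw [variation_mediator τ hα]
  exact sum_coeffF ρ b fun ν => wickField (α n ν b) Φ

lemma variation_mediator_N (hα : α n ∈ spaceV f c) (b : ι) :
    variation τ (mediator α n) (.N b) = 0 := by
  ext1 Φ
  rw [variation_mediator τ hα]
  simp only [coeffF, zero_smul, smul_zero, Finset.sum_const_zero, Pi.zero_apply]

lemma omega_mediator (hα : α n ∈ spaceV f c) (X : QField ι) :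
    omega τ (mediator α n) X = dirDeriv (vecField (α n)) X := by
  ext Φ x
  simp only [omega, dirDeriv, variation_mediator_A τ hα, variation_mediator_N τ hα]
  rfl

end Mediator

end Contraction

/-! ### Exponentials of power series -/

section Truncation

open Finset PowerSeries

variable {R : Type*} [Semiring R]

/-- Agreement of power series up to and including the order `n`. -/
def EqUpTo (n : ℕ) (y z : R⟦X⟧) : Prop := ∀ m ≤ n, coeff m y = coeff m z

lemma EqUpTo.refl (n : ℕ) (y : R⟦X⟧) : EqUpTo n y y := fun _ _ => rfl

lemma EqUpTo.mul {n : ℕ} {y y' z z' : R⟦X⟧} (hy : EqUpTo n y y') (hz : EqUpTo n z z') :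
    EqUpTo n (y * z) (y' * z') := by
  intro m hm
  rw [coeff_mul, coeff_mul]
  refine sum_congr rfl fun p hp => ?_
  have hp' := mem_antidiagonal.1 hp
  rw [hy p.1 (by omega), hz p.2 (by omega)]

lemma EqUpTo.mul_succ {n : ℕ} {y y' z z' : R⟦X⟧} (hy₀ : constantCoeff y = 0)
    (hz₀ : constantCoeff z = 0) (hy : EqUpTo n y y') (hz : EqUpTo n z z') :
    EqUpTo (n + 1) (y * z) (y' * z') := by
  rw [← coeff_zero_eq_constantCoeff_apply] at hy₀ hz₀
  have hy₀' : coeff 0 y' = 0 := (hy 0 n.zero_le).symm.trans hy₀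
  have hz₀' : coeff 0 z' = 0 := (hz 0 n.zero_le).symm.trans hz₀
  intro m hm
  rw [coeff_mul, coeff_mul]
  refine sum_congr rfl fun ⟨i, j⟩ hp => ?_
  have hij : i + j = m := mem_antidiagonal.1 hp
  rcases Nat.eq_zero_or_pos i with rfl | hi
  · rw [hy₀, hy₀', zero_mul, zero_mul]
  rcases Nat.eq_zero_or_pos j with rfl | hj
  · rw [hz₀, hz₀', mul_zero, mul_zero]
  rw [hy i (by omega), hz j (by omega)]

lemma le_order_mul_of_le {k l : ℕ} {y z : R⟦X⟧} (hy : k ≤ order y) (hz : l ≤ order z) :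
    ((k + l : ℕ) : ℕ∞) ≤ order (y * z) := by
  rw [Nat.cast_add]
  exact (add_le_add hy hz).trans (le_order_mul y z)

lemma coeff_sum_range_eq {b : ℕ → R⟦X⟧} (hb : ∀ k : ℕ, k ≤ order (b k)) {m n : ℕ} (h : m ≤ n) :
    ∑ k ∈ range (m + 1), coeff m (b k) = ∑ k ∈ range (n + 1), coeff m (b k) := by
  refine sum_subset (range_subset_range.2 (by omega)) fun k _ hk => ?_
  rw [mem_range, not_lt] at hk
  exact coeff_of_lt_order m ((Nat.cast_lt.2 hk).trans_le (hb k))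

end Truncation

section Exp

open Finset PowerSeries

variable {R : Type*} [Ring R] [Algebra ℝ R]

/-- The divided power `Y^k / k!`. -/
def divPow (Y : R) (k : ℕ) : R := ((k.factorial : ℝ)⁻¹) • Y ^ k

lemma succ_smul_divPow (Y : R) (k : ℕ) :
    ((k : ℝ) + 1) • divPow Y (k + 1) = Y * divPow Y k := by
  rw [divPow, divPow, smul_smul, mul_smul_comm, ← pow_succ', Nat.factorial_succ, Nat.cast_mul,
    mul_inv, ← mul_assoc, Nat.cast_succ, mul_inv_cancel₀ (by positivity), one_mul]

lemma mul_divPow_comm (Y : R) (k : ℕ) : Y * divPow Y k = divPow Y k * Y := by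
  rw [divPow, mul_smul_comm, smul_mul_assoc, ← pow_succ', ← pow_succ]

lemma eq_inv_factorial_succ_smul {M : Type*} [AddCommGroup M] [Module ℝ M] {y z : M} {n : ℕ}
    (h : ((n : ℝ) + 1) • y = ((n.factorial : ℝ)⁻¹) • z) :
    y = (((n + 1).factorial : ℝ)⁻¹) • z := by
  have hn : (n : ℝ) + 1 ≠ 0 := by positivity
  rw [← smul_right_inj hn, h, smul_smul, Nat.factorial_succ, Nat.cast_mul, mul_inv, ← mul_assoc,
    Nat.cast_succ, mul_inv_cancel₀ hn, one_mul]

lemma succ_smul_sum_antidiagonal (g : ℕ → ℕ → R) (n : ℕ) :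
    ((n : ℝ) + 1) • ∑ p ∈ antidiagonal (n + 1), g p.1 p.2 =
      ∑ p ∈ antidiagonal n, ((p.1 : ℝ) + 1) • g (p.1 + 1) p.2 +
        ∑ p ∈ antidiagonal n, ((p.2 : ℝ) + 1) • g p.1 (p.2 + 1) := by
  have hsplit : ((n : ℝ) + 1) • ∑ p ∈ antidiagonal (n + 1), g p.1 p.2 =
      ∑ p ∈ antidiagonal (n + 1), (p.1 : ℝ) • g p.1 p.2 +
        ∑ p ∈ antidiagonal (n + 1), (p.2 : ℝ) • g p.1 p.2 := by
    rw [smul_sum, ← sum_add_distrib]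
    refine sum_congr rfl fun p hp => ?_
    rw [← add_smul, ← Nat.cast_add, mem_antidiagonal.1 hp, Nat.cast_succ]
  rw [hsplit, Finset.Nat.sum_antidiagonal_succ (f := fun p => (p.1 : ℝ) • g p.1 p.2),
    Finset.Nat.sum_antidiagonal_succ' (f := fun p => (p.2 : ℝ) • g p.1 p.2)]
  simp only [Nat.cast_zero, zero_smul, zero_add, Nat.cast_add, Nat.cast_one]

lemma sum_divPow_conj (Y Z : R) (n : ℕ) :
    ∑ p ∈ antidiagonal n, divPow Y p.1 * Z * divPow (-Y) p.2 =
      ((n.factorial : ℝ)⁻¹) • (⁅Y, ·⁆)^[n] Z := by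
  induction n generalizing Z with
  | zero => simp [divPow]
  | succ n ih =>
    refine eq_inv_factorial_succ_smul ?_
    rw [Function.iterate_succ_apply, ← ih,
      succ_smul_sum_antidiagonal (fun i j => divPow Y i * Z * divPow (-Y) j), ← sum_add_distrib]
    refine sum_congr rfl fun p _ => ?_
    rw [← smul_mul_assoc, ← smul_mul_assoc, succ_smul_divPow, ← mul_smul_comm, succ_smul_divPow,
      mul_divPow_comm, Ring.lie_def]
    noncomm_ring

-- The recursion for `D` is satisfied by the derivatives `(e^{-Y})' = ∑ D_j` of the divided powers.
lemma sum_divPow_deriv (Y Y' : R) (D : ℕ → R)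
    (hD : ∀ j : ℕ, ((j : ℝ) + 1) • D (j + 1) = -(Y' * divPow (-Y) j + Y * D j)) (n : ℕ) :
    ∑ p ∈ antidiagonal (n + 1), divPow Y p.1 * D p.2 =
      ((n + 1).factorial : ℝ)⁻¹ • -(⁅Y, ·⁆)^[n] Y' := by
  refine eq_inv_factorial_succ_smul ?_
  rw [smul_neg, ← sum_divPow_conj, succ_smul_sum_antidiagonal (fun i j => divPow Y i * D j),
    ← sum_add_distrib, ← sum_neg_distrib]
  refine sum_congr rfl fun p _ => ?_
  rw [← smul_mul_assoc, succ_smul_divPow, ← mul_smul_comm, hD, mul_divPow_comm]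
  noncomm_ring

lemma sum_range_range_eq_antidiagonal {M : Type*} [AddCommMonoid M] (g : ℕ → ℕ → M) (n : ℕ)
    (hg : ∀ i j, n < i + j → g i j = 0) :
    ∑ i ∈ range (n + 1), ∑ j ∈ range (n + 1), g i j =
      ∑ m ∈ range (n + 1), ∑ p ∈ antidiagonal m, g p.1 p.2 := by
  simp only [Finset.Nat.sum_antidiagonal_eq_sum_range_succ g, Finset.sum_range_diag_flip]
  refine sum_congr rfl fun i hi => ?_
  refine (sum_subset (range_subset_range.2 (by omega)) fun j _ hj => hg i j ?_).symm
  simp only [mem_range, not_lt] at hj hi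
  omega

variable {y : R⟦X⟧}

lemma le_order_divPow (hy : constantCoeff y = 0) (k : ℕ) : k ≤ order (divPow y k) :=
  nat_le_order _ _ fun m hm => by
    rw [divPow, coeff_smul, coeff_of_lt_order m
      ((Nat.cast_lt.2 hm).trans_le (le_order_pow_of_constantCoeff_eq_zero k hy)), smul_zero]

lemma expSeries_eqUpTo (hy : constantCoeff y = 0) (n : ℕ) :
    EqUpTo n (expSeries y) (∑ k ∈ range (n + 1), divPow y k) := by
  intro m hm
  rw [expSeries, coeff_mk, map_sum, ← coeff_sum_range_eq (le_order_divPow hy) hm]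
  rfl

lemma coeff_conj_expSeries (hy : constantCoeff y = 0) (z : R⟦X⟧) (n : ℕ) :
    coeff n (expSeries y * z * expSeries (-y)) =
      ∑ m ∈ range (n + 1), ((m.factorial : ℝ)⁻¹) • coeff n ((⁅y, ·⁆)^[m] z) := by
  have hy' : constantCoeff (-y) = 0 := by rw [map_neg, hy, neg_zero]
  rw [((expSeries_eqUpTo hy n).mul (.refl n z)).mul (expSeries_eqUpTo hy' n) n le_rfl, sum_mul,
    sum_mul, map_sum]
  simp only [mul_sum, map_sum]
  rw [sum_range_range_eq_antidiagonal (fun i j => coeff n (divPow y i * z * divPow (-y) j))]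
  · refine sum_congr rfl fun m _ => ?_
    rw [← map_sum, sum_divPow_conj, coeff_smul]
  · intro i j hij
    have hi : i ≤ order (divPow y i * z) := by
      simpa using le_order_mul_of_le (le_order_divPow hy i) (l := 0) (z := z) (by simp)
    exact coeff_of_lt_order n ((Nat.cast_lt.2 hij).trans_le
      (le_order_mul_of_le hi (le_order_divPow hy' j)))

lemma coeff_expSeries_mul_deriv {y' e : R⟦X⟧} (hy : constantCoeff y = 0) {D : ℕ → R⟦X⟧}
    (hD₀ : D 0 = 0) (hD : ∀ j : ℕ, ((j : ℝ) + 1) • D (j + 1) = -(y' * divPow (-y) j + y * D j))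
    (hDo : ∀ j : ℕ, j ≤ order (D j)) (he : ∀ n, EqUpTo n e (∑ j ∈ range (n + 1), D j)) (n : ℕ) :
    coeff n (expSeries y * e) =
      -∑ m ∈ range n, (((m + 1).factorial : ℝ)⁻¹) • coeff n ((⁅y, ·⁆)^[m] y') := by
  rw [(expSeries_eqUpTo hy n).mul (he n) n le_rfl, sum_mul, map_sum]
  simp only [mul_sum, map_sum]
  rw [sum_range_range_eq_antidiagonal (fun i j => coeff n (divPow y i * D j)), sum_range_succ']
  · rw [← sum_neg_distrib]
    simp only [Finset.Nat.antidiagonal_zero, sum_singleton, hD₀, mul_zero, map_zero, add_zero]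
    refine sum_congr rfl fun m _ => ?_
    rw [← map_sum, sum_divPow_deriv y y' D hD, coeff_smul, map_neg, smul_neg]
  · intro i j hij
    exact coeff_of_lt_order n ((Nat.cast_lt.2 hij).trans_le
      (le_order_mul_of_le (le_order_divPow hy i) (hDo j)))

lemma expSeries_mul_neg (hy : constantCoeff y = 0) : expSeries y * expSeries (-y) = 1 := by
  have hcomm : ∀ m, (⁅y, ·⁆)^[m + 1] (1 : R⟦X⟧) = 0 := fun m => by
    rw [Function.iterate_succ_apply, Ring.lie_def, mul_one, one_mul, sub_self]
    exact Function.iterate_fixed (by rw [Ring.lie_def, mul_zero, zero_mul, sub_zero]) m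
  ext n
  have hconj := coeff_conj_expSeries hy 1 n
  rw [mul_one] at hconj
  simp only [hconj, sum_range_succ', hcomm, map_zero, smul_zero, sum_const_zero, zero_add,
    Nat.factorial_zero, Nat.cast_one, inv_one, one_smul, Function.iterate_zero, id_eq]

lemma map_expSeries {R' : Type*} [Ring R'] [Algebra ℝ R'] (φ : R →ₐ[ℝ] R') (y : R⟦X⟧) :
    PowerSeries.map (φ : R →+* R') (expSeries y) =
      expSeries (PowerSeries.map (φ : R →+* R') y) := by
  ext n
  simp only [expSeries, coeff_map, coeff_mk, ← map_pow, RingHom.coe_coe, map_sum, map_smul]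

end Exp

open PowerSeries

/-! ### Matrix-valued functions -/

/-- Matrices of complex functions on spacetime. A matrix of fields is evaluated at a configuration
to obtain one. -/
abbrev MatFn (d : ℕ) := Matrix (Fin d) (Fin d) (Spacetime → ℂ)

section Matrices

variable {d : ℕ} {R : Type*} [Semiring R] [Module R ℂ] [SMulCommClass ℝ R ℂ]
  [ContinuousConstSMul R ℂ]

/-- The entrywise derivative of a series of matrix-valued functions. -/
def pdSeries (μ : Fin 4) (Z : (MatFn d)⟦X⟧) : (MatFn d)⟦X⟧ :=
  PowerSeries.mk fun n => (coeff n Z).map (pd μ)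

lemma coeff_pdSeries_apply (μ : Fin 4) (Z : (MatFn d)⟦X⟧) (n : ℕ) (i j : Fin d) :
    coeff n (pdSeries μ Z) i j = pd μ (coeff n Z i j) := by
  rw [pdSeries, coeff_mk, Matrix.map_apply]

lemma coeff_mul_apply_eq_sum (Y Z : (MatFn d)⟦X⟧) (n : ℕ) (i j : Fin d) :
    coeff n (Y * Z) i j =
      ∑ p ∈ Finset.HasAntidiagonal.antidiagonal n, ∑ k, coeff p.1 Y i k * coeff p.2 Z k j := by
  rw [coeff_mul, Matrix.sum_apply]
  rfl

/-- Series of matrix-valued functions with differentiable entries. -/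
def DiffEntries (Z : (MatFn d)⟦X⟧) : Prop := ∀ n i j, Differentiable ℝ (coeff n Z i j)

namespace DiffEntries

variable {Y Z : (MatFn d)⟦X⟧}

lemma smul (hZ : DiffEntries Z) (r : R) : DiffEntries (r • Z) := fun n i j => by
  rw [coeff_smul]
  exact (hZ n i j).const_smul r

lemma neg (hZ : DiffEntries Z) : DiffEntries (-Z) := fun n i j => by
  rw [map_neg]
  exact (hZ n i j).neg

lemma mul (hY : DiffEntries Y) (hZ : DiffEntries Z) : DiffEntries (Y * Z) := fun n i j => by
  rw [coeff_mul_apply_eq_sum]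
  exact Differentiable.sum fun p _ => Differentiable.sum fun k _ => (hY _ _ _).mul (hZ _ _ _)

lemma one : DiffEntries (1 : (MatFn d)⟦X⟧) := fun n i j => by
  rw [coeff_one]
  split_ifs
  · rw [Matrix.one_apply]
    split_ifs
    exacts [differentiable_const 1, differentiable_const 0]
  · exact differentiable_const 0

lemma divPow (hY : DiffEntries Y) (k : ℕ) : DiffEntries (divPow Y k) := by
  refine DiffEntries.smul ?_ _
  induction k with
  | zero => exact one
  | succ k ih => rw [pow_succ]; exact ih.mul hY

end DiffEntries

variable {Y Z : (MatFn d)⟦X⟧}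

lemma pdSeries_mul (hY : DiffEntries Y) (hZ : DiffEntries Z) (μ : Fin 4) :
    pdSeries μ (Y * Z) = pdSeries μ Y * Z + Y * pdSeries μ Z := by
  ext1 n
  ext1 i j
  rw [map_add, Matrix.add_apply, coeff_pdSeries_apply, coeff_mul_apply_eq_sum,
    coeff_mul_apply_eq_sum, coeff_mul_apply_eq_sum, ← Finset.sum_add_distrib,
    pd_sum _ fun p _ => Differentiable.sum fun k _ => (hY _ _ _).mul (hZ _ _ _)]
  refine Finset.sum_congr rfl fun p _ => ?_
  rw [pd_sum _ fun k _ => (hY _ _ _).mul (hZ _ _ _), ← Finset.sum_add_distrib]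
  simp only [coeff_pdSeries_apply, pd_mul (hY _ _ _) (hZ _ _ _)]

lemma pdSeries_smul (hZ : DiffEntries Z) (r : R) (μ : Fin 4) :
    pdSeries μ (r • Z) = r • pdSeries μ Z := by
  ext1 n
  ext1 i j
  simp only [coeff_smul, Matrix.smul_apply, coeff_pdSeries_apply]
  exact pd_smul (hZ n i j) r μ

lemma pdSeries_neg (hZ : DiffEntries Z) (μ : Fin 4) : pdSeries μ (-Z) = -pdSeries μ Z := by
  simpa only [neg_smul, one_smul] using pdSeries_smul hZ (-1 : ℝ) μ

lemma pdSeries_one (μ : Fin 4) : pdSeries μ (1 : (MatFn d)⟦X⟧) = 0 := by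
  have h := pdSeries_mul (DiffEntries.one (d := d)) DiffEntries.one μ
  rwa [mul_one, mul_one, one_mul, left_eq_add] at h

lemma le_order_pdSeries {k : ℕ} (hZ : k ≤ order Z) (μ : Fin 4) : k ≤ order (pdSeries μ Z) :=
  nat_le_order _ _ fun m hm => by
    ext1 i j
    rw [coeff_pdSeries_apply, coeff_of_lt_order m ((Nat.cast_lt.2 hm).trans_le hZ)]
    exact pd_zero μ

lemma coeff_expSeries_mul_pdSeries {y : (MatFn d)⟦X⟧} (hy : constantCoeff y = 0)
    (hd : DiffEntries y) (μ : Fin 4) (n : ℕ) :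
    coeff n (expSeries y * pdSeries μ (expSeries (-y))) =
      -∑ m ∈ Finset.range n, (((m + 1).factorial : ℝ)⁻¹) •
        coeff n ((⁅y, ·⁆)^[m] (pdSeries μ y)) := by
  have hy' : constantCoeff (-y) = 0 := by rw [map_neg, hy, neg_zero]
  refine coeff_expSeries_mul_deriv hy (D := fun j => pdSeries μ (divPow (-y) j)) ?_ ?_
    (fun j => le_order_pdSeries (le_order_divPow hy' j) μ) ?_ n
  · simp only [divPow, Nat.factorial_zero, Nat.cast_one, inv_one, one_smul, pow_zero, pdSeries_one]
  · intro j
    rw [← pdSeries_smul (hd.neg.divPow _), succ_smul_divPow,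
      pdSeries_mul hd.neg (hd.neg.divPow j), pdSeries_neg hd]
    noncomm_ring
  · intro n m hm
    ext1 i j
    rw [map_sum, Matrix.sum_apply, coeff_pdSeries_apply, expSeries_eqUpTo hy' n m hm, map_sum,
      Matrix.sum_apply, pd_sum _ fun k _ => hd.neg.divPow k m i j]
    simp only [coeff_pdSeries_apply]

end Matrices

/-! ### Representations of Lie-algebra-valued functions -/

section Rep

variable {ι : Type*} [Fintype ι] {𝔤 : Type*} [LieRing 𝔤] [LieAlgebra ℝ 𝔤] {d : ℕ}
  (π : HermitianRep 𝔤 d) (ξ : Module.Basis ι ℝ 𝔤)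

/-- The matrix-valued function `∑_a w_a π(ξ_a)` of a Lie-algebra-valued function. -/
def repMat : (ι → Spacetime → ℝ) →ₗ[ℝ] MatFn d where
  toFun w := Matrix.of fun i j x => ∑ a, ((w a x : ℝ) : ℂ) * π.toFun (ξ a) i j
  map_add' w w' := by
    ext i j x
    simp [add_mul, Finset.sum_add_distrib]
  map_smul' r w := by
    ext i j x
    simp [Finset.mul_sum, mul_assoc]

lemma repMat_apply (w : ι → Spacetime → ℝ) (i j : Fin d) (x : Spacetime) :
    repMat π ξ w i j x = π.toFun (∑ a, w a x • ξ a) i j := by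
  simp [repMat, map_sum, Matrix.sum_apply]

lemma repMat_mul_apply (s w : ι → Spacetime → ℝ) (i j : Fin d) (x : Spacetime) :
    (repMat π ξ s * repMat π ξ w) i j x =
      (π.toFun (∑ a, s a x • ξ a) * π.toFun (∑ a, w a x • ξ a)) i j := by
  rw [Matrix.mul_apply, Finset.sum_apply, Matrix.mul_apply]
  simp only [Pi.mul_apply, repMat_apply]

lemma sum_adField_strConst_smul (s w : ι → Spacetime → ℝ) (x : Spacetime) :
    ∑ k, adField (strConst ξ) s w k x • ξ k = ⁅∑ a, s a x • ξ a, ∑ b, w b x • ξ b⁆ := by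
  have hbracket : ∀ a b, ⁅ξ a, ξ b⁆ = ∑ k, strConst ξ a b k • ξ k :=
    fun a b => (ξ.sum_repr _).symm
  rw [sum_lie]
  simp only [lie_sum, smul_lie, lie_smul, hbracket, adField, Finset.sum_apply,
    Pi.smul_apply, Pi.mul_apply, Finset.sum_smul, Finset.smul_sum]
  rw [Finset.sum_comm]
  refine Finset.sum_congr rfl fun a _ => ?_
  rw [Finset.sum_comm]
  refine Finset.sum_congr rfl fun b _ => Finset.sum_congr rfl fun k _ => ?_
  rw [smul_smul, smul_smul, smul_eq_mul]
  congr 1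
  ring

lemma repMat_adField (s w : ι → Spacetime → ℝ) :
    repMat π ξ (adField (strConst ξ) s w) = Complex.I • ⁅repMat π ξ s, repMat π ξ w⁆ := by
  ext i j x
  rw [Ring.lie_def, repMat_apply, sum_adField_strConst_smul, π.map_lie, Matrix.smul_apply,
    Matrix.smul_apply, Pi.smul_apply, Matrix.sub_apply, Matrix.sub_apply, Pi.sub_apply,
    repMat_mul_apply, repMat_mul_apply]

lemma repMat_pd {w : ι → Spacetime → ℝ} (hw : ∀ a, Differentiable ℝ (w a)) (μ : Fin 4) :
    (repMat π ξ w).map (pd μ) = repMat π ξ fun a => pd μ (w a) := by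
  ext i j x
  have hterm : ∀ a, HasFDerivAt (fun x => ((w a x : ℝ) : ℂ) * π.toFun (ξ a) i j)
      ((π.toFun (ξ a) i j) • (Complex.ofRealCLM ∘L fderiv ℝ (w a) x)) x := fun a =>
    (Complex.ofRealCLM.hasFDerivAt.comp x (hw a x).hasFDerivAt).mul_const _
  change fderiv ℝ (fun x => ∑ a, ((w a x : ℝ) : ℂ) * π.toFun (ξ a) i j) x (coordVec μ) = _
  rw [(HasFDerivAt.fun_sum fun a (_ : a ∈ Finset.univ) => hterm a).fderiv]
  simp [repMat, pd, mul_comm]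

lemma differentiable_repMat {w : ι → Spacetime → ℝ} (hw : ∀ a, Differentiable ℝ (w a))
    (i j : Fin d) : Differentiable ℝ (repMat π ξ w i j) :=
  Differentiable.fun_sum fun a _ =>
    (Complex.ofRealCLM.differentiable.comp (hw a)).mul_const (π.toFun (ξ a) i j)

/-- The series of matrix-valued functions of a series of Lie-algebra-valued functions. -/
def repFnSeries (W : ι → (Spacetime → ℝ)⟦X⟧) : (MatFn d)⟦X⟧ :=
  PowerSeries.mk fun n => repMat π ξ fun a => coeff n (W a)

lemma coeff_adField {R : Type*} [CommRing R] [Algebra ℝ R] (f : ι → ι → ι → ℝ)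
    (s w : ι → R⟦X⟧) (n : ℕ) (k : ι) :
    coeff n (adField f s w k) = ∑ p ∈ Finset.HasAntidiagonal.antidiagonal n,
      adField f (fun a => coeff p.1 (s a)) (fun a => coeff p.2 (w a)) k := by
  simp only [adField, map_sum, coeff_smul, coeff_mul, Finset.smul_sum]
  conv_lhs => enter [2, a]; rw [Finset.sum_comm]
  rw [Finset.sum_comm]

lemma I_smul_repFnSeries_lie (s w : ι → (Spacetime → ℝ)⟦X⟧) :
    ⁅Complex.I • repFnSeries π ξ s, repFnSeries π ξ w⁆ =
      repFnSeries π ξ (adField (strConst ξ) s w) := by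
  ext1 n
  rw [Ring.lie_def, smul_mul_assoc, mul_smul_comm, ← smul_sub, coeff_smul, map_sub, coeff_mul,
    coeff_mul,
    ← Finset.Nat.sum_antidiagonal_swap (f := fun p => coeff p.1 (repFnSeries π ξ w) *
      coeff p.2 (repFnSeries π ξ s)), ← Finset.sum_sub_distrib, Finset.smul_sum]
  simp only [repFnSeries, coeff_mk, coeff_adField, Prod.fst_swap, Prod.snd_swap, ← Ring.lie_def,
    ← repMat_adField]
  rw [← map_sum]
  congr 1
  ext1 a
  rw [Finset.sum_apply]

lemma iterate_I_smul_repFnSeries_lie (s w : ι → (Spacetime → ℝ)⟦X⟧) (m : ℕ) :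
    (⁅Complex.I • repFnSeries π ξ s, ·⁆)^[m] (repFnSeries π ξ w) =
      repFnSeries π ξ ((adField (strConst ξ) s)^[m] w) :=
  Function.Semiconj.iterate_right (f := repFnSeries π ξ) (ga := adField (strConst ξ) s)
    (fun w => (I_smul_repFnSeries_lie π ξ s w).symm) m w |>.symm

lemma iterate_lie_smul (y z : (MatFn d)⟦X⟧) (r : ℂ) (m : ℕ) :
    (⁅y, ·⁆)^[m] (r • z) = r • (⁅y, ·⁆)^[m] z :=
  Function.Semiconj.iterate_right (f := (r • ·)) (ga := (⁅y, ·⁆)) (gb := (⁅y, ·⁆))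
    (fun z => by simp only [Ring.lie_def, mul_smul_comm, smul_mul_assoc, smul_sub]) m z |>.symm

end Rep

/-! ### The dressing factor -/

section Dressing

variable {ι : Type*} {d : ℕ}

/-- The power series `∑ gⁿ γ_n`, colour by colour. -/
def seriesOf {R : Type*} (γ : ℕ → ι → R) : ι → R⟦X⟧ := fun a => PowerSeries.mk fun n => γ n a

@[simp]
lemma coeff_seriesOf {R : Type*} [Semiring R] (γ : ℕ → ι → R) (a : ι) (n : ℕ) :
    coeff n (seriesOf γ a) = γ n a :=
  coeff_mk _ _

lemma constantCoeff_seriesOf {R : Type*} [Semiring R] {γ : ℕ → ι → R} (hγ : γ 0 = 0) (a : ι) :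
    constantCoeff (seriesOf γ a) = 0 := by
  rw [← coeff_zero_eq_constantCoeff_apply, coeff_seriesOf, hγ, Pi.zero_apply]

/-- Evaluation of matrix-valued fields at a configuration. -/
def evMat (d : ℕ) (Φ : Conf ι) : MatField ι d →ₐ[ℝ] MatFn d :=
  (Pi.evalAlgHom ℝ (fun _ : Conf ι => Spacetime → ℂ) Φ).mapMatrix

/-- Evaluation of matrix-valued fields at a configuration and a point. -/
def evMatAt (d : ℕ) (Φ : Conf ι) (x : Spacetime) : MatField ι d →ₐ[ℝ] Matrix (Fin d) (Fin d) ℂ :=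
  (Pi.evalAlgHom ℝ (fun _ : Spacetime => ℂ) x).mapMatrix.comp (evMat d Φ)

/-- Evaluation of series of matrix-valued fields at a configuration. -/
abbrev evMatSeries (d : ℕ) (Φ : Conf ι) : (MatField ι d)⟦X⟧ →+* (MatFn d)⟦X⟧ :=
  PowerSeries.map (evMat d Φ : MatField ι d →+* MatFn d)

/-- Evaluation of series of fields at a configuration. -/
def evSeries (Φ : Conf ι) : (QField ι)⟦X⟧ →ₐ[ℝ] (Spacetime → ℝ)⟦X⟧ :=
  PowerSeries.mapAlgHom (Pi.evalAlgHom ℝ (fun _ : Conf ι => Spacetime → ℝ) Φ)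

@[simp]
lemma coeff_evSeries (Φ : Conf ι) (Y : (QField ι)⟦X⟧) (n : ℕ) :
    coeff n (evSeries Φ Y) = coeff n Y Φ := by
  rw [evSeries, mapAlgHom_apply, coeff_map]
  rfl

lemma evSeries_seriesOf (Φ : Conf ι) (γ : ℕ → ι → QField ι) (a : ι) :
    evSeries Φ (seriesOf γ a) = seriesOf (fun n b => γ n b Φ) a := by
  ext1 n
  simp only [coeff_evSeries, coeff_seriesOf]

lemma evMatSeries_I_smul (Φ : Conf ι) (Y : (MatField ι d)⟦X⟧) :
    evMatSeries d Φ (Complex.I • Y) = Complex.I • evMatSeries d Φ Y := by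
  ext n i j x
  rfl

lemma evMatSeries_matPd (Φ : Conf ι) (μ : Fin 4) (Y : (MatField ι d)⟦X⟧) :
    evMatSeries d Φ (matPd μ Y) = pdSeries μ (evMatSeries d Φ Y) := by
  ext n i j x
  simp only [coeff_map, matPd, pdSeries, coeff_mk]
  rfl

variable [Fintype ι] {𝔤 : Type*} [LieRing 𝔤] [LieAlgebra ℝ 𝔤] (π : HermitianRep 𝔤 d)
  (ξ : Module.Basis ι ℝ 𝔤)

lemma evMatSeries_repSeries (Φ : Conf ι) (Y : ι → (QField ι)⟦X⟧) :
    evMatSeries d Φ (repSeries π ξ Y) = repFnSeries π ξ fun a => evSeries Φ (Y a) := by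
  ext1 n
  simp only [coeff_map, repFnSeries, repSeries, coeff_mk, coeff_evSeries]
  rfl

lemma X_mul_repSeries (Y : ι → (QField ι)⟦X⟧) :
    X * repSeries π ξ Y = repSeries π ξ fun a => X * Y a := by
  ext n i j Φ x
  cases n with
  | zero => simp [repSeries]
  | succ n => simp [repSeries, coeff_succ_X_mul]

lemma constantCoeff_repSeries_seriesOf {γ : ℕ → ι → QField ι} (hγ : γ 0 = 0) :
    constantCoeff (Complex.I • repSeries π ξ (seriesOf γ)) = 0 := by
  rw [← coeff_zero_eq_constantCoeff_apply]
  ext i j Φ x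
  simp [repSeries, hγ]

lemma dressingFactor_neg (γ : ℕ → ι → QField ι) :
    dressingFactor π ξ (-γ) = expSeries (-(Complex.I • repSeries π ξ (seriesOf γ))) := by
  rw [dressingFactor, ← smul_neg]
  congr 2
  ext n i j Φ x
  simp [repSeries]

lemma dressingFactor_mul_neg {γ : ℕ → ι → QField ι} (hγ : γ 0 = 0) :
    dressingFactor π ξ γ * dressingFactor π ξ (-γ) = 1 := by
  rw [dressingFactor_neg]
  exact expSeries_mul_neg (constantCoeff_repSeries_seriesOf π ξ hγ)

lemma dressingFactor_neg_mul {γ : ℕ → ι → QField ι} (hγ : γ 0 = 0) :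
    dressingFactor π ξ (-γ) * dressingFactor π ξ γ = 1 := by
  have h := dressingFactor_mul_neg π ξ (γ := -γ) (by rw [Pi.neg_apply, hγ, neg_zero])
  rwa [neg_neg] at h

/-- The matrix-valued function `iγ` at a configuration. -/
def dressingExponent (γ : ℕ → ι → QField ι) (Φ : Conf ι) : (MatFn d)⟦X⟧ :=
  Complex.I • repFnSeries π ξ (seriesOf fun n a => γ n a Φ)

lemma evMatSeries_I_smul_repSeries (γ : ℕ → ι → QField ι) (Φ : Conf ι) :
    evMatSeries d Φ (Complex.I • repSeries π ξ (seriesOf γ)) = dressingExponent π ξ γ Φ := by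
  rw [evMatSeries_I_smul, evMatSeries_repSeries, dressingExponent]
  simp only [evSeries_seriesOf]

lemma evMatSeries_dressingFactor (γ : ℕ → ι → QField ι) (Φ : Conf ι) :
    evMatSeries d Φ (dressingFactor π ξ γ) = expSeries (dressingExponent π ξ γ Φ) := by
  rw [← evMatSeries_I_smul_repSeries, ← map_expSeries]
  rfl

lemma evMatSeries_dressingFactor_neg (γ : ℕ → ι → QField ι) (Φ : Conf ι) :
    evMatSeries d Φ (dressingFactor π ξ (-γ)) = expSeries (-dressingExponent π ξ γ Φ) := by
  rw [dressingFactor_neg, map_expSeries, map_neg, evMatSeries_I_smul_repSeries]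

lemma coeff_dressingFactor_apply (γ : ℕ → ι → QField ι) (Φ : Conf ι) (x : Spacetime) (n : ℕ)
    (i j : Fin d) :
    coeff n (dressingFactor π ξ γ) i j Φ x =
      coeff n (expSeries (PowerSeries.mk fun m => Complex.I • Matrix.of fun i j =>
        ∑ a, ((γ m a Φ x : ℝ) : ℂ) * π.toFun (ξ a) i j)) i j := by
  have hexp : PowerSeries.map (evMatAt d Φ x : MatField ι d →+* _)
      (Complex.I • repSeries π ξ (seriesOf γ)) =
        PowerSeries.mk fun m => Complex.I •
          Matrix.of fun i j => ∑ a, ((γ m a Φ x : ℝ) : ℂ) * π.toFun (ξ a) i j := by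
    ext n i j
    simp only [coeff_map, coeff_smul, coeff_mk, repSeries, coeff_seriesOf]
    rfl
  rw [← hexp, ← map_expSeries, coeff_map]
  rfl

lemma stringLocalized_dressingFactor {c : StringFunction} {γ : ℕ → ι → QField ι}
    (hγ : ∀ n a, IsRegular c (γ n a)) : StringLocalized c (dressingFactor π ξ γ) := by
  intro n i j x ε hε Φ hΦ Ψ hΨ h
  simp only [coeff_dressingFactor_apply, (hγ _ _).localized x ε hε Φ hΦ Ψ hΨ h]

end Dressing

/-! ### The gauge transform -/

section Gauge

variable {ι : Type*} [Fintype ι]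

/-- The order `n` of the gauge transform `e^{iγ} (g A_μ + i ∂_μ) e^{-iγ}`, by the expansions
`e^{iγ} v e^{-iγ} = ∑ ad_{iγ}^m(v) / m!` and
`i e^{iγ} ∂_μ e^{-iγ} = ∑ ad_{iγ}^m(∂_μ γ) / (m + 1)!`. -/
def gaugeCoeff (f : ι → ι → ι → ℝ) (γ : ℕ → ι → QField ι) (μ : Fin 4) (n : ℕ) (a : ι) : QField ι :=
  ∑ m ∈ Finset.range (n + 1), ((m.factorial : ℝ)⁻¹) •
      coeff n ((adField f (seriesOf γ))^[m] (fun b => X * C (fieldA μ b)) a) +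
    ∑ m ∈ Finset.range n, (((m + 1).factorial : ℝ)⁻¹) •
      coeff n ((adField f (seriesOf γ))^[m] (seriesOf fun n b => fieldPd μ (γ n b)) a)

lemma map_iterate_adField {R R' : Type*} [CommRing R] [Algebra ℝ R] [CommRing R'] [Algebra ℝ R']
    (f : ι → ι → ι → ℝ) (φ : R →ₐ[ℝ] R') (s v : ι → R) (m : ℕ) (k : ι) :
    φ ((adField f s)^[m] v k) = (adField f fun a => φ (s a))^[m] (fun a => φ (v a)) k :=
  congrFun (Function.Semiconj.iterate_right (f := fun v a => φ (v a)) (ga := adField f s)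
    (gb := adField f fun a => φ (s a)) (fun v => funext fun a => map_adField f φ s v a) m v) k

variable {𝔤 : Type*} [LieRing 𝔤] [LieAlgebra ℝ 𝔤] {d : ℕ} (π : HermitianRep 𝔤 d)
  (ξ : Module.Basis ι ℝ 𝔤)

lemma constantCoeff_dressingExponent {γ : ℕ → ι → QField ι} (hγ : γ 0 = 0) (Φ : Conf ι) :
    constantCoeff (dressingExponent π ξ γ Φ) = 0 := by
  rw [← coeff_zero_eq_constantCoeff_apply]
  simp only [dressingExponent, coeff_smul, repFnSeries, coeff_mk, coeff_seriesOf, hγ]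
  rw [show (fun a => (0 : ι → QField ι) a Φ) = 0 from rfl, map_zero, smul_zero]

lemma diffEntries_repFnSeries_seriesOf {w : ℕ → ι → Spacetime → ℝ}
    (hw : ∀ n a, Differentiable ℝ (w n a)) : DiffEntries (repFnSeries π ξ (seriesOf w)) := by
  intro m i j
  simp only [repFnSeries, coeff_mk, coeff_seriesOf]
  exact differentiable_repMat π ξ (hw m) i j

lemma pdSeries_repFnSeries_seriesOf {w : ℕ → ι → Spacetime → ℝ}
    (hw : ∀ n a, Differentiable ℝ (w n a)) (μ : Fin 4) :
    pdSeries μ (repFnSeries π ξ (seriesOf w)) =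
      repFnSeries π ξ (seriesOf fun n a => pd μ (w n a)) := by
  ext1 m
  simp only [pdSeries, repFnSeries, coeff_mk, coeff_seriesOf]
  exact repMat_pd π ξ (hw m) μ

lemma coeff_iterate_lie_repFnSeries (γ : ℕ → ι → QField ι) (Φ : Conf ι) (v : ι → (QField ι)⟦X⟧)
    (m n : ℕ) :
    coeff n ((⁅dressingExponent π ξ γ Φ, ·⁆)^[m] (repFnSeries π ξ fun a => evSeries Φ (v a))) =
      repMat π ξ fun a => coeff n ((adField (strConst ξ) (seriesOf γ))^[m] v a) Φ := by
  rw [dressingExponent, iterate_I_smul_repFnSeries_lie, repFnSeries, coeff_mk]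
  congr 1
  ext1 a
  rw [← coeff_evSeries, map_iterate_adField]
  simp only [evSeries_seriesOf]

lemma coeff_conj_dressingFactor {γ : ℕ → ι → QField ι} (hγ : γ 0 = 0) (Φ : Conf ι)
    (v : ι → (QField ι)⟦X⟧) (n : ℕ) :
    coeff n (evMatSeries d Φ
        (dressingFactor π ξ γ * repSeries π ξ v * dressingFactor π ξ (-γ))) =
      repMat π ξ (∑ m ∈ Finset.range (n + 1), ((m.factorial : ℝ)⁻¹) •
        fun a => coeff n ((adField (strConst ξ) (seriesOf γ))^[m] v a) Φ) := by
  rw [map_mul (evMatSeries d Φ), map_mul (evMatSeries d Φ), evMatSeries_dressingFactor,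
    evMatSeries_dressingFactor_neg, evMatSeries_repSeries,
    coeff_conj_expSeries (constantCoeff_dressingExponent π ξ hγ Φ),
    map_sum]
  simp only [map_smul, coeff_iterate_lie_repFnSeries]

lemma coeff_dressingFactor_mul_matPd {γ : ℕ → ι → QField ι} (hγ : γ 0 = 0) {Φ : Conf ι}
    (hd : ∀ n a, Differentiable ℝ (γ n a Φ)) (μ : Fin 4) (n : ℕ) :
    coeff n (evMatSeries d Φ
        (Complex.I • (dressingFactor π ξ γ * matPd μ (dressingFactor π ξ (-γ))))) =
      repMat π ξ (∑ m ∈ Finset.range n, (((m + 1).factorial : ℝ)⁻¹) • fun a => coeff n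
        ((adField (strConst ξ) (seriesOf γ))^[m] (seriesOf fun n b => fieldPd μ (γ n b)) a) Φ) := by
  have hdiff := diffEntries_repFnSeries_seriesOf π ξ hd
  have hpd : pdSeries μ (dressingExponent π ξ γ Φ) =
      Complex.I • repFnSeries π ξ
        fun a => evSeries Φ (seriesOf (fun n b => fieldPd μ (γ n b)) a) := by
    rw [dressingExponent, pdSeries_smul hdiff, pdSeries_repFnSeries_seriesOf π ξ hd]
    simp only [evSeries_seriesOf]
    rfl
  rw [evMatSeries_I_smul, map_mul (evMatSeries d Φ), evMatSeries_matPd, evMatSeries_dressingFactor,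
    evMatSeries_dressingFactor_neg, coeff_smul,
    coeff_expSeries_mul_pdSeries (constantCoeff_dressingExponent π ξ hγ Φ) (hdiff.smul _), hpd,
    smul_neg, Finset.smul_sum, map_sum, ← Finset.sum_neg_distrib]
  refine Finset.sum_congr rfl fun m _ => ?_
  rw [iterate_lie_smul, coeff_smul, coeff_iterate_lie_repFnSeries, map_smul, smul_comm Complex.I,
    smul_smul Complex.I, Complex.I_mul_I, neg_smul, one_smul, smul_neg, neg_neg]

lemma coeff_gaugeTransform {γ : ℕ → ι → QField ι} (hγ : γ 0 = 0) {Φ : Conf ι}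
    (hd : ∀ n a, Differentiable ℝ (γ n a Φ)) (μ : Fin 4) (n : ℕ) (i j : Fin d) :
    (coeff n (dressingFactor π ξ γ * (X * repSeries π ξ fun a => C (fieldA μ a)) *
        dressingFactor π ξ (-γ) +
      Complex.I • (dressingFactor π ξ γ * matPd μ (dressingFactor π ξ (-γ)))) :
        MatField ι d) i j Φ =
      repMat π ξ (fun a => gaugeCoeff (strConst ξ) γ μ n a Φ) i j := by
  rw [X_mul_repSeries]
  suffices h : coeff n (evMatSeries d Φ
      (dressingFactor π ξ γ * (repSeries π ξ fun a => X * C (fieldA μ a)) *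
        dressingFactor π ξ (-γ) +
      Complex.I • (dressingFactor π ξ γ * matPd μ (dressingFactor π ξ (-γ))))) =
      repMat π ξ fun a => gaugeCoeff (strConst ξ) γ μ n a Φ by
    rw [← h, coeff_map]
    rfl
  rw [map_add, map_add, coeff_conj_dressingFactor π ξ hγ,
    coeff_dressingFactor_mul_matPd π ξ hγ hd, ← map_add]
  congr 1
  ext1 a
  simp [gaugeCoeff, Finset.sum_apply]

end Gauge

/-! ### The gauge parameter -/

/-- The sequence defined by a recursion on its initial segments, which are continued by `0`. -/
def recSeq {M : Type*} [Zero M] (F : ℕ → (ℕ → M) → M) : ℕ → M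
  | n => F n fun j => if _ : j < n then recSeq F j else 0

lemma exists_seq_of_step {M : Type*} [Zero M] (Q : ℕ → (ℕ → M) → M → Prop)
    (h : ∀ n a, ∃ x, Q n a x) :
    ∃ s : ℕ → M, ∀ n, Q n (fun j => if j < n then s j else 0) (s n) := by
  choose F hF using h
  refine ⟨recSeq F, fun n => ?_⟩
  have hrec : recSeq F n = F n fun j => if j < n then recSeq F j else 0 := by
    rw [recSeq]
    simp only [dite_eq_ite]
  conv => arg 3; rw [hrec]
  exact hF n _

section VectorFields

variable {ι : Type*} [Fintype ι] {f : ι → ι → ι → ℝ} {c : StringFunction}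

/-- The map from vectors of Wick polynomials to vector fields. -/
def wickVec : (Fin 4 → ι → Wick f c) →ₗ[ℝ] (Fin 4 → ι → QField ι) where
  toFun := vecField
  map_add' u w := by ext1 ν; ext1 a; exact map_add wickField _ _
  map_smul' r u := by ext1 ν; ext1 a; exact map_smul wickField _ _

variable (f c) in
/-- The vector fields that are represented by elements of `𝒱`. -/
def fieldV : Submodule ℝ (Fin 4 → ι → QField ι) := (spaceV f c).map wickVec

lemma isRegular_of_mem_fieldV {w : Fin 4 → ι → QField ι} (hw : w ∈ fieldV f c) (ν : Fin 4)
    (a : ι) : IsRegular c (w ν a) := by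
  obtain ⟨u, hu, rfl⟩ := hw
  exact isRegular_wickField hu ν a

lemma fieldA_mem_fieldV : fieldA ∈ fieldV f c :=
  ⟨vecA, vecA_mem, funext₂ wickField_vecA⟩

lemma fieldPd_mem_fieldV {s : ι → QField ι} (hs : s ∈ spaceS f c) :
    (fun ν a => fieldPd ν (s a)) ∈ fieldV f c :=
  ⟨vecDs ⟨s, hs⟩, vecDs_mem _, funext₂ (wickField_vecDs _)⟩

lemma adField_mem_fieldV {s : ι → QField ι} (hs : s ∈ spaceS f c) {w : Fin 4 → ι → QField ι}
    (hw : w ∈ fieldV f c) : (fun ν => adField f s (w ν)) ∈ fieldV f c := by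
  obtain ⟨u, hu, rfl⟩ := hw
  exact ⟨adVec ⟨s, hs⟩ u, adVec_mem _ hu, funext₂ (wickField_adVec _ u)⟩

lemma coeff_iterate_adField_mem_fieldV {γ : ℕ → ι → QField ι} (hγ : ∀ n, γ n ∈ spaceS f c)
    {w : Fin 4 → ι → (QField ι)⟦X⟧} (hw : ∀ n, (fun ν a => coeff n (w ν a)) ∈ fieldV f c)
    (m n : ℕ) :
    (fun ν a => coeff n ((adField f (seriesOf γ))^[m] (w ν) a)) ∈ fieldV f c := by
  induction m generalizing n with
  | zero => exact hw n
  | succ m ih =>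
    have hcoeff : (fun ν a => coeff n ((adField f (seriesOf γ))^[m + 1] (w ν) a)) =
        ∑ p ∈ Finset.HasAntidiagonal.antidiagonal n, fun ν => adField f (γ p.1)
          fun a => coeff p.2 ((adField f (seriesOf γ))^[m] (w ν) a) := by
      ext1 ν
      ext1 a
      rw [Function.iterate_succ_apply', coeff_adField, Finset.sum_apply, Finset.sum_apply]
      simp only [coeff_seriesOf]
    rw [hcoeff]
    exact Submodule.sum_mem _ fun p _ => adField_mem_fieldV (hγ p.1) (ih p.2)

lemma coeff_X_mul_C_fieldA_mem_fieldV (n : ℕ) :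
    (fun (ν : Fin 4) (a : ι) => coeff n (X * C (fieldA ν a))) ∈ fieldV f c := by
  have hcoeff : (fun (ν : Fin 4) (a : ι) => coeff n (X * C (fieldA ν a))) =
      if n = 1 then fieldA else 0 := by
    ext1 ν
    ext1 a
    rw [mul_comm, coeff_C_mul, coeff_X, mul_ite, mul_one, mul_zero]
    split_ifs <;> rfl
  rw [hcoeff]
  split_ifs
  exacts [fieldA_mem_fieldV, zero_mem _]

end VectorFields

lemma eqUpTo_seriesOf {ι R : Type*} [Semiring R] {w w' : ℕ → ι → R} {n : ℕ}
    (h : ∀ j ≤ n, w j = w' j) (a : ι) : EqUpTo n (seriesOf w a) (seriesOf w' a) := fun m hm => by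
  rw [coeff_seriesOf, coeff_seriesOf, h m hm]

section Truncation

variable {ι : Type*} [Fintype ι] {R : Type*} [CommRing R] [Algebra ℝ R] {f : ι → ι → ι → ℝ}
  {s s' v v' : ι → R⟦X⟧}

lemma constantCoeff_adField (hs : ∀ a, constantCoeff (s a) = 0) (k : ι) :
    constantCoeff (adField f s v k) = 0 := by
  simp only [adField, map_sum, constantCoeff_smul, map_mul, hs, zero_mul, smul_zero,
    Finset.sum_const_zero]

lemma EqUpTo.adField {n : ℕ} (hs : ∀ a, EqUpTo n (s a) (s' a)) (hv : ∀ a, EqUpTo n (v a) (v' a))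
    (k : ι) : EqUpTo n (adField f s v k) (adField f s' v' k) := fun m hm => by
  simp only [StringYM.adField, map_sum, coeff_smul, ((hs _).mul (hv _)) m hm]

lemma EqUpTo.iterate_adField {n : ℕ} (hs : ∀ a, EqUpTo n (s a) (s' a))
    (hv : ∀ a, EqUpTo n (v a) (v' a)) (m : ℕ) (k : ι) :
    EqUpTo n ((StringYM.adField f s)^[m] v k) ((StringYM.adField f s')^[m] v' k) := by
  induction m generalizing k with
  | zero => exact hv k
  | succ m ih =>
    rw [Function.iterate_succ_apply', Function.iterate_succ_apply']
    exact .adField hs ih k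

lemma EqUpTo.iterate_adField_succ {n : ℕ} (hs₀ : ∀ a, constantCoeff (s a) = 0)
    (hv₀ : ∀ a, constantCoeff (v a) = 0) (hs : ∀ a, EqUpTo n (s a) (s' a))
    (hv : ∀ a, EqUpTo n (v a) (v' a)) (m : ℕ) (k : ι) :
    EqUpTo (n + 1) ((StringYM.adField f s)^[m + 1] v k)
      ((StringYM.adField f s')^[m + 1] v' k) := fun l hl => by
  have hiter₀ : ∀ b, constantCoeff ((StringYM.adField f s)^[m] v b) = 0 := by
    cases m with
    | zero => exact hv₀
    | succ m =>
      rw [Function.iterate_succ_apply']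
      exact constantCoeff_adField hs₀
  rw [Function.iterate_succ_apply', Function.iterate_succ_apply' (StringYM.adField f s')]
  simp only [StringYM.adField, map_sum, coeff_smul,
    EqUpTo.mul_succ (hs₀ _) (hiter₀ _) (hs _) (EqUpTo.iterate_adField hs hv m _) l hl]

end Truncation

section Gamma

variable {ι : Type*} [Fintype ι] {f : ι → ι → ι → ℝ} {c : StringFunction} {γ : ℕ → ι → QField ι}

/-- The order `n + 1` of the gauge transform, without the term `∂_μ γ_{n+1}`. -/
def gaugeRest (f : ι → ι → ι → ℝ) (γ : ℕ → ι → QField ι) (μ : Fin 4) (n : ℕ) (a : ι) : QField ι :=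
  ∑ m ∈ Finset.range (n + 2), ((m.factorial : ℝ)⁻¹) •
      coeff (n + 1) ((adField f (seriesOf γ))^[m] (fun b => X * C (fieldA μ b)) a) +
    ∑ m ∈ Finset.range n, (((m + 2).factorial : ℝ)⁻¹) • coeff (n + 1)
      ((adField f (seriesOf γ))^[m + 1] (seriesOf fun n b => fieldPd μ (γ n b)) a)

lemma gaugeCoeff_succ (γ : ℕ → ι → QField ι) (μ : Fin 4) (n : ℕ) (a : ι) :
    gaugeCoeff f γ μ (n + 1) a = gaugeRest f γ μ n a + fieldPd μ (γ (n + 1) a) := by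
  rw [gaugeCoeff, gaugeRest, Finset.sum_range_succ' _ n]
  simp only [coeff_seriesOf, Function.iterate_zero, id_eq, zero_add, Nat.factorial_one,
    Nat.cast_one, inv_one, one_smul]
  exact (add_assoc _ _ _).symm

lemma gaugeCoeff_zero (μ : Fin 4) (a : ι) : gaugeCoeff f γ μ 0 a = 0 := by
  simp [gaugeCoeff]

lemma gaugeRest_mem_fieldV (hγ : ∀ n, γ n ∈ spaceS f c) (n : ℕ) :
    (fun μ a => gaugeRest f γ μ n a) ∈ fieldV f c := by
  have hpd : ∀ n, (fun ν a => coeff n (seriesOf (fun n b => fieldPd ν (γ n b)) a)) ∈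
      fieldV f c := fun n => by
    simpa only [coeff_seriesOf] using fieldPd_mem_fieldV (hγ n)
  have hrest : (fun μ a => gaugeRest f γ μ n a) =
      ∑ m ∈ Finset.range (n + 2), ((m.factorial : ℝ)⁻¹) • (fun ν a =>
        coeff (n + 1) ((adField f (seriesOf γ))^[m] (fun b => X * C (fieldA ν b)) a)) +
      ∑ m ∈ Finset.range n, (((m + 2).factorial : ℝ)⁻¹) • (fun ν a => coeff (n + 1)
        ((adField f (seriesOf γ))^[m + 1] (seriesOf fun n b => fieldPd ν (γ n b)) a)) := by
    ext1 μ
    ext1 a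
    simp [gaugeRest, Finset.sum_apply]
  rw [hrest]
  exact add_mem
    (Submodule.sum_mem _ fun m _ => Submodule.smul_mem _ _
      (coeff_iterate_adField_mem_fieldV hγ coeff_X_mul_C_fieldA_mem_fieldV _ _))
    (Submodule.sum_mem _ fun m _ => Submodule.smul_mem _ _
      (coeff_iterate_adField_mem_fieldV hγ hpd _ _))

lemma gaugeCoeff_mem_fieldV (hγ : ∀ n, γ n ∈ spaceS f c) (n : ℕ) :
    (fun μ a => gaugeCoeff f γ μ n a) ∈ fieldV f c := by
  cases n with
  | zero =>
    simp only [gaugeCoeff_zero]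
    exact zero_mem _
  | succ n =>
    simp only [gaugeCoeff_succ]
    exact add_mem (gaugeRest_mem_fieldV hγ n) (fieldPd_mem_fieldV (hγ (n + 1)))

/-- Only `∂_μ γ_{n+1}`, which is left out of `gaugeRest`, involves `γ_{n+1}`: in the other terms
each `γ` is multiplied by a series without constant term. -/
lemma gaugeRest_congr {γ' : ℕ → ι → QField ι} (hγ : γ 0 = 0) {n : ℕ} (h : ∀ j ≤ n, γ j = γ' j)
    (μ : Fin 4) (a : ι) : gaugeRest f γ μ n a = gaugeRest f γ' μ n a := by
  have hpd₀ : (fun b => fieldPd μ (γ 0 b)) = 0 := by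
    ext b Φ x
    rw [hγ]
    exact congrFun (pd_zero μ) x
  have hs := eqUpTo_seriesOf h
  have hpd : ∀ b, EqUpTo n (seriesOf (fun n b => fieldPd μ (γ n b)) b)
      (seriesOf (fun n b => fieldPd μ (γ' n b)) b) :=
    eqUpTo_seriesOf fun j hj => by rw [h j hj]
  have hγ₀ := constantCoeff_seriesOf hγ
  unfold gaugeRest
  congr 1
  · refine Finset.sum_congr rfl fun m _ => ?_
    cases m with
    | zero => rfl
    | succ m =>
      rw [EqUpTo.iterate_adField_succ hγ₀ (fun b => by rw [map_mul, constantCoeff_X, zero_mul]) hs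
        (fun _ => .refl n _) m a (n + 1) le_rfl]
  · refine Finset.sum_congr rfl fun m _ => ?_
    rw [EqUpTo.iterate_adField_succ hγ₀ (constantCoeff_seriesOf hpd₀) hs hpd m a (n + 1) le_rfl]

lemma gaugeRest_zero (hγ : γ 0 = 0) (μ : Fin 4) (a : ι) : gaugeRest f γ μ 0 a = fieldA μ a := by
  have had : coeff 1 (adField f (seriesOf γ) (fun b => X * C (fieldA μ b)) a) = 0 := by
    simp only [adField, map_sum, coeff_smul, coeff_mul, Finset.Nat.antidiagonal_succ]
    simp [hγ]
  simp [gaugeRest, Finset.sum_range_succ, had]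

variable (f c) in
-- As `I_c^ν ∂_ν γ = -γ`, the condition on `γ` is the axial gauge condition `I_c^ν B_ν = 0`.
lemma exists_axial_gauge : ∃ γ : ℕ → ι → QField ι, γ 0 = 0 ∧ (∀ n, γ n ∈ spaceS f c) ∧
    ∀ n a, Set.EqOn (γ (n + 1) a) (∑ ν, fieldInt c ν (gaugeRest f γ ν n a)) (configs ι c) := by
  obtain ⟨s, hs⟩ := exists_seq_of_step (M := spaceS f c)
    (fun n γ σ => (n = 0 → σ = 0) ∧ ∀ k, n = k + 1 → ∀ a, Set.EqOn (σ.1 a)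
      (∑ ν, fieldInt c ν (gaugeRest f (fun n => (γ n).1) ν k a)) (configs ι c)) (by
    intro n γ
    cases n with
    | zero => exact ⟨0, fun _ => rfl, fun k hk => by omega⟩
    | succ n =>
      obtain ⟨u, hu, hu'⟩ := gaugeRest_mem_fieldV (f := f) (c := c) (fun n => (γ n).2) n
      obtain ⟨σ, hσ, h⟩ := exists_spaceS_eqOn_vecInt hu
      refine ⟨⟨σ, hσ⟩, fun h => by omega, fun k hk a => ?_⟩
      obtain rfl : n = k := by omega
      have hrest : ∀ ν, wickField (u ν a) = gaugeRest f (fun n => (γ n).1) ν n a := fun ν =>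
        congrFun (congrFun hu' ν) a
      simpa only [vecInt, hrest] using h a)
  have hs₀ : s 0 = 0 := (hs 0).1 rfl
  refine ⟨fun n => (s n).1, congrArg Subtype.val hs₀, fun n => (s n).2, fun n a => ?_⟩
  have hrest : ∀ ν, gaugeRest f (fun n => (s n).1) ν n a =
      gaugeRest f (fun j => (if j < n + 1 then s j else 0 : spaceS f c).1) ν n a := fun ν =>
    gaugeRest_congr (congrArg Subtype.val hs₀) (fun j hj => by rw [if_pos (by omega)]) ν a
  simp only [hrest]
  exact (hs (n + 1)).2 n rfl a

end Gamma

/-! ### The flow of a series of variations -/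

section Flow

variable {ι : Type*} {c : StringFunction}

lemma IsRegular.congr {X Y : QField ι} (hX : IsRegular c X) (h : Set.EqOn X Y (configs ι c)) :
    IsRegular c Y where
  exists_poly Φ hΦ Ψ hΨ := by
    obtain ⟨p, hp, hp'⟩ := hX.exists_poly Φ hΦ Ψ hΨ
    exact ⟨p, hp, fun t => by rw [← h (add_smul_mem_configs hΦ hΨ t), hp']⟩
  localized x ε hε Φ hΦ Ψ hΨ hΦΨ := by
    rw [← h hΦ, ← h hΨ]
    exact hX.localized x ε hε Φ hΦ Ψ hΨ hΦΨ

/-- The functional derivative of a power series in `g` in the direction of the power series `w` of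
variations: the form that `ω_U` takes for a mediator field `U`. -/
def dSeries (w : ℕ → Fin 4 → ι → QField ι) (Y : (QField ι)⟦X⟧) : (QField ι)⟦X⟧ :=
  PowerSeries.mk fun n => ∑ p ∈ Finset.HasAntidiagonal.antidiagonal n,
    dirDeriv (w p.1) (coeff p.2 Y)

/-- The order `n` of the `k`-fold functional derivative of `X` in the direction of `w`. -/
def flowCoeff (w : ℕ → Fin 4 → ι → QField ι) (X : QField ι) (k n : ℕ) : QField ι :=
  coeff n ((dSeries w)^[k] (C X))

/-- The order `n` of the flow of `w` on `X`. If `w 0 = 0`, the `k`-fold derivative starts at order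
`k`, so the exponential series ends at `k = n`. -/
def expFlow (w : ℕ → Fin 4 → ι → QField ι) (X : QField ι) (n : ℕ) : QField ι :=
  ∑ k ∈ Finset.range (n + 1), ((k.factorial : ℝ)⁻¹) • flowCoeff w X k n

variable {w w' : ℕ → Fin 4 → ι → QField ι}

lemma flowCoeff_zero (X : QField ι) (n : ℕ) : flowCoeff w X 0 n = if n = 0 then X else 0 := by
  rw [flowCoeff, Function.iterate_zero, id, coeff_C]

lemma flowCoeff_succ (X : QField ι) (k n : ℕ) : flowCoeff w X (k + 1) n =
    ∑ p ∈ Finset.HasAntidiagonal.antidiagonal n, dirDeriv (w p.1) (flowCoeff w X k p.2) := by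
  rw [flowCoeff, Function.iterate_succ_apply', dSeries, coeff_mk]
  rfl

lemma flowCoeff_one (X : QField ι) (n : ℕ) : flowCoeff w X 1 n = dirDeriv (w n) X := by
  rw [flowCoeff_succ, Finset.sum_eq_single (n, 0)]
  · rw [flowCoeff_zero, if_pos rfl]
  · rintro ⟨i, j⟩ hij hne
    have hij' : i + j = n := Finset.HasAntidiagonal.mem_antidiagonal.1 hij
    have hj : j ≠ 0 := by
      rintro rfl
      exact hne (by rw [← hij', add_zero])
    rw [flowCoeff_zero, if_neg hj, dirDeriv_zero]
  · exact fun h => absurd (Finset.HasAntidiagonal.mem_antidiagonal.2 (add_zero n)) h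

lemma flowCoeff_eq_zero (hw : w 0 = 0) (X : QField ι) {k n : ℕ} (h : n < k) :
    flowCoeff w X k n = 0 := by
  induction k generalizing n with
  | zero => omega
  | succ k ih =>
    rw [flowCoeff_succ]
    refine Finset.sum_eq_zero fun ⟨i, j⟩ hij => ?_
    have hij' : i + j = n := Finset.HasAntidiagonal.mem_antidiagonal.1 hij
    rcases Nat.eq_zero_or_pos i with rfl | hi
    · rw [hw, dirDeriv_zero_left]
    · rw [ih (by omega), dirDeriv_zero]

lemma flowCoeff_congr (X : QField ι) {n : ℕ} (h : ∀ j < n, w j = w' j) (k : ℕ) {m : ℕ}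
    (hm : m < n) : flowCoeff w X k m = flowCoeff w' X k m := by
  induction k generalizing m with
  | zero => rw [flowCoeff_zero, flowCoeff_zero]
  | succ k ih =>
    rw [flowCoeff_succ, flowCoeff_succ]
    refine Finset.sum_congr rfl fun ⟨i, j⟩ hij => ?_
    have hij' : i + j = m := Finset.HasAntidiagonal.mem_antidiagonal.1 hij
    rw [h i (by omega), ih (by omega)]

lemma flowCoeff_add_two_congr (hw : w 0 = 0) (hw' : w' 0 = 0) (X : QField ι) {n : ℕ}
    (h : ∀ j < n, w j = w' j) (k : ℕ) :
    flowCoeff w X (k + 2) n = flowCoeff w' X (k + 2) n := by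
  rw [flowCoeff_succ, flowCoeff_succ]
  refine Finset.sum_congr rfl fun ⟨i, j⟩ hij => ?_
  have hij' : i + j = n := Finset.HasAntidiagonal.mem_antidiagonal.1 hij
  rcases Nat.eq_zero_or_pos i with rfl | hi
  · rw [hw, hw', dirDeriv_zero_left, dirDeriv_zero_left]
  rcases Nat.eq_zero_or_pos j with rfl | hj
  · rw [flowCoeff_eq_zero hw X (Nat.succ_pos k), flowCoeff_eq_zero hw' X (Nat.succ_pos k),
      dirDeriv_zero, dirDeriv_zero]
  rw [h i (by omega), flowCoeff_congr X h (k + 1) (by omega)]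

/-- The order `n + 1` of the flow of `w` on `X`, without the term `dirDeriv (w (n + 1)) X`. -/
def flowRest (w : ℕ → Fin 4 → ι → QField ι) (X : QField ι) (n : ℕ) : QField ι :=
  ∑ k ∈ Finset.range n, (((k + 2).factorial : ℝ)⁻¹) • flowCoeff w X (k + 2) (n + 1)

lemma expFlow_zero (X : QField ι) : expFlow w X 0 = X := by
  simp [expFlow, flowCoeff_zero]

lemma expFlow_succ (X : QField ι) (n : ℕ) :
    expFlow w X (n + 1) = dirDeriv (w (n + 1)) X + flowRest w X n := by
  rw [expFlow, flowRest, Finset.sum_range_succ', Finset.sum_range_succ', flowCoeff_zero,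
    if_neg (Nat.succ_ne_zero n), smul_zero, add_zero, add_comm, zero_add, flowCoeff_one,
    Nat.factorial_one, Nat.cast_one, inv_one, one_smul]

lemma flowRest_congr (hw : w 0 = 0) (hw' : w' 0 = 0) (X : QField ι) {n : ℕ}
    (h : ∀ j ≤ n, w j = w' j) : flowRest w X n = flowRest w' X n := by
  simp only [flowRest, flowCoeff_add_two_congr hw hw' X fun j hj => h j (Nat.le_of_lt_succ hj)]

/-! ### Linear operations on vector fields -/

/-- A linear operation on vector fields that preserves regularity and commutes with functional
derivatives. The identities are required on configurations and for regular fields only, since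
derivatives and string integrals are additive only there. -/
structure IsLinOp (c : StringFunction) (L : (Fin 4 → QField ι) → QField ι) : Prop where
  regular : ∀ {Y}, (∀ ν, IsRegular c (Y ν)) → IsRegular c (L Y)
  congr : ∀ {Y Z}, (∀ ν, Set.EqOn (Y ν) (Z ν) (configs ι c)) → Set.EqOn (L Y) (L Z) (configs ι c)
  add : ∀ {Y Z}, (∀ ν, IsRegular c (Y ν)) → (∀ ν, IsRegular c (Z ν)) →
    Set.EqOn (L (Y + Z)) (L Y + L Z) (configs ι c)
  smul : ∀ {Y}, (∀ ν, IsRegular c (Y ν)) → ∀ r : ℝ,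
    Set.EqOn (L (r • Y)) (r • L Y) (configs ι c)
  deriv : ∀ {v Y}, IsVariation c v → (∀ ν, IsRegular c (Y ν)) →
    Set.EqOn (dirDeriv v (L Y)) (L fun ν => dirDeriv v (Y ν)) (configs ι c)

lemma isLinOp_apply (ν : Fin 4) : IsLinOp c fun Y : Fin 4 → QField ι => Y ν where
  regular hY := hY ν
  congr h := h ν
  add _ _ _ _ := rfl
  smul _ _ _ _ := rfl
  deriv _ _ _ _ := rfl

variable {L M : (Fin 4 → QField ι) → QField ι}

lemma IsLinOp.fieldPd (hL : IsLinOp c L) (μ : Fin 4) : IsLinOp c fun Y => fieldPd μ (L Y) where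
  regular hY := (hL.regular hY).fieldPd μ
  congr h Φ hΦ := by simp only [StringYM.fieldPd, hL.congr h hΦ]
  add hY hZ Φ hΦ := by
    simp only [StringYM.fieldPd, hL.add hY hZ hΦ, Pi.add_apply]
    exact pd_add ((hL.regular hY).admissible hΦ).differentiable
      ((hL.regular hZ).admissible hΦ).differentiable μ
  smul hY r Φ hΦ := by
    simp only [StringYM.fieldPd, hL.smul hY r hΦ, Pi.smul_apply]
    exact pd_smul ((hL.regular hY).admissible hΦ).differentiable r μ
  deriv hv hY Φ hΦ := by
    rw [dirDeriv_fieldPd hv (hL.regular hY) μ hΦ]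
    simp only [StringYM.fieldPd, hL.deriv hv hY hΦ]

lemma IsLinOp.fieldInt (hL : IsLinOp c L) (μ : Fin 4) : IsLinOp c fun Y => fieldInt c μ (L Y) where
  regular hY := (hL.regular hY).fieldInt μ
  congr h Φ hΦ := by simp only [StringYM.fieldInt, hL.congr h hΦ]
  add hY hZ Φ hΦ := by
    simp only [StringYM.fieldInt, hL.add hY hZ hΦ, Pi.add_apply]
    exact stringInt_add ((hL.regular hY).admissible hΦ) ((hL.regular hZ).admissible hΦ) μ
  smul hY r Φ hΦ := by
    simp only [StringYM.fieldInt, hL.smul hY r hΦ, Pi.smul_apply]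
    exact stringInt_smul ((hL.regular hY).admissible hΦ) r μ
  deriv hv hY Φ hΦ := by
    rw [dirDeriv_fieldInt hv (hL.regular hY) μ hΦ]
    simp only [StringYM.fieldInt, hL.deriv hv hY hΦ]

lemma IsLinOp.sub (hL : IsLinOp c L) (hM : IsLinOp c M) : IsLinOp c fun Y => L Y - M Y where
  regular hY := (hL.regular hY).sub (hM.regular hY)
  congr h Φ hΦ := by simp only [Pi.sub_apply, hL.congr h hΦ, hM.congr h hΦ]
  add hY hZ Φ hΦ := by
    simp only [Pi.sub_apply, Pi.add_apply, hL.add hY hZ hΦ, hM.add hY hZ hΦ]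
    exact add_sub_add_comm _ _ _ _
  smul hY r Φ hΦ := by
    simp only [Pi.sub_apply, Pi.smul_apply, hL.smul hY r hΦ, hM.smul hY r hΦ, smul_sub]
  deriv {v Y} hv hY Φ hΦ := by
    have h : L Y - M Y = L Y + (-1 : ℝ) • M Y := by rw [neg_one_smul, sub_eq_add_neg]
    simp only [h, dirDeriv_add hv (hL.regular hY) ((hM.regular hY).smul _) hΦ, Pi.add_apply,
      dirDeriv_smul hv (hM.regular hY) _ hΦ, Pi.smul_apply, hL.deriv hv hY hΦ, hM.deriv hv hY hΦ,
      Pi.sub_apply]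
    rw [neg_one_smul, sub_eq_add_neg]

lemma IsLinOp.sum {κ : Type*} [Fintype κ] {L : κ → (Fin 4 → QField ι) → QField ι}
    (hL : ∀ i, IsLinOp c (L i)) : IsLinOp c fun Y => ∑ i, L i Y where
  regular hY := IsRegular.sum _ fun i _ => (hL i).regular hY
  congr h Φ hΦ := by simp only [Finset.sum_apply, fun i => (hL i).congr h hΦ]
  add hY hZ Φ hΦ := by
    simp only [Finset.sum_apply, Pi.add_apply, fun i => (hL i).add hY hZ hΦ]
    exact Finset.sum_add_distrib
  smul hY r Φ hΦ := by
    simp only [Finset.sum_apply, Pi.smul_apply, fun i => (hL i).smul hY r hΦ, Finset.smul_sum]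
  deriv hv hY Φ hΦ := by
    rw [dirDeriv_sum hv _ (fun i _ => (hL i).regular hY) hΦ]
    simp only [Finset.sum_apply, fun i => (hL i).deriv hv hY hΦ]

lemma IsLinOp.map_zero (hL : IsLinOp c L) : Set.EqOn (L 0) 0 (configs ι c) := fun Φ hΦ => by
  simpa only [zero_smul] using hL.smul (Y := 0) (fun _ => isRegular_zero) 0 hΦ

lemma IsLinOp.map_sum (hL : IsLinOp c L) {κ : Type*} (s : Finset κ) {Y : κ → Fin 4 → QField ι}
    (hY : ∀ i ∈ s, ∀ ν, IsRegular c (Y i ν)) :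
    Set.EqOn (L (∑ i ∈ s, Y i)) (∑ i ∈ s, L (Y i)) (configs ι c) := by
  classical
  induction s using Finset.induction_on with
  | empty => exact hL.map_zero
  | insert i s hi ih =>
    intro Φ hΦ
    have hs : ∀ j ∈ s, ∀ ν, IsRegular c (Y j ν) := fun j hj => hY j (Finset.mem_insert_of_mem hj)
    have hsum : ∀ ν, IsRegular c ((∑ j ∈ s, Y j) ν) := fun ν => by
      rw [Finset.sum_apply]
      exact IsRegular.sum s fun j hj => hs j hj ν
    rw [Finset.sum_insert hi, Finset.sum_insert hi,
      hL.add (hY i (Finset.mem_insert_self _ _)) hsum hΦ, Pi.add_apply, Pi.add_apply, ih hs hΦ]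

section Commute

variable (hL : IsLinOp c L) (hw : ∀ n, IsVariation c (w n)) {Y : Fin 4 → QField ι}
  (hY : ∀ k n ν, IsRegular c (flowCoeff w (Y ν) k n))
  (hdY : ∀ j k n ν, IsRegular c (dirDeriv (w j) (flowCoeff w (Y ν) k n)))

include hL hw hY hdY

lemma flowCoeff_isLinOp (k n : ℕ) :
    Set.EqOn (flowCoeff w (L Y) k n) (L fun ν => flowCoeff w (Y ν) k n) (configs ι c) := by
  induction k generalizing n with
  | zero =>
    simp only [flowCoeff_zero]
    split_ifs
    · exact fun _ _ => rfl
    · exact hL.map_zero.symm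
  | succ k ih =>
    intro Φ hΦ
    have hsum : (fun ν => flowCoeff w (Y ν) (k + 1) n) =
        ∑ p ∈ Finset.HasAntidiagonal.antidiagonal n, fun ν =>
          dirDeriv (w p.1) (flowCoeff w (Y ν) k p.2) := by
      ext1 ν
      rw [flowCoeff_succ, Finset.sum_apply]
    rw [hsum, hL.map_sum _ (fun p _ ν => hdY p.1 k p.2 ν) hΦ, flowCoeff_succ, Finset.sum_apply,
      Finset.sum_apply]
    refine Finset.sum_congr rfl fun p _ => ?_
    rw [dirDeriv_congr (hw p.1) (ih p.2) hΦ, hL.deriv (hw p.1) (hY k p.2) hΦ]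

lemma expFlow_isLinOp (n : ℕ) :
    Set.EqOn (expFlow w (L Y) n) (L fun ν => expFlow w (Y ν) n) (configs ι c) := by
  intro Φ hΦ
  have hsum : (fun ν => expFlow w (Y ν) n) = ∑ k ∈ Finset.range (n + 1),
      ((k.factorial : ℝ)⁻¹) • fun ν => flowCoeff w (Y ν) k n := by
    ext1 ν
    simp only [expFlow, Finset.sum_apply, Pi.smul_apply]
  rw [hsum, hL.map_sum (Y := fun k => ((k.factorial : ℝ)⁻¹) • fun ν => flowCoeff w (Y ν) k n) _
    (fun k _ ν => (hY k n ν).smul _) hΦ, expFlow, Finset.sum_apply, Finset.sum_apply]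
  refine Finset.sum_congr rfl fun k _ => ?_
  rw [hL.smul (hY k n) _ hΦ, Pi.smul_apply, Pi.smul_apply,
    flowCoeff_isLinOp hL hw hY hdY k n hΦ]

end Commute

end Flow

/-! ### The mediator field -/

section Mediator

variable {ι : Type*} [Fintype ι] {f : ι → ι → ι → ℝ} {c : StringFunction}
  {α : ℕ → Fin 4 → ι → Wick f c}

lemma omegaSeries_mediator (τ : Renormalization ι (spaceS f c)) (hα : ∀ n, α n ∈ spaceV f c) :
    omegaSeries τ (mediator α) = dSeries fun n => wickVec (α n) := by
  ext1 Y
  simp only [omegaSeries, dSeries, omega_mediator τ (hα _)]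
  rfl

lemma coeff_omegaSeries_mediator (τ : Renormalization ι (spaceS f c))
    (hα : ∀ n, α n ∈ spaceV f c) (X : QField ι) (n : ℕ) :
    coeff n (omegaSeries τ (mediator α) (C X)) = dirDeriv (wickVec (α n)) X := by
  rw [omegaSeries_mediator τ hα]
  exact flowCoeff_one (w := fun n => wickVec (α n)) X n

lemma coeff_expOmega_mediator (τ : Renormalization ι (spaceS f c))
    (hα : ∀ n, α n ∈ spaceV f c) (X : QField ι) (n : ℕ) :
    coeff n (expOmega τ (mediator α) (C X)) = expFlow (fun n => wickVec (α n)) X n := by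
  rw [expOmega, coeff_mk, omegaSeries_mediator τ hα]
  rfl

lemma isVariation_wickVec {u : Fin 4 → ι → Wick f c} (hu : u ∈ spaceV f c) :
    IsVariation c (wickVec u) :=
  isVariation_vecField hu

lemma exists_flowCoeff_fieldA (hα : ∀ n, α n ∈ spaceV f c) (k n : ℕ) : ∃ u ∈ spaceV f c, ∀ ν b,
    Set.EqOn (flowCoeff (fun n => wickVec (α n)) (fieldA ν b) k n) (wickVec u ν b)
      (configs ι c) := by
  induction k generalizing n with
  | zero =>
    by_cases hn : n = 0
    · refine ⟨vecA, vecA_mem, fun ν b Φ _ => ?_⟩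
      rw [flowCoeff_zero, if_pos hn, ← wickField_vecA (f := f) (c := c)]
      rfl
    · refine ⟨0, zero_mem _, fun ν b Φ _ => ?_⟩
      rw [flowCoeff_zero, if_neg hn, map_zero]
      rfl
  | succ k ih =>
    choose u hu hflow using ih
    choose x hx hderiv using fun p : ℕ × ℕ => exists_isDerivV (hα p.1) (hu p.2)
    refine ⟨∑ p ∈ Finset.HasAntidiagonal.antidiagonal n, x p,
      Submodule.sum_mem _ fun p _ => hx p, fun ν b Φ hΦ => ?_⟩
    rw [flowCoeff_succ, map_sum, Finset.sum_apply, Finset.sum_apply, Finset.sum_apply,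
      Finset.sum_apply]
    refine Finset.sum_congr rfl fun p _ => ?_
    rw [dirDeriv_congr (isVariation_wickVec (hα p.1)) (hflow p.2 ν b) hΦ]
    exact hderiv p ν b hΦ

lemma isRegular_flowCoeff_fieldA (hα : ∀ n, α n ∈ spaceV f c) (k n : ℕ) (ν : Fin 4) (b : ι) :
    IsRegular c (flowCoeff (fun n => wickVec (α n)) (fieldA ν b) k n) := by
  obtain ⟨u, hu, hflow⟩ := exists_flowCoeff_fieldA hα k n
  exact (isRegular_wickField hu ν b).congr (hflow ν b).symm

lemma isRegular_dirDeriv_flowCoeff_fieldA (hα : ∀ n, α n ∈ spaceV f c) (j k n : ℕ) (ν : Fin 4)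
    (b : ι) : IsRegular c
      (dirDeriv (wickVec (α j)) (flowCoeff (fun n => wickVec (α n)) (fieldA ν b) k n)) := by
  obtain ⟨u, hu, hflow⟩ := exists_flowCoeff_fieldA hα k n
  obtain ⟨x, hx, hderiv⟩ := exists_isDerivV (hα j) hu
  exact (isRegular_wickField hx ν b).congr
    ((dirDeriv_congr (isVariation_wickVec (hα j)) (hflow ν b)).trans (hderiv ν b)).symm

lemma exists_flowRest_fieldA (hα : ∀ n, α n ∈ spaceV f c) (n : ℕ) : ∃ u ∈ spaceV f c, ∀ ν b,
    Set.EqOn (flowRest (fun n => wickVec (α n)) (fieldA ν b) n) (wickVec u ν b)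
      (configs ι c) := by
  choose u hu hflow using fun k => exists_flowCoeff_fieldA hα (k + 2) (n + 1)
  refine ⟨∑ k ∈ Finset.range n, (((k + 2).factorial : ℝ)⁻¹) • u k,
    Submodule.sum_mem _ fun k _ => Submodule.smul_mem _ _ (hu k), fun ν b Φ hΦ => ?_⟩
  simp only [flowRest, map_sum, map_smul, Finset.sum_apply, Pi.smul_apply, hflow _ ν b hΦ]

/-- Since `expFlow` contains `α_{n+1}` at order `n + 1` only through the term
`dirDeriv α_{n+1} A = α_{n+1}`, the equation can be solved for `α_{n+1}`. -/
lemma exists_expFlow_fieldA_eqOn {B : ℕ → Fin 4 → ι → QField ι} (hB : ∀ n, B n ∈ fieldV f c)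
    (hB₀ : B 0 = fieldA) :
    ∃ α : ℕ → Fin 4 → ι → Wick f c, α 0 = 0 ∧ (∀ n, α n ∈ spaceV f c) ∧ ∀ n ν b,
      Set.EqOn (expFlow (fun n => wickVec (α n)) (fieldA ν b) n) (B n ν b) (configs ι c) := by
  obtain ⟨s, hs⟩ := exists_seq_of_step (M := spaceV f c)
    (fun n a x => (n = 0 → x = 0) ∧ ∀ m, n = m + 1 → ∀ ν b, Set.EqOn (wickVec x.1 ν b)
      (B n ν b - flowRest (fun n => wickVec (a n).1) (fieldA ν b) m) (configs ι c)) (by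
    intro n a
    cases n with
    | zero => exact ⟨0, fun _ => rfl, fun m hm => by omega⟩
    | succ n =>
      obtain ⟨x, hx, hxB⟩ := hB (n + 1)
      obtain ⟨u, hu, hrest⟩ := exists_flowRest_fieldA (fun n => (a n).2) n
      refine ⟨⟨x - u, sub_mem hx hu⟩, fun h => by omega, fun m hm ν b Φ hΦ => ?_⟩
      obtain rfl : n = m := by omega
      rw [map_sub, hxB, Pi.sub_apply, Pi.sub_apply, Pi.sub_apply, Pi.sub_apply, hrest ν b hΦ])
  have hs₀ : s 0 = 0 := (hs 0).1 rfl
  refine ⟨fun n => (s n).1, congrArg Subtype.val hs₀, fun n => (s n).2, fun n ν b Φ hΦ => ?_⟩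
  cases n with
  | zero => rw [expFlow_zero, hB₀]
  | succ n =>
    have hrest : flowRest (fun n => wickVec (s n).1) (fieldA ν b) n =
        flowRest (fun j => wickVec (if j < n + 1 then s j else 0 : spaceV f c).1)
          (fieldA ν b) n :=
      flowRest_congr (by simp [hs₀]) (by simp [hs₀]) _ fun j hj => by rw [if_pos (by omega)]
    rw [expFlow_succ, dirDeriv_fieldA, Pi.add_apply, (hs (n + 1)).2 n rfl ν b hΦ, Pi.sub_apply,
      ← hrest]
    exact sub_add_cancel _ _

end Mediator

/-! ### The dressed fields -/

section Curl

variable {ι : Type*} {c : StringFunction}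

/-- The curl `∂_μ Y_ν - ∂_ν Y_μ` of a vector field. -/
def curl (Y : Fin 4 → QField ι) (μ ν : Fin 4) : QField ι := fieldPd μ (Y ν) - fieldPd ν (Y μ)

lemma isLinOp_curl (μ ν : Fin 4) : IsLinOp c fun Y : Fin 4 → QField ι => curl Y μ ν :=
  ((isLinOp_apply ν).fieldPd μ).sub ((isLinOp_apply μ).fieldPd ν)

lemma isRegular_fieldF (μ ν : Fin 4) (a : ι) : IsRegular c (fieldF μ ν a) :=
  (isLinOp_curl μ ν).regular fun ρ => isRegular_fieldA ρ a

lemma dirDeriv_fieldF {v : Fin 4 → ι → QField ι} (hv : IsVariation c v) (μ ν : Fin 4) (a : ι) :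
    Set.EqOn (dirDeriv v (fieldF μ ν a)) (curl (fun ρ => v ρ a) μ ν) (configs ι c) := by
  have hderiv := (isLinOp_curl μ ν).deriv hv fun ρ => isRegular_fieldA (c := c) ρ a
  simp only [dirDeriv_fieldA] at hderiv
  exact hderiv

variable {Y : Fin 4 → QField ι}

lemma sum_fieldInt_curl (hY : ∀ ν, IsRegular c (Y ν)) (μ : Fin 4) :
    Set.EqOn (∑ ν, fieldInt c ν (curl Y μ ν))
      (fieldPd μ (∑ ν, fieldInt c ν (Y ν)) + Y μ) (configs ι c) := by
  intro Φ hΦ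
  have hcurl : ∀ ν, fieldInt c ν (curl Y μ ν) Φ =
      pd μ (fieldInt c ν (Y ν) Φ) - fieldInt c ν (fieldPd ν (Y μ)) Φ := fun ν => by
    rw [curl, sub_eq_add_neg, ← neg_one_smul ℝ, fieldInt_add_apply ((hY ν).fieldPd μ)
      (((hY μ).fieldPd ν).smul _) hΦ, fieldInt_smul_apply ((hY μ).fieldPd ν) hΦ, neg_one_smul,
      ← sub_eq_add_neg]
    exact congrArg (· - _) (pd_stringInt ((hY ν).admissible hΦ) ν μ).symm
  have hdiv := sum_fieldInt_fieldPd (hY μ) hΦ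
  rw [Finset.sum_apply] at hdiv
  rw [Finset.sum_apply, Pi.add_apply, fieldPd, Finset.sum_apply,
    pd_sum _ fun ν _ => (((hY ν).fieldInt ν).admissible hΦ).differentiable]
  simp only [hcurl]
  rw [Finset.sum_sub_distrib, hdiv, sub_neg_eq_add]

lemma curl_fieldPd_add {Z : QField ι} (hZ : IsRegular c Z) (hY : ∀ ν, IsRegular c (Y ν))
    (μ ν : Fin 4) :
    Set.EqOn (curl (fun ρ => fieldPd ρ Z + Y ρ) μ ν) (curl Y μ ν) (configs ι c) := by
  intro Φ hΦ
  have hpd : ∀ κ ρ, pd κ ((fieldPd ρ Z + Y ρ) Φ) = pd κ (pd ρ (Z Φ)) + pd κ (Y ρ Φ) := fun κ ρ =>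
    pd_add ((hZ.fieldPd ρ).admissible hΦ).differentiable ((hY ρ).admissible hΦ).differentiable κ
  change pd μ ((fieldPd ν Z + Y ν) Φ) - pd ν ((fieldPd μ Z + Y μ) Φ) =
    pd μ (Y ν Φ) - pd ν (Y μ Φ)
  rw [hpd, hpd, pd_pd_comm (hZ.admissible hΦ).contDiff ν μ, add_sub_add_left_eq_sub]

end Curl

section DressedFields

variable {ι : Type*} [Fintype ι] {f : ι → ι → ι → ℝ} {c : StringFunction}
  {α : ℕ → Fin 4 → ι → Wick f c} {B : ℕ → Fin 4 → ι → QField ι} (hα : ∀ n, α n ∈ spaceV f c)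
  (hflow : ∀ n ν b,
    Set.EqOn (expFlow (fun n => wickVec (α n)) (fieldA ν b) n) (B n ν b) (configs ι c))

include hα hflow

lemma expFlow_isLinOp_fieldA {L : (Fin 4 → QField ι) → QField ι} (hL : IsLinOp c L) (n : ℕ)
    (a : ι) :
    Set.EqOn (expFlow (fun n => wickVec (α n)) (L fun ν => fieldA ν a) n) (L fun ν => B n ν a)
      (configs ι c) :=
  (expFlow_isLinOp hL (fun n => isVariation_wickVec (hα n))
    (fun k n ν => isRegular_flowCoeff_fieldA hα k n ν a)
    (fun j k n ν => isRegular_dirDeriv_flowCoeff_fieldA hα j k n ν a) n).trans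
    (hL.congr fun ν => hflow n ν a)

lemma expFlow_fieldF (n : ℕ) (μ ν : Fin 4) (a : ι) :
    Set.EqOn (expFlow (fun n => wickVec (α n)) (fieldF μ ν a) n) (curl (fun ρ => B n ρ a) μ ν)
      (configs ι c) :=
  expFlow_isLinOp_fieldA hα hflow (isLinOp_curl μ ν) n a

variable (hB : ∀ n, B n ∈ fieldV f c)

include hB

lemma expFlow_fieldAc (n : ℕ) (μ : Fin 4) (a : ι) :
    Set.EqOn (expFlow (fun n => wickVec (α n)) (fieldAc c μ a) n)
      (fieldPd μ (∑ ν, fieldInt c ν (B n ν a)) + B n μ a) (configs ι c) :=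
  (expFlow_isLinOp_fieldA hα hflow (.sum fun ν => (isLinOp_curl μ ν).fieldInt ν) n a).trans
    (sum_fieldInt_curl (fun ν => isRegular_of_mem_fieldV (hB n) ν a) μ)

lemma expFlow_fieldF_eqOn_curl (n : ℕ) (μ ν : Fin 4) (a : ι) :
    Set.EqOn (expFlow (fun n => wickVec (α n)) (fieldF μ ν a) n)
      (curl (fun ρ => expFlow (fun n => wickVec (α n)) (fieldAc c ρ a) n) μ ν)
      (configs ι c) := by
  have hreg := fun ρ => isRegular_of_mem_fieldV (hB n) ρ a
  refine (expFlow_fieldF hα hflow n μ ν a).trans (.symm ?_)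
  exact ((isLinOp_curl μ ν).congr fun ρ => expFlow_fieldAc hα hflow hB n ρ a).trans
    (curl_fieldPd_add (.sum _ fun ρ _ => (hreg ρ).fieldInt ρ) hreg μ ν)

end DressedFields

section GaugePotential

variable {ι : Type*} [Fintype ι] {f : ι → ι → ι → ℝ} {c : StringFunction} {γ : ℕ → ι → QField ι}

/-- The deformation of `A` generated by the flow: the gauge transformed potential
`W (A + i g⁻¹ ∂) W⁻¹`, without the pure gauge term `∂γ₁` at order zero. The index is shifted by one,
since `gaugeCoeff` is the transform of `g A`. -/
def gaugePotential (f : ι → ι → ι → ℝ) (γ : ℕ → ι → QField ι) : ℕ → Fin 4 → ι → QField ι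
  | 0 => fieldA
  | n + 1 => fun ν b => gaugeCoeff f γ ν (n + 2) b

lemma gaugePotential_mem_fieldV (hγ : ∀ n, γ n ∈ spaceS f c) (n : ℕ) :
    gaugePotential f γ n ∈ fieldV f c := by
  cases n with
  | zero => exact fieldA_mem_fieldV
  | succ n => exact gaugeCoeff_mem_fieldV hγ (n + 2)

variable (hγ : ∀ n, γ n ∈ spaceS f c)
  (hint : ∀ n a,
    Set.EqOn (γ (n + 1) a) (∑ ν, fieldInt c ν (gaugeRest f γ ν n a)) (configs ι c))

include hγ hint

lemma sum_fieldInt_gaugeCoeff (n : ℕ) (a : ι) :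
    Set.EqOn (∑ ν, fieldInt c ν (gaugeCoeff f γ ν (n + 1) a)) 0 (configs ι c) := by
  intro Φ hΦ
  have hreg := isRegular_of_mem_spaceS (hγ (n + 1)) a
  have hdiv := sum_fieldInt_fieldPd hreg hΦ
  have hint' := hint n a hΦ
  rw [Finset.sum_apply] at hdiv hint' ⊢
  simp only [gaugeCoeff_succ, fieldInt_add_apply
    (isRegular_of_mem_fieldV (gaugeRest_mem_fieldV hγ n) _ a) (hreg.fieldPd _) hΦ]
  rw [Finset.sum_add_distrib, hdiv, ← hint', add_neg_cancel, Pi.zero_apply]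

lemma fieldPd_sum_fieldInt_gaugePotential (hγ₀ : γ 0 = 0) (n : ℕ) (μ : Fin 4) (a : ι) :
    Set.EqOn (fieldPd μ (∑ ν, fieldInt c ν (gaugePotential f γ n ν a)) + gaugePotential f γ n μ a)
      (gaugeCoeff f γ μ (n + 1) a) (configs ι c) := by
  intro Φ hΦ
  cases n with
  | zero =>
    have hint₀ := hint 0 a hΦ
    simp only [gaugeRest_zero hγ₀] at hint₀
    rw [gaugeCoeff_succ, gaugeRest_zero hγ₀, Pi.add_apply, Pi.add_apply, fieldPd, fieldPd, hint₀,
      add_comm]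
    rfl
  | succ n =>
    simp only [gaugePotential, Pi.add_apply, fieldPd]
    rw [sum_fieldInt_gaugeCoeff hγ hint (n + 1) a hΦ, Pi.zero_apply, pd_zero, zero_add]

end GaugePotential

section GaugeTransform

variable {ι : Type*} [Fintype ι] {𝔤 : Type*} [LieRing 𝔤] [LieAlgebra ℝ 𝔤] {d : ℕ}
  (π : HermitianRep 𝔤 d) (ξ : Module.Basis ι ℝ 𝔤) {c : StringFunction} {γ : ℕ → ι → QField ι}

lemma matEqOnConf_gaugeTransform (hγ₀ : γ 0 = 0) (hγ : ∀ n a, IsRegular c (γ n a)) {μ : Fin 4}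
    {Y : ι → (QField ι)⟦X⟧} (hY : ∀ n a,
      Set.EqOn (coeff n (Y a)) (gaugeCoeff (strConst ξ) γ μ (n + 1) a) (configs ι c)) :
    MatEqOnConf (configs ι c) (X * repSeries π ξ Y)
      (dressingFactor π ξ γ * (X * repSeries π ξ fun a => C (fieldA μ a)) *
          dressingFactor π ξ (-γ) +
        Complex.I • (dressingFactor π ξ γ * matPd μ (dressingFactor π ξ (-γ)))) := by
  intro n i j Φ hΦ
  have hcoeff : ∀ a, (coeff n (X * Y a) : QField ι) Φ = gaugeCoeff (strConst ξ) γ μ n a Φ :=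
    fun a => by
      cases n with
      | zero => rw [coeff_zero_X_mul, gaugeCoeff_zero]
      | succ n => rw [coeff_succ_X_mul, hY n a hΦ]
  rw [coeff_gaugeTransform π ξ hγ₀ fun n a => ((hγ n a).admissible hΦ).differentiable,
    X_mul_repSeries]
  simp only [← hcoeff]
  rw [repSeries, coeff_mk]
  rfl

end GaugeTransform

/-! ### The divergence of the mediator field -/

section Lagrangian

lemma sum_antisymm_mul_sub {κ ι R : Type*} [Fintype κ] [Fintype ι] [CommRing R] (s : κ → R)
    {g : κ → κ → ι → R} (hg : ∀ μ ν a, g μ ν a = -g ν μ a) (d : κ → κ → ι → R) :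
    ∑ μ, ∑ ν, ∑ a, s μ * s ν * (g μ ν a * (d μ ν a - d ν μ a)) =
      2 * ∑ μ, ∑ ν, ∑ a, s μ * s ν * (g μ ν a * d μ ν a) := by
  have hswap : ∑ μ, ∑ ν, ∑ a, s μ * s ν * (g μ ν a * d ν μ a) =
      -∑ μ, ∑ ν, ∑ a, s μ * s ν * (g μ ν a * d μ ν a) := by
    rw [Finset.sum_comm]
    simp only [← Finset.sum_neg_distrib]
    refine Finset.sum_congr rfl fun μ _ => Finset.sum_congr rfl fun ν _ =>
      Finset.sum_congr rfl fun a _ => ?_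
    rw [hg ν μ a]
    ring
  simp only [mul_sub, Finset.sum_sub_distrib]
  rw [hswap]
  ring

variable {ι : Type*} {c : StringFunction} {Φ : Conf ι}

lemma sum_pd_fieldF (hΦ : Φ ∈ onShell ι c) (ν : Fin 4) (a : ι) (x : Spacetime) :
    ∑ μ, sgn μ * pd μ (fieldF μ ν a Φ) x = -pd ν (Φ.2 a) x := by
  obtain ⟨hconf, hbox, hnull⟩ := hΦ
  have hA : ∀ μ, Admissible c (Φ.1 μ a) := fun μ => hconf.1 μ a
  have hF : ∀ μ, pd μ (fieldF μ ν a Φ) = pd μ (pd μ (Φ.1 ν a)) - pd ν (pd μ (Φ.1 μ a)) :=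
    fun μ => by
      rw [pd_pd_comm (hA μ).contDiff ν μ,
        ← pd_sub ((hA ν).pd μ).differentiable ((hA μ).pd ν).differentiable]
      rfl
  have hN : Φ.2 a = ∑ μ, sgn μ • pd μ (Φ.1 μ a) := by
    ext y
    rw [hnull a y, Finset.sum_apply]
    rfl
  rw [hN, pd_sum _ fun μ _ => (((hA μ).pd μ).smul _).differentiable, Finset.sum_apply]
  simp only [hF, fun μ => pd_smul ((hA μ).pd μ).differentiable (sgn μ) ν, Pi.sub_apply, mul_sub,
    Finset.sum_sub_distrib, hbox, zero_sub, Pi.smul_apply, smul_eq_mul]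

variable [Fintype ι] {f : ι → ι → ι → ℝ}

lemma dirDeriv_fieldK0_apply {v : Fin 4 → ι → QField ι} (hv : IsVariation c v)
    (hΦ : Φ ∈ configs ι c) (x : Spacetime) :
    dirDeriv v fieldK0 Φ x =
      -∑ μ, ∑ ν, ∑ a, sgn μ * sgn ν * (fieldF μ ν a Φ x * pd μ (v ν a Φ) x) := by
  have hF : ∀ p : Fin 4 × Fin 4 × ι, IsRegular c (fieldF p.1 p.2.1 p.2.2) := fun p =>
    isRegular_fieldF p.1 p.2.1 p.2.2
  have hterm : ∀ p : Fin 4 × Fin 4 × ι, dirDeriv v ((sgn p.1 * sgn p.2.1) •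
        (fieldF p.1 p.2.1 p.2.2 * fieldF p.1 p.2.1 p.2.2)) Φ x =
      2 * (sgn p.1 * sgn p.2.1 * (fieldF p.1 p.2.1 p.2.2 Φ x *
        (pd p.1 (v p.2.1 p.2.2 Φ) x - pd p.2.1 (v p.1 p.2.2 Φ) x))) := fun p => by
    rw [dirDeriv_smul hv ((hF p).mul (hF p)) _ hΦ, Pi.smul_apply, dirDeriv_mul hv (hF p) (hF p) hΦ]
    simp only [Pi.smul_apply, Pi.add_apply, Pi.mul_apply, dirDeriv_fieldF hv _ _ _ hΦ, curl,
      Pi.sub_apply, fieldPd, smul_eq_mul]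
    ring
  have hK₀ : (fieldK0 : QField ι) = (-(1 / 4) : ℝ) • ∑ p : Fin 4 × Fin 4 × ι,
      (sgn p.1 * sgn p.2.1) • (fieldF p.1 p.2.1 p.2.2 * fieldF p.1 p.2.1 p.2.2) := by
    simp only [fieldK0, Fintype.sum_prod_type]
  have hreg : ∀ p ∈ (Finset.univ : Finset (Fin 4 × Fin 4 × ι)), IsRegular c
      ((sgn p.1 * sgn p.2.1) • (fieldF p.1 p.2.1 p.2.2 * fieldF p.1 p.2.1 p.2.2)) := fun p _ =>
    ((hF p).mul (hF p)).smul _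
  rw [hK₀, dirDeriv_smul hv (.sum _ hreg) _ hΦ, Pi.smul_apply, dirDeriv_sum hv _ hreg hΦ]
  rw [Pi.smul_apply, Finset.sum_apply, Finset.sum_apply, Finset.sum_congr rfl fun p _ => hterm p,
    ← Finset.mul_sum]
  simp only [Fintype.sum_prod_type, smul_eq_mul]
  rw [sum_antisymm_mul_sub sgn (g := fun μ ν a => fieldF μ ν a Φ x)
    (fun μ ν a => by rw [fieldF_antisymm]; rfl) fun μ ν a => pd μ (v ν a Φ) x]
  ring

lemma pd_wickField_mediator {α : ℕ → Fin 4 → ι → Wick f c} {n : ℕ} (hα : α n ∈ spaceV f c)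
    (hΦ : Φ ∈ configs ι c) (μ : Fin 4) (x : Spacetime) :
    pd μ (wickField (mediator α n μ) Φ) x = ∑ ν, ∑ a, sgn μ * sgn ν *
      (pd μ (fieldF μ ν a Φ) x * wickField (α n ν a) Φ x +
        fieldF μ ν a Φ x * pd μ (wickField (α n ν a) Φ) x) := by
  have hF : ∀ p : Fin 4 × ι, Admissible c (fieldF μ p.1 p.2 Φ) := fun p =>
    (isRegular_fieldF μ p.1 p.2).admissible hΦ
  have hα' : ∀ p : Fin 4 × ι, Admissible c (wickField (α n p.1 p.2) Φ) := fun p =>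
    (isRegular_wickField hα p.1 p.2).admissible hΦ
  have hU : wickField (mediator α n μ) Φ = ∑ p : Fin 4 × ι, (sgn μ * sgn p.1) •
      (fieldF μ p.1 p.2 Φ * wickField (α n p.1 p.2) Φ) := by
    simp only [mediator, map_sum, map_smul, map_mul, Finset.sum_apply, wickField_X_F,
      Fintype.sum_prod_type]
    rfl
  rw [hU, pd_sum _ fun p _ => (((hF p).mul (hα' p).contDiff).smul _).differentiable,
    Finset.sum_apply, Fintype.sum_prod_type]
  refine Finset.sum_congr rfl fun ν _ => Finset.sum_congr rfl fun a _ => ?_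
  rw [pd_smul ((hF (ν, a)).mul (hα' (ν, a)).contDiff).differentiable,
    pd_mul (hF (ν, a)).differentiable (hα' (ν, a)).differentiable]
  rfl

lemma sum_fieldPd_mediator_add_dirDeriv_fieldK0 {α : ℕ → Fin 4 → ι → Wick f c} {n : ℕ}
    (hα : α n ∈ spaceV f c) :
    Set.EqOn (∑ μ, fieldPd μ (wickField (mediator α n μ)) + dirDeriv (wickVec (α n)) fieldK0)
      (-∑ ν, ∑ a, sgn ν • (fieldPd ν (fieldN a) * wickField (α n ν a))) (onShell ι c) := by
  intro Φ hΦ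
  ext x
  let T (μ ν : Fin 4) (a : ι) := pd μ (fieldF μ ν a Φ) x * wickField (α n ν a) Φ x
  have hleft : (∑ μ, fieldPd μ (wickField (mediator α n μ)) +
      dirDeriv (wickVec (α n)) fieldK0) Φ x = ∑ μ, ∑ ν, ∑ a, sgn μ * sgn ν * T μ ν a := by
    rw [Pi.add_apply, Pi.add_apply, dirDeriv_fieldK0_apply (isVariation_wickVec hα) hΦ.1,
      Finset.sum_apply, Finset.sum_apply]
    simp only [fieldPd, pd_wickField_mediator hα hΦ.1, mul_add, Finset.sum_add_distrib]
    exact add_neg_cancel_right _ _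
  have heqn : ∀ ν a, ∑ μ, sgn μ * sgn ν * T μ ν a =
      -(sgn ν * (pd ν (Φ.2 a) x * wickField (α n ν a) Φ x)) := fun ν a => calc
    _ = sgn ν * wickField (α n ν a) Φ x * ∑ μ, sgn μ * pd μ (fieldF μ ν a Φ) x := by
      rw [Finset.mul_sum]
      exact Finset.sum_congr rfl fun μ _ => by ring
    _ = _ := by rw [sum_pd_fieldF hΦ]; ring
  rw [hleft, Finset.sum_comm]
  simp only [Pi.neg_apply, Finset.sum_apply, Pi.smul_apply, Pi.mul_apply, smul_eq_mul,
    ← Finset.sum_neg_distrib]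
  refine Finset.sum_congr rfl fun ν _ => ?_
  rw [Finset.sum_comm]
  exact Finset.sum_congr rfl fun a _ => heqn ν a

end Lagrangian

end StringYM

end

open StringYM PowerSeries in
theorem propositionp_general {𝔤 : Type*} [LieRing 𝔤] [LieAlgebra ℝ 𝔤] {ι : Type*} [Fintype ι]
    (ξ : Module.Basis ι ℝ 𝔤) (c : StringFunction) :
    ∃ (α : ℕ → Fin 4 → ι → Wick (strConst ξ) c) (γ : ℕ → ι → QField ι),
      (α 0 = 0 ∧ ∀ n, α n ∈ spaceV (strConst ξ) c) ∧
      (γ 0 = 0 ∧ ∀ n, γ n ∈ spaceS (strConst ξ) c) ∧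
      (∀ (d : ℕ) (π : HermitianRep 𝔤 d),
        dressingFactor π ξ γ * dressingFactor π ξ (-γ) = 1 ∧
        dressingFactor π ξ (-γ) * dressingFactor π ξ γ = 1 ∧
        StringLocalized c (dressingFactor π ξ γ)) ∧
      ∀ τ : Renormalization ι (spaceS (strConst ξ) c),
        (∀ (d : ℕ) (π : HermitianRep 𝔤 d) (μ : Fin 4),
          MatEqOnConf (configs ι c)
            (X * repSeries π ξ fun a => expOmega τ (mediator α) (C (fieldAc c μ a)))
            (dressingFactor π ξ γ * (X * repSeries π ξ fun a => C (fieldA μ a)) *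
                dressingFactor π ξ (-γ) +
              Complex.I • (dressingFactor π ξ γ * matPd μ (dressingFactor π ξ (-γ))))) ∧
        (∀ μ ν a, EqOnConf (configs ι c)
          (expOmega τ (mediator α) (C (fieldF μ ν a)))
          (PowerSeries.mk fun n =>
            fieldPd μ (coeff n (expOmega τ (mediator α) (C (fieldAc c ν a)))) -
            fieldPd ν (coeff n (expOmega τ (mediator α) (C (fieldAc c μ a)))))) ∧
        (∀ a, EqOnConf (configs ι c) (omegaSeries τ (mediator α) (C (fieldN a))) 0) ∧
        (∀ κ a, EqOnConf (configs ι c)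
          (omegaSeries τ (mediator α) (C (fieldPd κ (fieldN a)))) 0) ∧
        EqOnConf (onShell ι c)
          ((PowerSeries.mk fun n => ∑ μ, fieldPd μ (wickField (mediator α n μ))) +
            omegaSeries τ (mediator α) (C fieldK0))
          (PowerSeries.mk fun n => -∑ ν, ∑ a, sgn ν •
            (fieldPd ν (fieldN a) * wickField (α n ν a))) := by
  obtain ⟨γ, hγ₀, hγ, hint⟩ := exists_axial_gauge (strConst ξ) c
  have hγreg := fun n a => isRegular_of_mem_spaceS (hγ n) a
  have hB := gaugePotential_mem_fieldV hγ
  obtain ⟨α, hα₀, hα, hflow⟩ := exists_expFlow_fieldA_eqOn hB rfl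
  refine ⟨α, γ, ⟨hα₀, hα⟩, ⟨hγ₀, hγ⟩, fun d π => ⟨dressingFactor_mul_neg π ξ hγ₀,
    dressingFactor_neg_mul π ξ hγ₀, stringLocalized_dressingFactor π ξ hγreg⟩, fun τ =>
    ⟨fun d π μ => matEqOnConf_gaugeTransform π ξ hγ₀ hγreg fun n a => ?_,
      fun μ ν a n => ?_, fun a n => ?_, fun κ a n => ?_, fun n Φ hΦ => ?_⟩⟩
  · rw [coeff_expOmega_mediator τ hα]
    exact (expFlow_fieldAc hα hflow hB n μ a).trans
      (fieldPd_sum_fieldInt_gaugePotential hγ hint hγ₀ n μ a)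
  · simp only [coeff_mk, coeff_expOmega_mediator τ hα]
    exact expFlow_fieldF_eqOn_curl hα hflow hB n μ ν a
  · rw [coeff_omegaSeries_mediator τ hα, dirDeriv_fieldN, map_zero]
    exact fun _ _ => rfl
  · rw [coeff_omegaSeries_mediator τ hα, dirDeriv_fieldPd_fieldN, map_zero]
    exact fun _ _ => rfl
  · rw [map_add, coeff_mk, coeff_mk, coeff_omegaSeries_mediator τ hα]
    exact sum_fieldPd_mediator_add_dirDeriv_fieldK0 (hα n) hΦ

theorem propositionp {𝔤 : Type*} [LieRing 𝔤] [LieAlgebra ℝ 𝔤] {ι : Type*} [Fintype ι]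
    (ξ : Module.Basis ι ℝ 𝔤)
    (hξ : ∀ a b k, StringYM.strConst ξ a b k = StringYM.strConst ξ b k a)
    (c : StringYM.StringFunction) :
    ∃ (α : ℕ → Fin 4 → ι → StringYM.Wick (StringYM.strConst ξ) c)
      (γ : ℕ → ι → StringYM.QField ι),
      -- `α ∈ g 𝒱[[g]]` and `γ ∈ g 𝒮[[g]]`
      (α 0 = 0 ∧ ∀ n, α n ∈ StringYM.spaceV (StringYM.strConst ξ) c) ∧
      (γ 0 = 0 ∧ ∀ n, γ n ∈ StringYM.spaceS (StringYM.strConst ξ) c) ∧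
      -- `W = e^{iγ}` has the inverse `e^{-iγ}` and is string-localized
      (∀ (d : ℕ) (π : StringYM.HermitianRep 𝔤 d),
        StringYM.dressingFactor π ξ γ * StringYM.dressingFactor π ξ (-γ) = 1 ∧
        StringYM.dressingFactor π ξ (-γ) * StringYM.dressingFactor π ξ γ = 1 ∧
        StringYM.StringLocalized c (StringYM.dressingFactor π ξ γ)) ∧
      ∀ τ : StringYM.Renormalization ι (StringYM.spaceS (StringYM.strConst ξ) c),
        -- `g e^{ω_U}(A_μ(c)) = W (g A_μ + i ∂_μ) W⁻¹`
        (∀ (d : ℕ) (π : StringYM.HermitianRep 𝔤 d) (μ : Fin 4),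
          StringYM.MatEqOnConf (StringYM.configs ι c)
            (PowerSeries.X * StringYM.repSeries π ξ fun a =>
              StringYM.expOmega τ (StringYM.mediator α) (PowerSeries.C (StringYM.fieldAc c μ a)))
            (StringYM.dressingFactor π ξ γ *
                (PowerSeries.X * StringYM.repSeries π ξ fun a =>
                  PowerSeries.C (StringYM.fieldA μ a)) *
                StringYM.dressingFactor π ξ (-γ) +
              Complex.I • (StringYM.dressingFactor π ξ γ *
                StringYM.matPd μ (StringYM.dressingFactor π ξ (-γ))))) ∧
        -- `e^{ω_U}(F_{μν}) = ∂_μ e^{ω_U}(A_ν(c)) - ∂_ν e^{ω_U}(A_μ(c))`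
        (∀ μ ν a, StringYM.EqOnConf (StringYM.configs ι c)
          (StringYM.expOmega τ (StringYM.mediator α) (PowerSeries.C (StringYM.fieldF μ ν a)))
          (PowerSeries.mk fun n =>
            StringYM.fieldPd μ (PowerSeries.coeff n (StringYM.expOmega τ (StringYM.mediator α)
              (PowerSeries.C (StringYM.fieldAc c ν a)))) -
            StringYM.fieldPd ν (PowerSeries.coeff n (StringYM.expOmega τ (StringYM.mediator α)
              (PowerSeries.C (StringYM.fieldAc c μ a)))))) ∧
        -- `ω_U(N) = ω_U(∂N) = 0`
        (∀ a, StringYM.EqOnConf (StringYM.configs ι c)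
          (StringYM.omegaSeries τ (StringYM.mediator α)
            (PowerSeries.C (StringYM.fieldN a))) 0) ∧
        (∀ κ a, StringYM.EqOnConf (StringYM.configs ι c)
          (StringYM.omegaSeries τ (StringYM.mediator α)
            (PowerSeries.C (StringYM.fieldPd κ (StringYM.fieldN a)))) 0) ∧
        -- `∂_μ U^μ + ω_U(K₀) = -⟨∂^ν N|α_ν⟩` by the field equations
        StringYM.EqOnConf (StringYM.onShell ι c)
          ((PowerSeries.mk fun n => ∑ μ,
              StringYM.fieldPd μ (StringYM.wickField (StringYM.mediator α n μ))) +
            StringYM.omegaSeries τ (StringYM.mediator α) (PowerSeries.C StringYM.fieldK0))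
          (PowerSeries.mk fun n => -∑ ν, ∑ a, StringYM.sgn ν •
            (StringYM.fieldPd ν (StringYM.fieldN a) * StringYM.wickField (α n ν a))) :=
  propositionp_general ξ c
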